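/- Let $\mathbb{T}^3=\mathbb{R}^3/(2\pi\mathbb{Z})^3$ and let $\mu,\kappa,\alpha,\beta,\gamma,\tau,\lambda,\nu$ be real constants with $\mu,\ \kappa,\ \alpha+\tfrac{4\beta}{3},\ \beta+\gamma,\ \tau,\ \lambda,\ \nu>0$. Put $\tilde\mu=\mu+\kappa/2$, $\tilde\alpha=\alpha+4\beta/3$, $\tilde\gamma=\beta+\gamma$, $\omega_{eq}=\frac{\tau}{2\kappa}e_3$, $J_{eq}=\mathrm{diag}(\lambda,\lambda,\nu)$; for $w\in\mathbb{R}^3$ let $[w]_\times$ be the matrix with $[w]_\times v=w\times v$, put $\Omega=[\omega]_\times$, $\Omega_{eq}=[\omega_{eq}]_\times$, and let $[A,B]=AB-BA$. For $T>0$, consider strong solutions $Z=(u,\omega,J)$ on $[0,T]$, with $u,\omega$ valued in $\mathbb{R}^3$, $J$ valued in symmetric $3\times3$ matrices, and a pressure $p(t)\in H^1(\mathbb{T}^3)$ for a.e. $t$, of the equations of a micropolar fluid perturbed about the equilibrium $(0,\omega_{eq},J_{eq})$: that is, $Z\in L^\infty(0,T;H^2)$, $\partial_tZ\in L^\infty(0,T;L^2)$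 (so $Z$ is a Lipschitz curve in $L^2$ and $Z(t)$ is defined for every $t\in[0,T]$), and almost everywhere in $(0,T)\times\mathbb{T}^3$, $\nabla\cdot u=0$ and $$\partial_t u=\tilde\mu\Delta u+\kappa\nabla\times\omega-\nabla p-(u\cdot\nabla)u,$$ $$J_{eq}\,\partial_t\omega = F-P - J_{eq}(u\cdot\nabla)\omega-(I+JJ_{eq}^{-1})^{-1}Q-JJ_{eq}^{-1}(I+JJ_{eq}^{-1})^{-1}(F-P),$$ $$\partial_tJ=[\Omega_{eq},J]+[\Omega,J_{eq}]+[\Omega,J]-(u\cdot\nabla)J,$$ where $F=\kappa\nabla\times u-2\kappa\omega+(\tilde\alpha-\tilde\gamma)\nabla(\nabla\cdot\omega)+\tilde\gamma\Delta\omega$, $P=\omega\times J_{eq}\omega_{eq}+\omega_{eq}\times J\omega_{eq}+\omega_{eq}\times J_{eq}\omega$ and $Q=\omega\times J\omega+\omega_{eq}\times J\omega+\omega\times J_{eq}\omega+\omega\times J\omega_{eq}$. Write $\bar\omega=(\omega_1,\omega_2)$, $a=(J_{13},J_{23})$ and $E_{\mathrm{ins}}(t)=\|\bar\omega(t)\|_{L^2}^2+\|a(t)\|_{L^2}^2$.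 Then there is $0<\delta_B<1$, depending only on the constants above, such that for every $\psi>0$ there is $C(\psi)>0$, depending only on $\psi$ and the constants above, with the following property. For every $T>0$ and every such solution $Z$ on $[0,T]$ with $\sup_{0\le t\le T}\|Z(t)\|_{H^4}\le\delta_B$, and for every $C_{\mathrm{ins}}>0$: if $E_{\mathrm{ins}}(t)\le C_{\mathrm{ins}}e^{\psi t}$ for all $0<t\le T$, then for all $0\le t\le T$ $$\|Z(t)\|_{H^4}^2\le C(\psi)\left(\|Z(0)\|_{H^4}^2+C_{\mathrm{ins}}\right)e^{\psi t}.$$ -/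

import Mathlib

open MeasureTheory Set
open scoped Matrix

noncomputable section

namespace Micropolar

/-! ### The torus, weak derivatives and Sobolev norms -/

instance instFactTwoPiPos : Fact (0 < 2 * Real.pi) := Fact.mk Real.two_pi_pos

/-- The torus `ℝ³ / (2πℤ)³`, with the product of the Lebesgue measures (total mass `(2π)³`). -/
abbrev T3 : Type := Fin 3 → AddCircle (2 * Real.pi)

/-- Real-valued `L²(𝕋³)`. -/
abbrev L2 : Type := Lp ℝ 2 (volume : Measure T3)

/-- Smooth functions on the torus: the `2π`-periodic lift to `ℝ³` is `C^∞`. -/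
def IsSmooth (φ : T3 → ℝ) : Prop :=
  ContDiff ℝ ((⊤ : ℕ∞) : WithTop ℕ∞)
    (fun y : Fin 3 → ℝ => φ (fun i => ((y i : ℝ) : AddCircle (2 * Real.pi))))

/-- The classical partial derivative in the direction `e_j` of a function on the torus. -/
def pderiv (j : Fin 3) (φ : T3 → ℝ) (x : T3) : ℝ :=
  deriv (fun s : ℝ => φ (x + Pi.single j ((s : ℝ) : AddCircle (2 * Real.pi)))) 0

/-- `g ∈ L²` is the weak partial derivative `∂_j f` of `f ∈ L²`. -/
def IsWeakDeriv (j : Fin 3) (f g : L2) : Prop :=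
  ∀ φ : T3 → ℝ, IsSmooth φ → ∫ x, f x * pderiv j φ x = -∫ x, g x * φ x

open Classical in
/-- The weak partial derivative `∂_j f` (with the value `0` if there is none in `L²`). -/
def wd (j : Fin 3) (f : L2) : L2 :=
  if h : ∃ g : L2, IsWeakDeriv j f g then h.choose else 0

/-- Membership in `H^m(𝕋³)`: all iterated weak derivatives up to order `m` exist in `L²`. -/
def MemH : ℕ → L2 → Prop
  | 0, _ => True
  | m + 1, f => ∀ j : Fin 3, ∃ g : L2, IsWeakDeriv j f g ∧ MemH m g

/-- `‖f‖²_{H^m} = ∑_{k ≤ m} ‖∇^k f‖²_{L²}` for `f ∈ H^m`, where `∇^k f` is the tensor of all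
iterated partial derivatives of order `k`. -/
def normSqH : ℕ → L2 → ℝ
  | 0, f => ‖f‖ ^ 2
  | m + 1, f => ‖f‖ ^ 2 + ∑ j : Fin 3, normSqH m (wd j f)

/-- The gradient of a scalar field. -/
def grad (f : L2) : Fin 3 → L2 := fun j => wd j f

/-- The divergence of a vector field. -/
def div (v : Fin 3 → L2) : L2 := ∑ j : Fin 3, wd j (v j)

/-- The curl of a vector field. -/
def curl (v : Fin 3 → L2) : Fin 3 → L2 :=
  ![wd 1 (v 2) - wd 2 (v 1), wd 2 (v 0) - wd 0 (v 2), wd 0 (v 1) - wd 1 (v 0)]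

/-- The (componentwise) Laplacian of a vector field. -/
def lap (v : Fin 3 → L2) : Fin 3 → L2 := fun i => ∑ j : Fin 3, wd j (wd j (v i))

/-- The value `(u · ∇) f` at the point `x`. -/
def advect (u : Fin 3 → L2) (f : L2) (x : T3) : ℝ := ∑ j : Fin 3, u j x * wd j f x

/-- The value of a vector field at a point. -/
def vecAt (v : Fin 3 → L2) (x : T3) : Fin 3 → ℝ := fun i => v i x

/-- The value of a matrix field at a point. -/
def matAt (A : Fin 3 → Fin 3 → L2) (x : T3) : Matrix (Fin 3) (Fin 3) ℝ :=
  Matrix.of fun i j => A i j x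

/-- The antisymmetric matrix `Ω` with `Ω v = w × v`. -/
def skew (w : Fin 3 → ℝ) : Matrix (Fin 3) (Fin 3) ℝ :=
  !![0, -w 2, w 1; w 2, 0, -w 0; -w 1, w 0, 0]

/-- The matrix commutator. -/
def comm (A B : Matrix (Fin 3) (Fin 3) ℝ) : Matrix (Fin 3) (Fin 3) ℝ := A * B - B * A

/-! ### Physical constants and the equilibrium -/

/-- The physical constants: the fluid viscosities `μ, κ, α, β, γ`, the magnitude `τ` of the
microtorque, and the eigenvalues `lam, lam, nu` of the microinertia. -/
structure Constants where
  μ : ℝ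
  κ : ℝ
  α : ℝ
  β : ℝ
  γ : ℝ
  τ : ℝ
  lam : ℝ
  nu : ℝ

namespace Constants

/-- The sign conditions on the constants. -/
structure Admissible (c : Constants) : Prop where
  μ_pos : 0 < c.μ
  κ_pos : 0 < c.κ
  αβ_pos : 0 < c.α + 4 * c.β / 3
  βγ_pos : 0 < c.β + c.γ
  τ_pos : 0 < c.τ
  lam_pos : 0 < c.lam
  nu_pos : 0 < c.nu

/-- `μ̃ = μ + κ / 2`. -/
def μt (c : Constants) : ℝ := c.μ + c.κ / 2

/-- `α̃ = α + 4 β / 3`. -/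
def αt (c : Constants) : ℝ := c.α + 4 * c.β / 3

/-- `γ̃ = β + γ`. -/
def γt (c : Constants) : ℝ := c.β + c.γ

/-- The equilibrium angular velocity `ω_eq = τ / (2 κ) e₃`. -/
def ωeq (c : Constants) : Fin 3 → ℝ := ![0, 0, c.τ / (2 * c.κ)]

/-- The equilibrium microinertia `J_eq = diag(lam, lam, nu)`. -/
def Jeq (c : Constants) : Matrix (Fin 3) (Fin 3) ℝ := Matrix.diagonal ![c.lam, c.lam, c.nu]

end Constants

/-! ### The perturbative unknown -/

/-- The perturbative unknown `Z = (u, ω, J)` at a fixed time. -/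
structure State where
  u : Fin 3 → L2
  ω : Fin 3 → L2
  J : Fin 3 → Fin 3 → L2

namespace State

/-- `Z ∈ H^m(𝕋³)`. -/
def MemH (m : ℕ) (Z : State) : Prop :=
  (∀ i, Micropolar.MemH m (Z.u i)) ∧ (∀ i, Micropolar.MemH m (Z.ω i)) ∧
    ∀ i j, Micropolar.MemH m (Z.J i j)

/-- The norm `‖Z‖_{H^m}` (for `Z ∈ H^m`). -/
def normH (m : ℕ) (Z : State) : ℝ :=
  Real.sqrt (∑ i, normSqH m (Z.u i) + ∑ i, normSqH m (Z.ω i) + ∑ i, ∑ j, normSqH m (Z.J i j))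

/-- `E_ins = ‖ω̄‖²_{L²} + ‖a‖²_{L²}` with `ω̄ = (ω₁, ω₂)` and `a = (J₁₃, J₂₃)`. -/
def Eins (Z : State) : ℝ :=
  (‖Z.ω 0‖ ^ 2 + ‖Z.ω 1‖ ^ 2) + (‖Z.J 0 2‖ ^ 2 + ‖Z.J 1 2‖ ^ 2)

/-! The value at `x` of the three components of the linear operator. -/

def linU (c : Constants) (Z : State) (x : T3) : Fin 3 → ℝ :=
  c.μt • vecAt (lap Z.u) x + c.κ • vecAt (curl Z.ω) x

/-- The viscous and rotational stresses
`κ ∇×u - 2κω + (α̃ - γ̃) ∇(∇·ω) + γ̃ Δω`. -/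
def stress (c : Constants) (Z : State) (x : T3) : Fin 3 → ℝ :=
  c.κ • vecAt (curl Z.u) x - (2 * c.κ) • vecAt Z.ω x
    + (c.αt - c.γt) • vecAt (grad (div Z.ω)) x + c.γt • vecAt (lap Z.ω) x

/-- The linear part `ω × J_eq ω_eq + ω_eq × J ω_eq + ω_eq × J_eq ω` of the precession term. -/
def linPrec (c : Constants) (Z : State) (x : T3) : Fin 3 → ℝ :=
  crossProduct (vecAt Z.ω x) (c.Jeq *ᵥ c.ωeq)
    + crossProduct c.ωeq (matAt Z.J x *ᵥ c.ωeq)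
    + crossProduct c.ωeq (c.Jeq *ᵥ vecAt Z.ω x)

/-- The quadratic and cubic part
`ω × J ω + ω_eq × J ω + ω × J_eq ω + ω × J ω_eq` of the precession term. -/
def nonlinPrec (c : Constants) (Z : State) (x : T3) : Fin 3 → ℝ :=
  crossProduct (vecAt Z.ω x) (matAt Z.J x *ᵥ vecAt Z.ω x)
    + crossProduct c.ωeq (matAt Z.J x *ᵥ vecAt Z.ω x)
    + crossProduct (vecAt Z.ω x) (c.Jeq *ᵥ vecAt Z.ω x)
    + crossProduct (vecAt Z.ω x) (matAt Z.J x *ᵥ c.ωeq)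

def linω (c : Constants) (Z : State) (x : T3) : Fin 3 → ℝ :=
  stress c Z x - linPrec c Z x

def linJ (c : Constants) (Z : State) (x : T3) : Matrix (Fin 3) (Fin 3) ℝ :=
  comm (skew c.ωeq) (matAt Z.J x) + comm (skew (vecAt Z.ω x)) c.Jeq

/-! The value at `x` of the three components `N₁, N₂, N₃` of the nonlinearity. -/

def N₁ (Z : State) (x : T3) : Fin 3 → ℝ := fun i => -advect Z.u (Z.u i) x

/-- `A = J J_eq⁻¹`. -/
def relJ (c : Constants) (Z : State) (x : T3) : Matrix (Fin 3) (Fin 3) ℝ :=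
  matAt Z.J x * c.Jeq⁻¹

/-- `m(A) = (I + A)⁻¹` with `A = J J_eq⁻¹`. -/
def mJ (c : Constants) (Z : State) (x : T3) : Matrix (Fin 3) (Fin 3) ℝ :=
  (1 + relJ c Z x)⁻¹

def N₂ (c : Constants) (Z : State) (x : T3) : Fin 3 → ℝ :=
  -(c.Jeq *ᵥ (fun i => advect Z.u (Z.ω i) x)) - mJ c Z x *ᵥ nonlinPrec c Z x
    - (relJ c Z x * mJ c Z x) *ᵥ (stress c Z x - linPrec c Z x)

def N₃ (Z : State) (x : T3) : Matrix (Fin 3) (Fin 3) ℝ :=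
  comm (skew (vecAt Z.ω x)) (matAt Z.J x) - Matrix.of fun i j => advect Z.u (Z.J i j) x

end State

/-- `Z` is a strong solution on `[0, T]`, with pressure `p`, of
`∂ₜ(D Z) = 𝓛 Z + Λ(p) + N(Z)` subject to `∇·u = 0`, where `D = I ⊕ J_eq ⊕ I` and
`Λ(p) = (-∇p, 0, 0)`, `J` taking values in the symmetric matrices:
`Z ∈ L^∞(0,T; H²)`, `∂ₜ Z ∈ L^∞(0,T; L²)`, and the equations hold almost everywhere.
The time derivative is the one of `t ↦ Z(t)` as a Lipschitz curve in `L²`. -/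
structure IsSolution (c : Constants) (T : ℝ) (Z : ℝ → State) (p : ℝ → L2) : Prop where
  symm : ∀ t ∈ Icc 0 T, ∀ i j, (Z t).J i j = (Z t).J j i
  bound : ∃ B : ℝ, ∀ᵐ t ∂(volume.restrict (Icc 0 T)), (Z t).MemH 2 ∧ (Z t).normH 2 ≤ B
  pressure : ∀ᵐ t ∂(volume.restrict (Icc 0 T)), MemH 1 (p t)
  lip_u : ∃ K, LipschitzOnWith K (fun t => (Z t).u) (Icc 0 T)
  lip_ω : ∃ K, LipschitzOnWith K (fun t => (Z t).ω) (Icc 0 T)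
  lip_J : ∃ K, LipschitzOnWith K (fun t => (Z t).J) (Icc 0 T)
  div_free : ∀ᵐ t ∂(volume.restrict (Icc 0 T)), div (Z t).u = 0
  eqn : ∀ᵐ t ∂(volume.restrict (Icc 0 T)),
    ∃ (ut ωt : Fin 3 → L2) (Jt : Fin 3 → Fin 3 → L2),
      HasDerivAt (fun s => (Z s).u) ut t ∧
      HasDerivAt (fun s => (Z s).ω) ωt t ∧
      HasDerivAt (fun s => (Z s).J) Jt t ∧
      ∀ᵐ x : T3,
        vecAt ut x = (Z t).linU c x - vecAt (grad (p t)) x + (Z t).N₁ x ∧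
        c.Jeq *ᵥ vecAt ωt x = (Z t).linω c x + (Z t).N₂ c x ∧
        matAt Jt x = (Z t).linJ c x + (Z t).N₃ x

end Micropolar

end

open scoped ComplexConjugate ENNReal

noncomputable section

namespace Micropolar

/-! ### Fourier series on the torus -/

/-! The proof is an energy argument at two levels of regularity, carried out on Fourier
coefficients. With G = J_eq(∂ₜω + u·∇ω) and A = J J_eq⁻¹, the ω-equation is equivalent to (I + A)G =
F - P - Q. The matrix inverse disappears, and the nonlinearity becomes N = Q + AG, a sum of products
(`resolvent_identity`). Smallness of J then bounds G, hence N, by absorption.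

L² level. The viscous form, including the κ-coupling of u and ω, is coercive on ∇u and on ω in H¹
(`exists_dissipation`). Transport by a divergence-free field is antisymmetric, and commutators with
Ω_eq and Ω are orthogonal to J. The rest of the linear part couples ω̄ only with a
(`re_coupling_le`). The linear forcing of G also sees J only through a, so N is small in H⁻¹
relative to the dissipation plus ‖a‖² (`exists_nonlinear_estimate_low`). The L² energy therefore
grows at a rate at most C·E_ins (`exists_energyRate_low`), which integrates to ‖Z‖²_{L²} ≤ C(1 +
ψ⁻¹)M e^{ψt} with M = ‖Z(0)‖²_{H⁴} + C_ins (`exists_lebSq_le`).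

H⁴ level. J is not dissipated, but the dissipation of ω gains a derivative, so that the linear
coupling needs J only in H³. Transport and commutator terms are tame, of size ‖Z‖_{H³}‖Z‖²_{H⁴}. If
‖Z‖_{H³} ≲ η, the energy rate is at most C(η‖Z‖²_{H⁴} + ‖J‖²_{H³}) (`exists_energyRate_high`), and
interpolation (`sqs_wt_cube_le_interp`) trades ‖J‖²_{H³} for η‖J‖²_{H⁴} + η⁻³‖J‖²_{L²}. With S a
bound for e^{-ψs}‖Z(s)‖²_{H⁴}, integration (`exists_sobSq_le`) returns a term C ψ⁻¹ η S, and taking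
η proportional to ψ lets S absorb it (`le_two_mul_of_self_improving`).

The smallness δ_B may not depend on ψ, whereas η does. The condition on ‖Z‖_{H³} is therefore not
imposed on the solution but obtained by interpolating the bounded H⁴ norm with the L² estimate,
which works while M e^{ψt} is below a threshold ε(ψ). Beyond the threshold the claim is trivial,
since ‖Z‖_{H⁴} ≤ 1 and the constant may contain ε⁻¹.

Time derivatives live only in L², so the H⁴ weight is replaced by min(1 + |k|, N)⁴, with |k| the ℓ¹
norm. This weight is bounded, so the energy is Lipschitz in time and differentiable wherever Z is.
All estimates are uniform in N, and N → ∞ at the very end. Nonnegative sequences take values in [0,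
∞], so finiteness matters only where a term is absorbed. -/

/-- The frequencies of the torus. -/
abbrev Freq : Type := Fin 3 → ℤ

/-- The character `x ↦ exp (i k · x)`. -/
def character (k : Freq) : C(T3, ℂ) where
  toFun x := ∏ i, fourier (k i) (x i)
  continuous_toFun := by fun_prop

lemma character_neg (k : Freq) (x : T3) : character (-k) x = conj (character k x) := by
  simp only [character, Pi.neg_apply, fourier_neg, ContinuousMap.coe_mk, map_prod]

lemma character_add (k l : Freq) (x : T3) :
    character (k + l) x = character k x * character l x := by
  simp only [character, Pi.add_apply, fourier_add, ContinuousMap.coe_mk, ← Finset.prod_mul_distrib]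

lemma character_zero : character 0 = 1 := by
  ext x
  simp [character]

lemma norm_character_apply (k : Freq) (x : T3) : ‖character k x‖ = 1 := by
  simp only [character, ContinuousMap.coe_mk, norm_prod, fourier_apply, Circle.norm_coe,
    Finset.prod_const_one]

lemma norm_character (k : Freq) : ‖character k‖ = 1 := by
  apply le_antisymm
  · exact (ContinuousMap.norm_le _ zero_le_one).mpr fun x => (norm_character_apply k x).le
  · exact (norm_character_apply k 0).ge.trans ((character k).norm_coe_le_norm 0)

lemma character_single (x : T3) (i : Fin 3) :
    character (Pi.single i 1) x = fourier 1 (x i) := by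
  simp only [character, ContinuousMap.coe_mk]
  rw [Finset.prod_eq_single i]
  · simp
  · intro j _ hj
    simp [Pi.single_eq_of_ne hj]
  · simp

/-- The star subalgebra generated by the characters. -/
def characterSubalgebra : StarSubalgebra ℂ C(T3, ℂ) where
  toSubalgebra := Algebra.adjoin ℂ (range character)
  star_mem' := by
    change Algebra.adjoin ℂ (range character) ≤ star (Algebra.adjoin ℂ (range character))
    refine Algebra.adjoin_le ?_
    rintro _ ⟨n, rfl⟩
    refine Algebra.subset_adjoin ⟨-n, ?_⟩
    ext1 x
    simp only [character_neg, starRingEnd_apply, ContinuousMap.star_apply]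

/-- Products of characters are characters and the constant 1 is one of them, so the generated
algebra is already the linear span. -/
theorem characterSubalgebra_coe :
    characterSubalgebra.toSubalgebra.toSubmodule = Submodule.span ℂ (range character) := by
  apply Algebra.adjoin_eq_span_of_subset
  refine .trans (fun x ↦ Submonoid.closure_induction (fun _ ↦ id) ⟨0, ?_⟩ ?_)
    Submodule.subset_span
  · exact character_zero
  · rintro _ _ _ _ ⟨m, rfl⟩ ⟨n, rfl⟩
    refine ⟨m + n, ?_⟩
    ext z
    exact character_add m n z

theorem characterSubalgebra_separatesPoints : characterSubalgebra.SeparatesPoints := by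
  intro x y hxy
  rw [Ne, funext_iff, not_forall] at hxy
  obtain ⟨i, hi⟩ := hxy
  refine ⟨_, ⟨character (Pi.single i 1), Algebra.subset_adjoin ⟨Pi.single i 1, rfl⟩, rfl⟩, ?_⟩
  change character (Pi.single i 1) x ≠ character (Pi.single i 1) y
  rw [character_single, character_single, fourier_one, fourier_one]
  exact fun h => hi (AddCircle.injective_toCircle Real.two_pi_pos.ne' (Circle.ext h))

/-- Stone–Weierstrass; density in L² and completeness of the Fourier system follow from it. -/
theorem span_character_closure_eq_top :
    (Submodule.span ℂ (range character)).topologicalClosure = ⊤ := by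
  rw [← characterSubalgebra_coe]
  exact congr_arg (Subalgebra.toSubmodule <| StarSubalgebra.toSubalgebra ·)
    (ContinuousMap.starSubalgebra_topologicalClosure_eq_top_of_separatesPoints _
      characterSubalgebra_separatesPoints)

/-- The characters as elements of the complex `L²` space. -/
abbrev characterLp (k : Freq) : Lp ℂ 2 (volume : Measure T3) :=
  ContinuousMap.toLp (E := ℂ) 2 volume ℂ (character k)

theorem coeFn_characterLp (k : Freq) : characterLp k =ᵐ[volume] character k :=
  ContinuousMap.coeFn_toLp volume (character k)

theorem span_characterLp_closure_eq_top :
    (Submodule.span ℂ (range characterLp)).topologicalClosure = ⊤ := by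
  simpa only [Submodule.map_span, ContinuousLinearMap.coe_coe, ← range_comp, Function.comp_def]
    using (ContinuousMap.toLp_denseRange ℂ (volume : Measure T3) ℂ (p := 2)
      (by simp)).topologicalClosure_map_submodule span_character_closure_eq_top

/-- The volume of the torus. -/
def torusVol : ℝ := (2 * Real.pi) ^ 3

lemma torusVol_pos : 0 < torusVol := pow_pos Real.two_pi_pos 3

lemma integral_character (k : Freq) :
    ∫ x, character k x = if k = 0 then (torusVol : ℂ) else 0 := by
  have h1 : ∀ n : ℤ, ∫ x : AddCircle (2 * Real.pi), fourier n x
      = if n = 0 then ((2 * Real.pi : ℝ) : ℂ) else 0 := by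
    intro n
    -- One-dimensional orthonormality is stated for the Haar probability measure; the volume used
    -- here is 2π times it.
    rw [AddCircle.volume_eq_smul_haarAddCircle, integral_smul_measure,
      ENNReal.toReal_ofReal Real.two_pi_pos.le]
    have := (orthonormal_iff_ite.mp (orthonormal_fourier (T := 2 * Real.pi))) 0 n
    simp only [ContinuousMap.inner_toLp, fourier_zero, map_one, mul_one] at this
    rw [this]
    split_ifs with h h' h'
    · simp
    · exact absurd h.symm h'
    · exact absurd h'.symm h
    · simp
  have h2 : ∫ x, character k x = ∏ i, ∫ x : AddCircle (2 * Real.pi), fourier (k i) x := by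
    rw [← MeasureTheory.integral_fintype_prod_volume_eq_prod]
    rfl
  rw [h2]
  split_ifs with h
  · subst h
    simp only [Pi.zero_apply, h1, if_true, Finset.prod_const, Finset.card_univ, Fintype.card_fin,
      torusVol, Complex.ofReal_pow]
  · obtain ⟨i, hi⟩ := Function.ne_iff.mp h
    apply Finset.prod_eq_zero (Finset.mem_univ i)
    rw [h1, if_neg (by simpa using hi)]

lemma inner_characterLp (k l : Freq) :
    inner ℂ (characterLp k) (characterLp l) = if k = l then (torusVol : ℂ) else 0 := by
  have : inner ℂ (characterLp k) (characterLp l) = ∫ x, character (l - k) x := by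
    rw [ContinuousMap.inner_toLp]
    refine integral_congr_ae (.of_forall fun x => ?_)
    simp only [sub_eq_add_neg, character_add, character_neg]
  rw [this, integral_character]
  simp only [sub_eq_zero, eq_comm]

lemma orthonormal_character :
    Orthonormal ℂ (fun k => ((√torusVol)⁻¹ : ℂ) • characterLp k) := by
  rw [orthonormal_iff_ite]
  intro k l
  rw [inner_smul_left, inner_smul_right, inner_characterLp]
  split_ifs with h
  · have h0 : (√torusVol : ℝ) * √torusVol = torusVol := Real.mul_self_sqrt torusVol_pos.le
    have h1 : (√torusVol : ℝ) ≠ 0 := (Real.sqrt_pos.mpr torusVol_pos).ne'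
    rw [map_inv₀, Complex.conj_ofReal]
    have h2 : ((√torusVol : ℝ) : ℂ) ≠ 0 := by exact_mod_cast h1
    field_simp
    exact_mod_cast h0.symm.trans (pow_two _).symm
  · simp

/-- The normalised characters form a Hilbert basis. -/
def characterBasis : HilbertBasis Freq ℂ (Lp ℂ 2 (volume : Measure T3)) :=
  HilbertBasis.mk orthonormal_character (by
    refine ge_of_eq ?_
    rw [← span_characterLp_closure_eq_top]
    congr 1
    have hne : ((√torusVol)⁻¹ : ℂ) ≠ 0 := by
      have h1 : (√torusVol : ℝ) ≠ 0 := (Real.sqrt_pos.mpr torusVol_pos).ne'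
      exact inv_ne_zero (by exact_mod_cast h1)
    apply le_antisymm
    · rw [Submodule.span_le]
      rintro _ ⟨k, rfl⟩
      exact Submodule.smul_mem _ _ (Submodule.subset_span ⟨k, rfl⟩)
    · rw [Submodule.span_le]
      rintro _ ⟨k, rfl⟩
      have := Submodule.smul_mem (Submodule.span ℂ (range fun k =>
        ((√torusVol)⁻¹ : ℂ) • characterLp k)) ((√torusVol)⁻¹ : ℂ)⁻¹
        (Submodule.subset_span ⟨k, rfl⟩)
      rwa [smul_smul, inv_mul_cancel₀ hne, one_smul] at this)

lemma characterBasis_apply (k : Freq) :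
    characterBasis k = ((√torusVol)⁻¹ : ℂ) • characterLp k := by
  simp [characterBasis]

/-- Parseval's identity in terms of the characters. -/
lemma hasSum_inner_characterLp (f g : Lp ℂ 2 (volume : Measure T3)) :
    HasSum (fun k => inner ℂ f (characterLp k) * inner ℂ (characterLp k) g)
      (torusVol * inner ℂ f g) := by
  have h := (characterBasis.hasSum_inner_mul_inner f g).mul_left (torusVol : ℂ)
  refine h.congr_fun fun k => ?_
  rw [characterBasis_apply, inner_smul_left, inner_smul_right, map_inv₀, Complex.conj_ofReal]
  have h0 : (√torusVol : ℝ) * √torusVol = torusVol := Real.mul_self_sqrt torusVol_pos.le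
  have h1 : (√torusVol : ℝ) ≠ 0 := (Real.sqrt_pos.mpr torusVol_pos).ne'
  have h2 : ((√torusVol : ℝ) : ℂ) ≠ 0 := by exact_mod_cast h1
  have : (torusVol : ℂ) = (√torusVol : ℝ) ^ 2 := by exact_mod_cast h0.symm.trans (pow_two _).symm
  rw [this]
  field_simp

/-- A real `L²` function as a complex one. -/
def toComplex (f : L2) : Lp ℂ 2 (volume : Measure T3) := Complex.ofRealCLM.compLp f

lemma coeFn_toComplex (f : L2) : toComplex f =ᵐ[volume] fun x => (f x : ℂ) := by
  filter_upwards [Complex.ofRealCLM.coeFn_compLp f] with x hx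
  rw [toComplex, hx]
  rfl

/-- The Fourier coefficients `(2π)⁻³ ∫ h(x) exp (-i k · x) dx`. -/
def fc (h : T3 → ℝ) (k : Freq) : ℂ := (torusVol : ℂ)⁻¹ * ∫ x, (h x : ℂ) * character (-k) x

lemma inner_characterLp_toComplex (f : L2) (k : Freq) :
    inner ℂ (characterLp k) (toComplex f) = torusVol * fc f k := by
  have h : (torusVol : ℂ) ≠ 0 := by exact_mod_cast torusVol_pos.ne'
  rw [fc, mul_inv_cancel_left₀ h, MeasureTheory.L2.inner_def]
  refine integral_congr_ae ?_
  filter_upwards [coeFn_toComplex f, coeFn_characterLp k] with x h1 h2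
  rw [h1, h2, RCLike.inner_apply, character_neg]

lemma inner_toComplex (f g : L2) :
    inner ℂ (toComplex f) (toComplex g) = ((∫ x, f x * g x : ℝ) : ℂ) := by
  rw [MeasureTheory.L2.inner_def, ← integral_complex_ofReal]
  refine integral_congr_ae ?_
  filter_upwards [coeFn_toComplex f, coeFn_toComplex g] with x h1 h2
  rw [h1, h2, RCLike.inner_apply, Complex.conj_ofReal]
  push_cast
  ring

/-- Parseval's identity for real functions. -/
lemma hasSum_parseval (f g : L2) :
    HasSum (fun k => torusVol * (conj (fc f k) * fc g k)) ((∫ x, f x * g x : ℝ) : ℂ) := by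
  have h := (hasSum_inner_characterLp (toComplex f) (toComplex g)).mul_left ((torusVol : ℂ)⁻¹)
  have h0 : (torusVol : ℂ) ≠ 0 := by exact_mod_cast torusVol_pos.ne'
  rw [inner_toComplex, inv_mul_cancel_left₀ h0] at h
  refine h.congr_fun fun k => ?_
  rw [← inner_conj_symm, inner_characterLp_toComplex, inner_characterLp_toComplex, map_mul,
    Complex.conj_ofReal]
  field_simp

lemma norm_sq_eq_integral (f : L2) : ‖f‖ ^ 2 = ∫ x, f x * f x := by
  rw [← real_inner_self_eq_norm_sq, MeasureTheory.L2.inner_def]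
  rfl

lemma hasSum_norm_sq_fc (f : L2) : HasSum (fun k => torusVol * ‖fc f k‖ ^ 2) (‖f‖ ^ 2) := by
  have h := Complex.hasSum_re (hasSum_parseval f f)
  rw [Complex.ofReal_re, ← norm_sq_eq_integral] at h
  refine h.congr_fun fun k => ?_
  rw [Complex.conj_mul', ← Complex.ofReal_pow, ← Complex.ofReal_mul, Complex.ofReal_re]

lemma fc_congr {f g : T3 → ℝ} (h : f =ᵐ[volume] g) (k : Freq) : fc f k = fc g k := by
  unfold fc
  congr 1
  refine integral_congr_ae ?_
  filter_upwards [h] with x hx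
  rw [hx]

lemma integrable_mul_character {h : T3 → ℝ} (hh : Integrable h) (k : Freq) :
    Integrable (fun x => (h x : ℂ) * character k x) := by
  refine hh.ofReal.mul_bdd (c := 1) (character k).continuous.aestronglyMeasurable ?_
  exact .of_forall fun x => (norm_character_apply k x).le

lemma fc_add {f g : T3 → ℝ} (hf : Integrable f) (hg : Integrable g) (k : Freq) :
    fc (fun x => f x + g x) k = fc f k + fc g k := by
  unfold fc
  rw [← mul_add, ← integral_add (integrable_mul_character hf _) (integrable_mul_character hg _)]
  simp only [Complex.ofReal_add, add_mul]

lemma fc_const_mul (a : ℝ) (f : T3 → ℝ) (k : Freq) :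
    fc (fun x => a * f x) k = a * fc f k := by
  unfold fc
  simp only [Complex.ofReal_mul, mul_assoc]
  rw [integral_const_mul]
  ring

lemma fc_neg (f : T3 → ℝ) (k : Freq) : fc (fun x => -f x) k = -fc f k := by
  simpa using fc_const_mul (-1) f k

lemma fc_sub {f g : T3 → ℝ} (hf : Integrable f) (hg : Integrable g) (k : Freq) :
    fc (fun x => f x - g x) k = fc f k - fc g k := by
  simp only [sub_eq_add_neg]
  rw [← fc_neg g]
  exact fc_add hf hg.neg k

lemma fc_sum {ι : Type*} (s : Finset ι) {f : ι → T3 → ℝ} (hf : ∀ i ∈ s, Integrable (f i))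
    (k : Freq) : fc (fun x => ∑ i ∈ s, f i x) k = ∑ i ∈ s, fc (f i) k := by
  unfold fc
  rw [← Finset.mul_sum, ← integral_finsetSum s fun i hi => integrable_mul_character (hf i hi) _]
  simp only [Complex.ofReal_sum, Finset.sum_mul]

lemma fc_neg_freq (f : T3 → ℝ) (k : Freq) : fc f (-k) = conj (fc f k) := by
  unfold fc
  rw [map_mul, map_inv₀, Complex.conj_ofReal, ← integral_conj]
  congr 2 with x
  rw [map_mul, Complex.conj_ofReal, ← character_neg]

lemma L2.integrable (f : L2) : Integrable f := (Lp.memLp f).integrable (by norm_num)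

lemma L2.integrable_mul (f g : L2) : Integrable (fun x => f x * g x) :=
  (Lp.memLp f).integrable_mul (Lp.memLp g)

lemma fc_injective {f g : L2} (h : ∀ k, fc f k = fc g k) : f = g := by
  have h1 := hasSum_norm_sq_fc (f - g)
  have h2 : ∀ k, fc (f - g : L2) k = 0 := by
    intro k
    rw [fc_congr (Lp.coeFn_sub f g), ← sub_eq_zero.mpr (h k)]
    exact fc_sub f.integrable g.integrable k
  simp only [h2, norm_zero] at h1
  have h3 : ‖f - g‖ ^ 2 = 0 := by
    refine h1.unique ?_
    simp
  exact sub_eq_zero.mp (norm_eq_zero.mp (pow_eq_zero_iff two_ne_zero |>.mp h3))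

/-- Multiplication by a character. -/
def characterMul (k : Freq) (f : L2) : Lp ℂ 2 (volume : Measure T3) :=
  MemLp.toLp (fun x => character k x * (f x : ℂ)) (by
    refine (Lp.memLp f).of_le ?_ (.of_forall fun x => ?_)
    · exact (character k).continuous.aestronglyMeasurable.mul
        (Complex.continuous_ofReal.comp_aestronglyMeasurable (Lp.aestronglyMeasurable f))
    · rw [norm_mul, norm_character_apply, one_mul, Complex.norm_real])

/-- The Fourier coefficients of a product. -/
lemma hasSum_fc_mul (f g : L2) (k : Freq) :
    HasSum (fun l => fc f (k - l) * fc g l) (fc (fun x => f x * g x) k) := by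
  have h0 : (torusVol : ℂ) ≠ 0 := by exact_mod_cast torusVol_pos.ne'
  have hm : characterMul k f =ᵐ[volume] fun x => character k x * (f x : ℂ) := MemLp.coeFn_toLp _
  -- Parseval for the pair (e^{ik·x} f, g): the inner product is the coefficient of fg at k, and
  -- modulation shifts the coefficients of f, which produces the convolution.
  have h := (hasSum_inner_characterLp (characterMul k f) (toComplex g)).mul_left
    ((torusVol : ℂ)⁻¹ ^ 2)
  have e1 : inner ℂ (characterMul k f) (toComplex g)
      = torusVol * fc (fun x => f x * g x) k := by
    rw [fc, mul_inv_cancel_left₀ h0, MeasureTheory.L2.inner_def]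
    refine integral_congr_ae ?_
    filter_upwards [hm, coeFn_toComplex g] with x h1 h2
    rw [h1, h2, RCLike.inner_apply, map_mul, Complex.conj_ofReal, character_neg]
    push_cast
    ring
  have e2 : ∀ l, inner ℂ (characterMul k f) (characterLp l) = torusVol * fc f (k - l) := by
    intro l
    rw [fc, mul_inv_cancel_left₀ h0, MeasureTheory.L2.inner_def]
    refine integral_congr_ae ?_
    filter_upwards [hm, coeFn_characterLp l] with x h1 h2
    rw [h1, h2, RCLike.inner_apply, map_mul, Complex.conj_ofReal, neg_sub, sub_eq_add_neg,
      character_add, character_neg]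
    ring
  rw [e1] at h
  have e3 : (torusVol : ℂ)⁻¹ ^ 2 * (torusVol * (torusVol * fc (fun x => f x * g x) k))
      = fc (fun x => f x * g x) k := by field_simp
  rw [e3] at h
  refine h.congr_fun fun l => ?_
  rw [e2, inner_characterLp_toComplex]
  field_simp

/-- A function with absolutely summable Fourier coefficients is bounded by their sum. -/
lemma ae_abs_le_tsum_norm_fc (f : L2) (hf : Summable fun k => ‖fc f k‖) :
    ∀ᵐ x, |f x| ≤ ∑' k, ‖fc f k‖ := by
  have hs : Summable fun k => fc f k • character k := by
    refine .of_norm ?_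
    simpa only [norm_smul, norm_character, mul_one] using hf
  have h1 : HasSum (fun k => fc f k • characterLp k)
      (ContinuousMap.toLp (E := ℂ) 2 volume ℂ (∑' k, fc f k • character k)) := by
    simpa only [map_smul] using
      (ContinuousMap.toLp (E := ℂ) 2 (volume : Measure T3) ℂ).hasSum hs.hasSum
  have h2 : HasSum (fun k => fc f k • characterLp k) (toComplex f) := by
    have := characterBasis.hasSum_repr (toComplex f)
    refine this.congr_fun fun k => ?_
    rw [characterBasis.repr_apply_apply, characterBasis_apply, inner_smul_left, smul_smul,
      inner_characterLp_toComplex, map_inv₀, Complex.conj_ofReal]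
    congr 1
    have h0 : (√torusVol : ℝ) * √torusVol = torusVol := Real.mul_self_sqrt torusVol_pos.le
    have h1 : (√torusVol : ℝ) ≠ 0 := (Real.sqrt_pos.mpr torusVol_pos).ne'
    have h2 : ((√torusVol : ℝ) : ℂ) ≠ 0 := by exact_mod_cast h1
    have h3 : (torusVol : ℂ) = (√torusVol : ℝ) ^ 2 := by
      exact_mod_cast h0.symm.trans (pow_two _).symm
    rw [h3]
    field_simp
  -- The same series converges uniformly to a continuous function and in L² to f, so the two limits
  -- agree almost everywhere.
  have h3 := h1.unique h2
  have h4 := ContinuousMap.coeFn_toLp (p := 2) (𝕜 := ℂ) (volume : Measure T3)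
    (∑' k, fc f k • character k)
  rw [h3] at h4
  filter_upwards [h4, coeFn_toComplex f] with x h5 h6
  rw [h6] at h5
  rw [← Real.norm_eq_abs, ← Complex.norm_real, h5]
  refine (ContinuousMap.norm_coe_le_norm _ x).trans ?_
  refine (norm_tsum_le_tsum_norm ?_).trans (le_of_eq ?_)
  · simpa only [norm_smul, norm_character, mul_one] using hf
  · simp only [norm_smul, norm_character, mul_one]

/-! ### Weak derivatives -/

lemma character_coe (k : Freq) (y : Fin 3 → ℝ) :
    character k (fun i => ((y i : ℝ) : AddCircle (2 * Real.pi)))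
      = Complex.exp (Complex.I * ∑ i, (k i : ℂ) * (y i : ℂ)) := by
  simp only [character, ContinuousMap.coe_mk, fourier_coe_apply, Finset.mul_sum]
  rw [← Complex.exp_sum]
  refine congrArg _ (Finset.sum_congr rfl fun i _ => ?_)
  have : (Real.pi : ℂ) ≠ 0 := by exact_mod_cast Real.pi_ne_zero
  push_cast
  field_simp

lemma contDiff_character (k : Freq) : ContDiff ℝ ((⊤ : ℕ∞) : WithTop ℕ∞)
    (fun y : Fin 3 → ℝ => character k (fun i => ((y i : ℝ) : AddCircle (2 * Real.pi)))) := by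
  simp only [character_coe]
  refine ContDiff.cexp (contDiff_const.mul (ContDiff.sum fun i _ => contDiff_const.mul ?_))
  exact Complex.ofRealCLM.contDiff.comp (contDiff_apply ℝ ℝ i)

lemma isSmooth_re_character (k : Freq) : IsSmooth fun x => (character k x).re :=
  Complex.reCLM.contDiff.comp (contDiff_character k)

lemma isSmooth_im_character (k : Freq) : IsSmooth fun x => (character k x).im :=
  Complex.imCLM.contDiff.comp (contDiff_character k)

lemma hasDerivAt_character (j : Fin 3) (k : Freq) (x : T3) :
    HasDerivAt (fun s : ℝ => character k (x + Pi.single j ((s : ℝ) : AddCircle (2 * Real.pi))))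
      (Complex.I * k j * character k x) 0 := by
  have h : ∀ s : ℝ, character k (x + Pi.single j ((s : ℝ) : AddCircle (2 * Real.pi)))
      = character k x * Complex.exp (Complex.I * k j * s) := by
    intro s
    have h1 : character k (x + Pi.single j ((s : ℝ) : AddCircle (2 * Real.pi)))
        = character k x * character k (Pi.single j ((s : ℝ) : AddCircle (2 * Real.pi))) := by
      simp only [character, ContinuousMap.coe_mk, ← Finset.prod_mul_distrib, Pi.add_apply]
      refine Finset.prod_congr rfl fun i _ => ?_
      simp only [fourier_apply, smul_add, AddCircle.toCircle_add, Circle.coe_mul]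
    have h2 : (Pi.single j ((s : ℝ) : AddCircle (2 * Real.pi)) : T3)
        = fun i => (((Pi.single j s : Fin 3 → ℝ) i : ℝ) : AddCircle (2 * Real.pi)) := by
      ext i
      by_cases hij : i = j
      · subst hij
        simp
      · simp [Pi.single_eq_of_ne hij]
    rw [h1, h2, character_coe]
    congr 2
    rw [mul_assoc, Finset.sum_eq_single j]
    · simp
    · intro i _ hij
      simp [Pi.single_eq_of_ne hij]
    · simp
  simp only [h]
  have h3 : HasDerivAt (fun s : ℝ => Complex.exp (Complex.I * k j * s)) (Complex.I * k j) 0 := by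
    have h4 : HasDerivAt (fun s : ℝ => Complex.I * k j * (s : ℂ)) (Complex.I * k j * 1) 0 :=
      (Complex.ofRealCLM.hasDerivAt (x := (0 : ℝ))).const_mul _
    simpa using h4.cexp
  simpa [mul_comm] using h3.const_mul (character k x)

lemma pderiv_re_character (j : Fin 3) (k : Freq) (x : T3) :
    pderiv j (fun x => (character k x).re) x = (Complex.I * k j * character k x).re :=
  (Complex.reCLM.hasFDerivAt.comp_hasDerivAt (0 : ℝ) (hasDerivAt_character j k x)).deriv

lemma pderiv_im_character (j : Fin 3) (k : Freq) (x : T3) :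
    pderiv j (fun x => (character k x).im) x = (Complex.I * k j * character k x).im :=
  (Complex.imCLM.hasFDerivAt.comp_hasDerivAt (0 : ℝ) (hasDerivAt_character j k x)).deriv

lemma integral_mul_complex {h : T3 → ℝ} (hh : Integrable h) {c : T3 → ℂ} (hc : Continuous c) :
    ∫ x, (h x : ℂ) * c x
      = ((∫ x, h x * (c x).re : ℝ) : ℂ) + ((∫ x, h x * (c x).im : ℝ) : ℂ) * Complex.I := by
  obtain ⟨B, hB⟩ := (isCompact_range hc).isBounded.exists_norm_le
  have h1 : Integrable fun x => h x * (c x).re :=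
    hh.mul_bdd (c := B) (Complex.continuous_re.comp hc).aestronglyMeasurable
      (.of_forall fun x => (Complex.abs_re_le_norm _).trans (hB _ ⟨x, rfl⟩))
  have h2 : Integrable fun x => h x * (c x).im :=
    hh.mul_bdd (c := B) (Complex.continuous_im.comp hc).aestronglyMeasurable
      (.of_forall fun x => (Complex.abs_im_le_norm _).trans (hB _ ⟨x, rfl⟩))
  rw [← integral_complex_ofReal, ← integral_complex_ofReal, ← integral_mul_const,
    ← integral_add h1.ofReal (h2.ofReal.mul_const _)]
  congr 1 with x
  conv_lhs => rw [← Complex.re_add_im (c x)]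
  push_cast
  ring

/-- A weak derivative acts on the Fourier coefficients by multiplication with `i k_j`. -/
lemma IsWeakDeriv.fc_eq {j : Fin 3} {f g : L2} (h : IsWeakDeriv j f g) (k : Freq) :
    fc g k = Complex.I * k j * fc f k := by
  -- Test functions are real, so the character is tested through its real and imaginary parts and
  -- reassembled afterwards.
  have h1 := h _ (isSmooth_re_character (-k))
  have h2 := h _ (isSmooth_im_character (-k))
  simp only [pderiv_re_character, pderiv_im_character] at h1 h2
  have hc : Continuous fun x => Complex.I * ((-k) j : ℤ) * character (-k) x := by fun_prop
  have h3 := integral_mul_complex f.integrable hc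
  have h4 := integral_mul_complex g.integrable (character (-k)).continuous
  rw [h1, h2] at h3
  have h5 : ∫ x, (f x : ℂ) * (Complex.I * ((-k) j : ℤ) * character (-k) x)
      = -(Complex.I * k j) * ∫ x, (f x : ℂ) * character (-k) x := by
    rw [← integral_const_mul]
    congr 1 with x
    simp only [Pi.neg_apply, Int.cast_neg]
    ring
  rw [h5] at h3
  unfold fc
  rw [h4]
  push_cast at h3 ⊢
  linear_combination (torusVol : ℂ)⁻¹ * h3

lemma isOpenQuotientMap_coe : IsOpenQuotientMap
    (fun y : Fin 3 → ℝ => fun i => ((y i : ℝ) : AddCircle (2 * Real.pi))) :=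
  IsOpenQuotientMap.piMap fun _ => QuotientAddGroup.isOpenQuotientMap_mk

/-- The torus carries the quotient topology of ℝ³, so continuity may be checked on the periodic
lift. -/
lemma IsSmooth.continuous {φ : T3 → ℝ} (h : IsSmooth φ) : Continuous φ :=
  isOpenQuotientMap_coe.isQuotientMap.continuous_iff.mpr (ContDiff.continuous h)

lemma IsSmooth.continuous_pderiv {φ : T3 → ℝ} (h : IsSmooth φ) (j : Fin 3) :
    Continuous (pderiv j φ) := by
  refine isOpenQuotientMap_coe.isQuotientMap.continuous_iff.mpr ?_
  set Φ : (Fin 3 → ℝ) → ℝ := fun y => φ (fun i => ((y i : ℝ) : AddCircle (2 * Real.pi))) with hΦ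
  have hd : ContDiff ℝ ((⊤ : ℕ∞) : WithTop ℕ∞) Φ := h
  have e : pderiv j φ ∘ (fun y : Fin 3 → ℝ => fun i => ((y i : ℝ) : AddCircle (2 * Real.pi)))
      = fun y => fderiv ℝ Φ y (Pi.single j 1) := by
    ext y
    have h1 : ∀ s : ℝ, φ ((fun i => ((y i : ℝ) : AddCircle (2 * Real.pi)))
        + Pi.single j ((s : ℝ) : AddCircle (2 * Real.pi))) = Φ (y + s • Pi.single j 1) := by
      intro s
      simp only [hΦ]
      congr 1
      ext i
      by_cases hij : i = j
      · subst hij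
        simp
      · simp [Pi.single_eq_of_ne hij]
    simp only [Function.comp_apply, pderiv, h1]
    have h2 : HasDerivAt (fun s : ℝ => y + s • (Pi.single j 1 : Fin 3 → ℝ)) (Pi.single j 1) 0 := by
      simpa using ((hasDerivAt_id (0 : ℝ)).smul_const (Pi.single j 1 : Fin 3 → ℝ)).const_add y
    have h3 : HasFDerivAt Φ (fderiv ℝ Φ y) (y + (0 : ℝ) • (Pi.single j 1 : Fin 3 → ℝ)) := by
      simpa using (hd.differentiable (by simp) y).hasFDerivAt
    exact (h3.comp_hasDerivAt (0 : ℝ) h2).deriv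
  rw [e]
  exact (hd.continuous_fderiv (by simp)).clm_apply continuous_const

lemma integrable_mul_continuous {h : T3 → ℝ} (hh : Integrable h) {c : T3 → ℝ}
    (hc : Continuous c) : Integrable fun x => h x * c x := by
  obtain ⟨B, hB⟩ := (isCompact_range hc).isBounded.exists_norm_le
  exact hh.mul_bdd (c := B) hc.aestronglyMeasurable (.of_forall fun x => hB _ ⟨x, rfl⟩)

lemma IsWeakDeriv.add {j : Fin 3} {f g f' g' : L2} (h : IsWeakDeriv j f g)
    (h' : IsWeakDeriv j f' g') : IsWeakDeriv j (f + f') (g + g') := by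
  intro φ hφ
  have e1 : ∫ x, (f + f' : L2) x * pderiv j φ x
      = ∫ x, (f x * pderiv j φ x + f' x * pderiv j φ x) := by
    refine integral_congr_ae ?_
    filter_upwards [Lp.coeFn_add f f'] with x hx
    rw [hx, Pi.add_apply, add_mul]
  have e2 : ∫ x, (g + g' : L2) x * φ x = ∫ x, (g x * φ x + g' x * φ x) := by
    refine integral_congr_ae ?_
    filter_upwards [Lp.coeFn_add g g'] with x hx
    rw [hx, Pi.add_apply, add_mul]
  have hc := hφ.continuous_pderiv j
  rw [e1, e2, integral_add (integrable_mul_continuous f.integrable hc)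
    (integrable_mul_continuous f'.integrable hc),
    integral_add (integrable_mul_continuous g.integrable hφ.continuous)
    (integrable_mul_continuous g'.integrable hφ.continuous), h φ hφ, h' φ hφ]
  ring

lemma isWeakDeriv_wd {j : Fin 3} {f : L2} (h : ∃ g : L2, IsWeakDeriv j f g) :
    IsWeakDeriv j f (wd j f) := by
  rw [wd, dif_pos h]
  exact h.choose_spec

/-- The coefficients i k_j f̂(k) are dictated by f. This makes the arbitrary choice inside `wd`
harmless. -/
lemma IsWeakDeriv.unique {j : Fin 3} {f g g' : L2} (h : IsWeakDeriv j f g)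
    (h' : IsWeakDeriv j f g') : g = g' :=
  fc_injective fun k => by rw [h.fc_eq, h'.fc_eq]

lemma IsWeakDeriv.wd_eq {j : Fin 3} {f g : L2} (h : IsWeakDeriv j f g) : wd j f = g :=
  (isWeakDeriv_wd ⟨g, h⟩).unique h

lemma MemH.memH_wd {m : ℕ} {f : L2} (h : MemH (m + 1) f) (j : Fin 3) : MemH m (wd j f) := by
  obtain ⟨g, hg, hm⟩ := h j
  rwa [hg.wd_eq]

lemma MemH.isWeakDeriv_wd {m : ℕ} {f : L2} (h : MemH (m + 1) f) (j : Fin 3) :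
    IsWeakDeriv j f (wd j f) := by
  obtain ⟨g, hg, -⟩ := h j
  rwa [hg.wd_eq]

lemma MemH.fc_wd {m : ℕ} {f : L2} (h : MemH (m + 1) f) (j : Fin 3) (k : Freq) :
    fc (wd j f) k = Complex.I * k j * fc f k :=
  (h.isWeakDeriv_wd j).fc_eq k

lemma MemH.add {m : ℕ} : ∀ {f g : L2}, MemH m f → MemH m g → MemH m (f + g) := by
  induction m with
  | zero => exact fun _ _ => trivial
  | succ m ih =>
    intro f g hf hg j
    obtain ⟨f', hf', hfm⟩ := hf j
    obtain ⟨g', hg', hgm⟩ := hg j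
    exact ⟨f' + g', hf'.add hg', ih hfm hgm⟩

/-- The Fourier symbol `∑_{n ≤ m} |k|^{2n}` of the squared `H^m` norm. -/
def symbolH : ℕ → Freq → ℝ
  | 0, _ => 1
  | m + 1, k => 1 + (∑ j, (k j : ℝ) ^ 2) * symbolH m k

/-- Parseval applied to every iterated derivative: each differentiation multiplies the squared
coefficient by k_j², and the recursion of `symbolH` mirrors that of `normSqH`. -/
lemma MemH.hasSum_normSqH {m : ℕ} : ∀ {f : L2}, MemH m f →
    HasSum (fun k => torusVol * (symbolH m k * ‖fc f k‖ ^ 2)) (normSqH m f) := by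
  induction m with
  | zero =>
    intro f _
    simpa [symbolH, normSqH] using hasSum_norm_sq_fc f
  | succ m ih =>
    intro f hf
    have h1 := (hasSum_norm_sq_fc f).add (hasSum_sum fun j (_ : j ∈ Finset.univ) =>
      ih (hf.memH_wd j))
    refine h1.congr_fun fun k => ?_
    simp only [symbolH, hf.fc_wd, norm_mul, Complex.norm_I, one_mul, Complex.norm_intCast,
      mul_pow, sq_abs]
    rw [add_mul, mul_add, one_mul, ← Finset.mul_sum, Finset.sum_mul, Finset.sum_mul]
    congr 2
    refine Finset.sum_congr rfl fun j _ => ?_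
    ring

/-! ### Convolutions and weighted square sums of sequences -/

/-- The sum of squares of a sequence. -/
def sqs (f : Freq → ℝ≥0∞) : ℝ≥0∞ := ∑' k, f k ^ 2

/-- The convolution of two sequences. -/
def conv (f g : Freq → ℝ≥0∞) (k : Freq) : ℝ≥0∞ := ∑' l, f (k - l) * g l

lemma ENNReal.two_mul_le_add_sq' (a b : ℝ≥0∞) : 2 * (a * b) ≤ a ^ 2 + b ^ 2 := by
  induction a with
  | top => simp
  | coe a =>
    induction b with
    | top => simp
    | coe b =>
      norm_cast
      have := two_mul_le_add_sq a b
      rwa [mul_assoc] at this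

lemma ENNReal.add_sq_le' (a b : ℝ≥0∞) : (a + b) ^ 2 ≤ 2 * (a ^ 2 + b ^ 2) := by
  have h : (a + b) ^ 2 = a ^ 2 + b ^ 2 + 2 * (a * b) := by ring
  rw [h, two_mul (a ^ 2 + b ^ 2)]
  gcongr
  exact ENNReal.two_mul_le_add_sq' a b

lemma sqs_mono {f g : Freq → ℝ≥0∞} (h : ∀ k, f k ≤ g k) : sqs f ≤ sqs g :=
  ENNReal.tsum_le_tsum fun k => by gcongr; exact h _

lemma sqs_const_mul (a : ℝ≥0∞) (f : Freq → ℝ≥0∞) : sqs (fun k => a * f k) = a ^ 2 * sqs f := by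
  simp only [sqs, mul_pow, ENNReal.tsum_mul_left]

lemma sqs_add_le (f g : Freq → ℝ≥0∞) : sqs (fun k => f k + g k) ≤ 2 * (sqs f + sqs g) := by
  simp only [sqs]
  rw [← ENNReal.tsum_add, ← ENNReal.tsum_mul_left]
  exact ENNReal.tsum_le_tsum fun k => ENNReal.add_sq_le' _ _

lemma conv_mono {f f' g g' : Freq → ℝ≥0∞} (hf : ∀ k, f k ≤ f' k) (hg : ∀ k, g k ≤ g' k)
    (k : Freq) : conv f g k ≤ conv f' g' k :=
  ENNReal.tsum_le_tsum fun _ => mul_le_mul' (hf _) (hg _)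

lemma conv_comm (f g : Freq → ℝ≥0∞) (k : Freq) : conv f g k = conv g f k := by
  unfold conv
  rw [← (Equiv.subLeft k).tsum_eq]
  simp [mul_comm]

lemma tsum_conv (f g : Freq → ℝ≥0∞) : ∑' k, conv f g k = (∑' k, f k) * ∑' k, g k := by
  simp only [conv]
  rw [ENNReal.tsum_comm]
  simp only [ENNReal.tsum_mul_right]
  have h : ∀ l : Freq, ∑' k, f (k - l) = ∑' k, f k := fun l => (Equiv.subRight l).tsum_eq f
  simp only [h, ENNReal.tsum_mul_left]

/-- Jensen's inequality for a weighted sum. -/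
lemma sq_tsum_mul_le (f g : Freq → ℝ≥0∞) :
    (∑' k, f k * g k) ^ 2 ≤ (∑' k, f k) * ∑' k, f k * g k ^ 2 := by
  -- Writing the square as a double sum and using 2ab ≤ a² + b² under it avoids dividing by the
  -- total mass, which may be zero or infinite.
  have h1 : 2 * (∑' k, f k * g k) ^ 2 = ∑' k, ∑' l, f k * f l * (2 * (g k * g l)) := by
    rw [pow_two, ← ENNReal.tsum_mul_right, ← ENNReal.tsum_mul_left]
    refine tsum_congr fun k => ?_
    rw [← ENNReal.tsum_mul_left, ← ENNReal.tsum_mul_left]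
    refine tsum_congr fun l => ?_
    ring
  have h2 : 2 * ((∑' k, f k) * ∑' k, f k * g k ^ 2)
      = ∑' k, ∑' l, f k * f l * (g k ^ 2 + g l ^ 2) := by
    have e1 : ∑' k, ∑' l, f k * f l * g k ^ 2 = (∑' k, f k) * ∑' k, f k * g k ^ 2 := by
      rw [mul_comm, ← ENNReal.tsum_mul_right]
      refine tsum_congr fun k => ?_
      rw [← ENNReal.tsum_mul_left]
      exact tsum_congr fun l => by ring
    have e2 : ∑' k, ∑' l, f k * f l * g l ^ 2 = (∑' k, f k) * ∑' k, f k * g k ^ 2 := by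
      rw [← ENNReal.tsum_mul_right]
      refine tsum_congr fun k => ?_
      rw [← ENNReal.tsum_mul_left]
      exact tsum_congr fun l => by ring
    simp only [mul_add, ENNReal.tsum_add, e1, e2, two_mul]
  have h3 : 2 * (∑' k, f k * g k) ^ 2 ≤ 2 * ((∑' k, f k) * ∑' k, f k * g k ^ 2) := by
    rw [h1, h2]
    refine ENNReal.tsum_le_tsum fun k => ENNReal.tsum_le_tsum fun l => ?_
    gcongr
    exact ENNReal.two_mul_le_add_sq' _ _
  exact (ENNReal.mul_le_mul_iff_right two_ne_zero ENNReal.ofNat_ne_top).mp h3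

/-- Young's inequality `ℓ¹ * ℓ² ⊆ ℓ²`. -/
lemma sqs_conv_le (f g : Freq → ℝ≥0∞) : sqs (conv f g) ≤ (∑' k, f k) ^ 2 * sqs g := by
  have h : ∀ k, conv f g k ^ 2 ≤ (∑' k, f k) * conv f (fun l => g l ^ 2) k := by
    intro k
    have h1 : ∑' l, f (k - l) = ∑' l, f l := (Equiv.subLeft k).tsum_eq f
    rw [← h1]
    exact sq_tsum_mul_le (fun l => f (k - l)) g
  refine (ENNReal.tsum_le_tsum h).trans (le_of_eq ?_)
  rw [ENNReal.tsum_mul_left, tsum_conv, pow_two, mul_assoc]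
  rfl

/-- Tame product estimate: a subadditive weight falls on one factor at a time, and the other factor
is left with its ℓ¹ norm through Young's inequality. -/
lemma sqs_weight_conv_le {v v₁ v₂ : Freq → ℝ≥0∞} {K : ℝ≥0∞}
    (h : ∀ k l, v k ≤ K * (v₁ l + v₂ (k - l))) (f g : Freq → ℝ≥0∞) :
    sqs (fun k => v k * conv f g k)
      ≤ 2 * K ^ 2 * ((∑' k, f k) ^ 2 * sqs (fun k => v₁ k * g k)
        + (∑' k, g k) ^ 2 * sqs (fun k => v₂ k * f k)) := by
  have h1 : ∀ k, v k * conv f g k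
      ≤ K * (conv f (fun k => v₁ k * g k) k + conv (fun k => v₂ k * f k) g k) := by
    intro k
    simp only [conv]
    rw [← ENNReal.tsum_mul_left, ← ENNReal.tsum_add, ← ENNReal.tsum_mul_left]
    refine ENNReal.tsum_le_tsum fun l => ?_
    calc v k * (f (k - l) * g l) ≤ K * (v₁ l + v₂ (k - l)) * (f (k - l) * g l) := by
          gcongr
          exact h k l
      _ = _ := by ring
  refine (sqs_mono h1).trans ?_
  rw [sqs_const_mul, mul_comm 2 (K ^ 2), mul_assoc (K ^ 2) 2]
  gcongr
  refine (sqs_add_le _ _).trans ?_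
  gcongr
  · exact sqs_conv_le _ _
  · refine le_trans (le_of_eq ?_) (sqs_conv_le _ _)
    exact congrArg sqs (funext fun k => conv_comm _ _ k)

/-- The version for a submultiplicative weight. The second factor appears only in the norm weighted
by `v₁`. This is what allows absorption when that factor is itself the unknown, with negative or
truncated weights. -/
lemma sqs_weight_conv_le_mul {v v₁ v₂ : Freq → ℝ≥0∞} {K : ℝ≥0∞}
    (h : ∀ k l, v k ≤ K * (v₂ (k - l) * v₁ l)) (f g : Freq → ℝ≥0∞) :
    sqs (fun k => v k * conv f g k)
      ≤ K ^ 2 * ((∑' k, v₂ k * f k) ^ 2 * sqs (fun k => v₁ k * g k)) := by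
  have h1 : ∀ k, v k * conv f g k
      ≤ K * conv (fun k => v₂ k * f k) (fun k => v₁ k * g k) k := by
    intro k
    simp only [conv]
    rw [← ENNReal.tsum_mul_left, ← ENNReal.tsum_mul_left]
    refine ENNReal.tsum_le_tsum fun l => ?_
    calc v k * (f (k - l) * g l) ≤ K * (v₂ (k - l) * v₁ l) * (f (k - l) * g l) := by
          gcongr
          exact h k l
      _ = _ := by ring
  refine (sqs_mono h1).trans ?_
  rw [sqs_const_mul]
  gcongr
  exact sqs_conv_le _ _

/-! ### Weights -/

/-- The weight `1 + |k₁| + |k₂| + |k₃|`. -/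
def wt (k : Freq) : ℕ := 1 + ∑ i, (k i).natAbs

lemma one_le_wt (k : Freq) : 1 ≤ wt k := Nat.le_add_right _ _

lemma wt_ne_zero (k : Freq) : wt k ≠ 0 := Nat.one_le_iff_ne_zero.mp (one_le_wt k)

lemma wt_le_add (k l : Freq) : wt k ≤ wt l + wt (k - l) := by
  simp only [wt, Fin.sum_univ_three, Pi.sub_apply]
  omega

lemma wt_neg (k : Freq) : wt (-k) = wt k := by simp [wt]

lemma natAbs_le_wt (k : Freq) (i : Fin 3) : (k i).natAbs ≤ wt k := by
  have := Finset.single_le_sum (f := fun i => (k i).natAbs) (fun _ _ => Nat.zero_le _)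
    (Finset.mem_univ i)
  simp only [wt]
  omega

/-- The weight dominates each 1 + |k_i|, so its fourth power dominates the product of the three (1 +
|k_i|)^{4/3}, and the exponent 4/3 is summable in one dimension. -/
lemma tsum_wt_ne_top : ∑' k : Freq, ((wt k : ℝ≥0∞) ^ 4)⁻¹ ≠ ∞ := by
  set a : ℤ → ℝ≥0∞ := fun n => ENNReal.ofReal ((1 + |(n : ℝ)|) ^ (-(4 / 3) : ℝ)) with ha
  have hsum : ∑' n, a n ≠ ∞ := by
    have hs : Summable fun n : ℤ => ((1 + |(n : ℝ)|) ^ (-(4 / 3) : ℝ)) := by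
      have h1 : Summable fun n : ℕ => ((1 + |((n : ℤ) : ℝ)|) ^ (-(4 / 3) : ℝ)) := by
        have h2 := (summable_nat_add_iff 1).mpr
          (Real.summable_nat_rpow.mpr (show (-(4 / 3) : ℝ) < -1 by norm_num))
        refine h2.congr fun n => ?_
        have : (1 + |((n : ℤ) : ℝ)|) = ((n + 1 : ℕ) : ℝ) := by
          push_cast
          rw [abs_of_nonneg (by positivity)]
          ring
        rw [this]
      refine Summable.of_nat_of_neg h1 ?_
      simpa using h1
    exact hs.tsum_ofReal_ne_top
  have hle : ∀ k : Freq, ((wt k : ℝ≥0∞) ^ 4)⁻¹ ≤ a (k 0) * (a (k 1) * a (k 2)) := by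
    intro k
    simp only [ha]
    rw [← ENNReal.ofReal_mul (by positivity), ← ENNReal.ofReal_mul (by positivity),
      ← Real.mul_rpow (by positivity) (by positivity),
      ← Real.mul_rpow (by positivity) (by positivity)]
    set x := 1 + |(k 0 : ℝ)| with hx'
    set y := 1 + |(k 1 : ℝ)| with hy'
    set z := 1 + |(k 2 : ℝ)| with hz'
    have hw : (wt k : ℝ) = 1 + |(k 0 : ℝ)| + |(k 1 : ℝ)| + |(k 2 : ℝ)| := by
      simp only [wt, Fin.sum_univ_three]
      push_cast
      simp only [Nat.cast_natAbs, Int.cast_abs]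
      ring
    have hw1 : (1 : ℝ) ≤ wt k := by exact_mod_cast one_le_wt k
    have hx : x ≤ wt k ∧ 0 < x := by
      constructor
      · rw [hw]
        linarith [abs_nonneg (k 1 : ℝ), abs_nonneg (k 2 : ℝ)]
      · positivity
    have hy : y ≤ wt k ∧ 0 < y := by
      constructor
      · rw [hw]
        linarith [abs_nonneg (k 0 : ℝ), abs_nonneg (k 2 : ℝ)]
      · positivity
    have hz : z ≤ wt k ∧ 0 < z := by
      constructor
      · rw [hw]
        linarith [abs_nonneg (k 0 : ℝ), abs_nonneg (k 1 : ℝ)]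
      · positivity
    have h3 : x * (y * z) ≤ (wt k : ℝ) ^ 3 := by
      calc x * (y * z) ≤ wt k * (wt k * wt k) := by
            gcongr
            · exact hx.1
            · exact hy.1
            · exact hz.1
        _ = _ := by ring
    have h4 : ((wt k : ℝ) ^ 4)⁻¹ ≤ (x * (y * z)) ^ (-(4 / 3) : ℝ) := by
      have h5 : ((wt k : ℝ) ^ 3) ^ (-(4 / 3) : ℝ) = ((wt k : ℝ) ^ 4)⁻¹ := by
        rw [← Real.rpow_natCast, ← Real.rpow_mul (by positivity), ← Real.rpow_natCast,
          ← Real.rpow_neg (by positivity)]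
        norm_num
      rw [← h5]
      exact Real.rpow_le_rpow_of_nonpos (mul_pos hx.2 (mul_pos hy.2 hz.2)) h3 (by norm_num)
    refine le_trans (le_of_eq ?_) (ENNReal.ofReal_le_ofReal h4)
    rw [ENNReal.ofReal_inv_of_pos (by positivity), ENNReal.ofReal_pow (by positivity),
      ENNReal.ofReal_natCast]
  have hinj : Function.Injective fun k : Freq => (k 0, k 1, k 2) := by
    intro k l h
    simp only [Prod.mk.injEq] at h
    ext i
    fin_cases i
    · exact h.1
    · exact h.2.1
    · exact h.2.2
  have hprod : ∑' p : ℤ × ℤ × ℤ, a p.1 * (a p.2.1 * a p.2.2)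
      = (∑' n, a n) * ((∑' n, a n) * ∑' n, a n) := by
    rw [ENNReal.tsum_prod']
    simp only [ENNReal.tsum_mul_left, ENNReal.tsum_prod', ENNReal.tsum_mul_right]
  refine ne_top_of_le_ne_top ?_ ((ENNReal.tsum_le_tsum hle).trans
    (ENNReal.tsum_comp_le_tsum_of_injective hinj fun p => a p.1 * (a p.2.1 * a p.2.2)))
  rw [hprod]
  exact ENNReal.mul_ne_top hsum (ENNReal.mul_ne_top hsum hsum)

/-- The constant of the embedding of `H²` into the sequences with summable Fourier coefficients. -/
def wienerConst : ℝ≥0∞ := ∑' k : Freq, ((wt k : ℝ≥0∞) ^ 4)⁻¹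

lemma wienerConst_ne_top : wienerConst ≠ ∞ := tsum_wt_ne_top

/-- Cauchy–Schwarz against the summable weight `wt`⁻⁴: H² embeds in the Wiener algebra in dimension
three. -/
lemma sq_tsum_le (f : Freq → ℝ≥0∞) :
    (∑' k, f k) ^ 2 ≤ wienerConst * sqs (fun k => (wt k : ℝ≥0∞) ^ 2 * f k) := by
  have h0 : ∀ k, ((wt k : ℝ≥0∞) ^ 4)⁻¹ * (wt k : ℝ≥0∞) ^ 4 = 1 := fun k =>
    ENNReal.inv_mul_cancel (by simp [wt_ne_zero]) (by simp)
  have h := sq_tsum_mul_le (fun k => ((wt k : ℝ≥0∞) ^ 4)⁻¹) (fun k => (wt k : ℝ≥0∞) ^ 4 * f k)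
  have e1 : ∀ k, ((wt k : ℝ≥0∞) ^ 4)⁻¹ * ((wt k : ℝ≥0∞) ^ 4 * f k) = f k := fun k => by
    rw [← mul_assoc, h0, one_mul]
  have e2 : ∀ k, ((wt k : ℝ≥0∞) ^ 4)⁻¹ * ((wt k : ℝ≥0∞) ^ 4 * f k) ^ 2
      = ((wt k : ℝ≥0∞) ^ 2 * f k) ^ 2 := fun k => by
    calc _ = ((wt k : ℝ≥0∞) ^ 4)⁻¹ * (wt k : ℝ≥0∞) ^ 4 * ((wt k : ℝ≥0∞) ^ 4 * f k ^ 2) := by ring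
      _ = _ := by rw [h0]; ring
  simp only [e1, e2] at h
  exact h

/-- The absorption step. Finiteness of x is indispensable, since x = ∞ satisfies the inequality
whenever b ≠ 0. -/
lemma ENNReal.le_two_mul_of_le_add_half {x a b : ℝ≥0∞} (hx : x ≠ ∞) (hb : b ≤ 2⁻¹)
    (h : x ≤ a + b * x) : x ≤ 2 * a := by
  have h1 : x ≤ a + x / 2 := by
    refine h.trans ?_
    gcongr
    rw [div_eq_mul_inv, mul_comm]
    gcongr
  have h2 : x / 2 + x / 2 ≤ a + x / 2 := by rwa [ENNReal.add_halves]
  have h3 : x / 2 ≤ a :=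
    (ENNReal.add_le_add_iff_right (ENNReal.div_ne_top hx two_ne_zero)).mp h2
  calc x = 2 * (x / 2) := (ENNReal.mul_div_cancel two_ne_zero ENNReal.ofNat_ne_top).symm
    _ ≤ 2 * a := by gcongr

/-- The truncated weight. -/
def trunc (N : ℕ) (k : Freq) : ℕ := min (wt k) N

lemma trunc_le_wt (N : ℕ) (k : Freq) : trunc N k ≤ wt k := min_le_left _ _

lemma trunc_le (N : ℕ) (k : Freq) : trunc N k ≤ N := min_le_right _ _

lemma one_le_trunc {N : ℕ} (hN : 1 ≤ N) (k : Freq) : 1 ≤ trunc N k :=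
  le_min (one_le_wt k) hN

lemma trunc_le_add (N : ℕ) (k l : Freq) : trunc N k ≤ trunc N l + wt (k - l) := by
  have := wt_le_add k l
  simp only [trunc]
  omega

lemma wt_le_two_mul (k l : Freq) : wt l ≤ 2 * (wt (k - l) * wt k) := by
  have h1 := wt_le_add l k
  rw [← neg_sub k l, wt_neg] at h1
  have h2 := one_le_wt k
  have h3 := one_le_wt (k - l)
  nlinarith

/-- A sum of two numbers that are at least 1 is at most twice their product; `1 ≤ N` keeps the
truncated weight at least 1. -/
lemma trunc_le_two_mul {N : ℕ} (hN : 1 ≤ N) (k l : Freq) :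
    trunc N k ≤ 2 * (wt (k - l) * trunc N l) := by
  have h1 := trunc_le_add N k l
  have h2 := one_le_trunc hN l
  have h3 := one_le_wt (k - l)
  nlinarith

lemma add_cube_le (a b : ℕ) : (a + b) ^ 3 ≤ 4 * (a ^ 3 + b ^ 3) := by
  zify
  nlinarith [mul_nonneg (add_nonneg (Int.natCast_nonneg a) (Int.natCast_nonneg b))
    (sq_nonneg ((a : ℤ) - b))]

lemma wt_cube_le (k l : Freq) : wt k ^ 3 ≤ 4 * (wt l ^ 3 + wt (k - l) ^ 3) :=
  (Nat.pow_le_pow_left (wt_le_add k l) 3).trans (add_cube_le _ _)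

lemma wt_fourth_le (k l : Freq) : wt k ^ 4 ≤ 8 * (wt l ^ 4 + wt (k - l) ^ 4) := by
  refine (Nat.pow_le_pow_left (wt_le_add k l) 4).trans ?_
  generalize wt l = a
  generalize wt (k - l) = b
  have := add_pow_le (Nat.zero_le a) (Nat.zero_le b) 4
  simpa using this

/-- The ratio of the truncated fourth power to the weight, the weight dual to the dissipation. -/
def dualWt (N : ℕ) (k : Freq) : ℝ≥0∞ := (trunc N k : ℝ≥0∞) ^ 4 / wt k

lemma dualWt_le (N : ℕ) (k : Freq) : dualWt N k ≤ (wt k : ℝ≥0∞) ^ 3 := by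
  refine ENNReal.div_le_of_le_mul ?_
  norm_cast
  calc trunc N k ^ 4 ≤ wt k ^ 4 := Nat.pow_le_pow_left (trunc_le_wt N k) 4
    _ = _ := by ring

lemma dualWt_le_const (N : ℕ) (k : Freq) : dualWt N k ≤ (N : ℝ≥0∞) ^ 4 := by
  refine ENNReal.div_le_of_le_mul ?_
  norm_cast
  calc trunc N k ^ 4 ≤ N ^ 4 := Nat.pow_le_pow_left (trunc_le N k) 4
    _ ≤ _ := Nat.le_mul_of_pos_right _ (one_le_wt k)

lemma dualWt_mul_wt (N : ℕ) (k : Freq) : dualWt N k * wt k = (trunc N k : ℝ≥0∞) ^ 4 :=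
  ENNReal.div_mul_cancel (by simp [wt_ne_zero]) (by simp)

/-- The dual weight grows like the cube up to the truncation and then decays, so it is not monotone.
If l dominates k - l, the frequencies k and l are comparable and so are their dual weights.
Otherwise `wt k` is at most three times `wt (k - l)` and the bound by the cube suffices. -/
lemma dualWt_le_add (N : ℕ) (k l : Freq) :
    dualWt N k ≤ 32 * (dualWt N l + (wt (k - l) : ℝ≥0∞) ^ 3) := by
  have h1 := wt_le_add k l
  have h2 := wt_le_add l k
  rw [← neg_sub k l, wt_neg] at h2
  by_cases h : 2 * wt (k - l) ≤ wt l
  · refine le_trans ?_ (mul_le_mul_right (le_add_right le_rfl) _)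
    have h3 : trunc N k ≤ 2 * trunc N l := by
      simp only [trunc]
      omega
    have h4 : wt l ≤ 2 * wt k := by omega
    refine ENNReal.div_le_of_le_mul ?_
    have h5 : (32 : ℝ≥0∞) * dualWt N l * wt k = (16 * (trunc N l : ℝ≥0∞) ^ 4) *
        (2 * wt k / wt l) := by
      rw [dualWt]
      simp only [div_eq_mul_inv]
      ring
    rw [h5]
    have h6 : (1 : ℝ≥0∞) ≤ 2 * wt k / wt l := by
      rw [ENNReal.le_div_iff_mul_le (by simp [wt_ne_zero]) (by simp), one_mul]
      exact_mod_cast h4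
    calc (trunc N k : ℝ≥0∞) ^ 4 ≤ 16 * (trunc N l : ℝ≥0∞) ^ 4 * 1 := by
          norm_cast
          calc trunc N k ^ 4 ≤ (2 * trunc N l) ^ 4 := Nat.pow_le_pow_left h3 4
            _ = _ := by ring
      _ ≤ _ := by gcongr
  · refine le_trans ?_ (mul_le_mul_right (le_add_left le_rfl) _)
    refine (dualWt_le N k).trans ?_
    norm_cast
    calc wt k ^ 3 ≤ (3 * wt (k - l)) ^ 3 := Nat.pow_le_pow_left (by omega) 3
      _ = 27 * wt (k - l) ^ 3 := by ring
      _ ≤ _ := by gcongr; norm_num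

/-- Truncation is 1-Lipschitz, so the difference of fourth powers gains a factor `wt (k - l)` and
costs only three powers of the larger weight. The factor `wt l`, the derivative in the transport
term, is thereby compensated uniformly in N. -/
lemma abs_trunc_sub_le (N : ℕ) (k l : Freq) :
    |((trunc N k : ℝ)) ^ 4 - (trunc N l : ℝ) ^ 4| * wt l
      ≤ 16 * ((wt (k - l) : ℝ) * (wt l : ℝ) ^ 4 + (wt (k - l) : ℝ) ^ 4 * wt l) := by
  have h1 : (trunc N k : ℝ) ≤ trunc N l + wt (k - l) := by exact_mod_cast trunc_le_add N k l
  have h2 : (trunc N l : ℝ) ≤ trunc N k + wt (k - l) := by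
    have := trunc_le_add N l k
    rw [← neg_sub k l, wt_neg] at this
    exact_mod_cast this
  have hl : (trunc N l : ℝ) ≤ wt l := by exact_mod_cast trunc_le_wt N l
  have hk : (trunc N k : ℝ) ≤ wt l + wt (k - l) := by linarith
  set a : ℝ := (trunc N k : ℝ)
  set b : ℝ := (trunc N l : ℝ)
  set m : ℝ := (wt (k - l) : ℝ)
  set w : ℝ := (wt l : ℝ)
  have ha : 0 ≤ a := Nat.cast_nonneg _
  have hb : 0 ≤ b := Nat.cast_nonneg _
  have hm : 0 ≤ m := Nat.cast_nonneg _
  have hw : 0 ≤ w := Nat.cast_nonneg _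
  have h3 : |a - b| ≤ m := abs_le.mpr ⟨by linarith, by linarith⟩
  have h4 : a ^ 4 - b ^ 4 = (a - b) * ((a + b) * (a ^ 2 + b ^ 2)) := by ring
  have h5 : (a + b) * (a ^ 2 + b ^ 2) ≤ (2 * (w + m)) * (2 * (w + m) ^ 2) := by
    have e1 : a ^ 2 ≤ (w + m) ^ 2 := by gcongr
    have e2 : b ^ 2 ≤ (w + m) ^ 2 := by gcongr; linarith
    have e3 : a + b ≤ 2 * (w + m) := by linarith
    have e4 : a ^ 2 + b ^ 2 ≤ 2 * (w + m) ^ 2 := by linarith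
    exact mul_le_mul e3 e4 (by positivity) (by positivity)
  have h6 : (2 * (w + m)) * (2 * (w + m) ^ 2) ≤ 16 * (w ^ 3 + m ^ 3) := by
    nlinarith [mul_nonneg (add_nonneg hw hm) (sq_nonneg (w - m))]
  rw [h4, abs_mul, abs_of_nonneg (by positivity : 0 ≤ (a + b) * (a ^ 2 + b ^ 2))]
  calc |a - b| * ((a + b) * (a ^ 2 + b ^ 2)) * w ≤ m * (16 * (w ^ 3 + m ^ 3)) * w :=
        mul_le_mul_of_nonneg_right (mul_le_mul h3 (h5.trans h6) (by positivity) hm) hw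
    _ = _ := by ring

/-! ### Complex sequences -/

/-- The pointwise norm of a complex sequence. -/
def mag (f : Freq → ℂ) (k : Freq) : ℝ≥0∞ := ‖f k‖ₑ

/-- The convolution of complex sequences. -/
def cconv (f g : Freq → ℂ) (k : Freq) : ℂ := ∑' l, f (k - l) * g l

lemma mag_cconv_le (f g : Freq → ℂ) (k : Freq) : mag (cconv f g) k ≤ conv (mag f) (mag g) k := by
  refine (enorm_tsum_le_tsum_enorm).trans (le_of_eq ?_)
  simp only [enorm_mul]
  rfl

lemma summable_of_tsum_enorm_ne_top {ι : Type*} {f : ι → ℂ} (h : ∑' i, ‖f i‖ₑ ≠ ∞) :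
    Summable f := by
  refine .of_nnnorm ?_
  exact ENNReal.tsum_coe_ne_top_iff_summable.mp h

lemma tsum_mul_le (f g : Freq → ℝ≥0∞) : 2 * ∑' k, f k * g k ≤ sqs f + sqs g := by
  rw [sqs, sqs, ← ENNReal.tsum_add, ← ENNReal.tsum_mul_left]
  exact ENNReal.tsum_le_tsum fun k => ENNReal.two_mul_le_add_sq' _ _

lemma tsum_mul_ne_top {f g : Freq → ℝ≥0∞} (hf : sqs f ≠ ∞) (hg : sqs g ≠ ∞) :
    ∑' k, f k * g k ≠ ∞ := by
  intro h
  have := tsum_mul_le f g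
  rw [h, ENNReal.mul_top two_ne_zero, top_le_iff, ENNReal.add_eq_top] at this
  exact this.elim hf hg

/-- The transport term `(u · ∇) f` in Fourier variables. -/
def transport (u : Fin 3 → Freq → ℂ) (f : Freq → ℂ) (k : Freq) : ℂ :=
  ∑ j, cconv (u j) (fun l => Complex.I * l j * f l) k

/-- The sum of the norms of the components of a vector field. -/
def mag3 (u : Fin 3 → Freq → ℂ) (k : Freq) : ℝ≥0∞ := ∑ j, mag (u j) k

lemma mag_le_mag3 (u : Fin 3 → Freq → ℂ) (j : Fin 3) (k : Freq) : mag (u j) k ≤ mag3 u k :=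
  Finset.single_le_sum (f := fun j => mag (u j) k) (fun _ _ => zero_le) (Finset.mem_univ j)

lemma enorm_intCast_le_wt (k : Freq) (j : Fin 3) : ‖((k j : ℤ) : ℂ)‖ₑ ≤ wt k := by
  have h : ‖((k j : ℤ) : ℂ)‖ = ((k j).natAbs : ℝ) := by
    rw [Complex.norm_intCast, Nat.cast_natAbs, Int.cast_abs]
  rw [← ofReal_norm, h, ENNReal.ofReal_natCast]
  exact_mod_cast natAbs_le_wt k j

lemma mag_deriv_le (f : Freq → ℂ) (j : Fin 3) (l : Freq) :
    mag (fun l => Complex.I * l j * f l) l ≤ wt l * mag f l := by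
  simp only [mag, enorm_mul]
  gcongr
  calc ‖Complex.I‖ₑ * ‖((l j : ℤ) : ℂ)‖ₑ ≤ 1 * wt l := by
        gcongr
        · simp [enorm]
        · exact enorm_intCast_le_wt l j
    _ = wt l := one_mul _

lemma sum_conv_le (u : Fin 3 → Freq → ℂ) (g : Freq → ℝ≥0∞) (k : Freq) :
    ∑ j, conv (mag (u j)) g k = conv (mag3 u) g k := by
  simp only [conv, mag3, Finset.sum_mul]
  rw [Summable.tsum_finsetSum fun _ _ => ENNReal.summable]

lemma mag_transport_le (u : Fin 3 → Freq → ℂ) (f : Freq → ℂ) (k : Freq) :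
    mag (transport u f) k ≤ conv (mag3 u) (fun l => wt l * mag f l) k := by
  rw [← sum_conv_le]
  refine (enorm_sum_le _ _).trans (Finset.sum_le_sum fun j _ => ?_)
  exact (mag_cconv_le _ _ k).trans (conv_mono (fun _ => le_rfl) (mag_deriv_le f j) k)

lemma sqs_transport_ne_top {u : Fin 3 → Freq → ℂ} {f : Freq → ℂ} (hu : ∑' k, mag3 u k ≠ ∞)
    (hf : sqs (fun k => wt k * mag f k) ≠ ∞) : sqs (mag (transport u f)) ≠ ∞ := by
  refine ne_top_of_le_ne_top ?_ ((sqs_mono (mag_transport_le u f)).trans (sqs_conv_le _ _))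
  exact ENNReal.mul_ne_top (ENNReal.pow_ne_top hu) hf

lemma summable_transport_term {u : Fin 3 → Freq → ℂ} {a : Freq → ℂ}
    (hu : ∑' k, mag3 u k ≠ ∞) (ha' : sqs (fun k => wt k * mag a k) ≠ ∞) (k : Freq) (j : Fin 3) :
    Summable fun l => u j (k - l) * (Complex.I * l j * a l) := by
  refine summable_of_tsum_enorm_ne_top ?_
  have h2 : ∑' l, ‖u j (k - l) * (Complex.I * l j * a l)‖ₑ
      ≤ ∑' l, mag3 u (k - l) * (wt l * mag a l) := by
    refine ENNReal.tsum_le_tsum fun l => ?_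
    rw [enorm_mul]
    gcongr
    · exact mag_le_mag3 u j (k - l)
    · exact mag_deriv_le a j l
  refine ne_top_of_le_ne_top ?_ h2
  have h3 : sqs (conv (mag3 u) fun l => wt l * mag a l) ≠ ∞ :=
    ne_top_of_le_ne_top (ENNReal.mul_ne_top (ENNReal.pow_ne_top hu) ha') (sqs_conv_le _ _)
  have h4 := ENNReal.ne_top_of_tsum_ne_top h3 k
  intro h5
  exact h4 (by rw [conv, h5]; simp)

/-- The transport by a divergence-free field is antisymmetric. -/
lemma re_tsum_transport_eq_zero {u : Fin 3 → Freq → ℂ} {a : Freq → ℂ}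
    (hreal : ∀ j k, u j (-k) = conj (u j k)) (hdiv : ∀ k : Freq, ∑ j, (k j : ℂ) * u j k = 0)
    (hu : ∑' k, mag3 u k ≠ ∞) (ha : sqs (mag a) ≠ ∞) (ha' : sqs (fun k => wt k * mag a k) ≠ ∞) :
    (∑' k, conj (a k) * transport u a k).re = 0 := by
  set F : Freq → Freq → ℂ := fun k l => conj (a k) * ∑ j, u j (k - l) * (Complex.I * l j * a l)
    with hF
  have hbound : ∀ k l, ‖F k l‖ₑ ≤ mag a k * (mag3 u (k - l) * (wt l * mag a l)) := by
    intro k l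
    simp only [hF, enorm_mul]
    have : ‖conj (a k)‖ₑ = mag a k := by simp [mag, enorm]
    rw [this, mag3, Finset.sum_mul]
    gcongr
    refine (enorm_sum_le _ _).trans (Finset.sum_le_sum fun j _ => ?_)
    rw [enorm_mul]
    gcongr
    · exact le_rfl
    · exact mag_deriv_le a j l
  have hsum : Summable (Function.uncurry F) := by
    refine summable_of_tsum_enorm_ne_top ?_
    rw [ENNReal.tsum_prod']
    have h1 : ∑' k, ∑' l, ‖F k l‖ₑ ≤ ∑' k, mag a k * conv (mag3 u) (fun l => wt l * mag a l) k := by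
      refine ENNReal.tsum_le_tsum fun k => ?_
      rw [conv, ← ENNReal.tsum_mul_left]
      exact ENNReal.tsum_le_tsum fun l => hbound k l
    refine ne_top_of_le_ne_top ?_ h1
    refine tsum_mul_ne_top ha (ne_top_of_le_ne_top ?_ (sqs_conv_le _ _))
    exact ENNReal.mul_ne_top (ENNReal.pow_ne_top hu) ha'
  have hcol := fun k j => summable_transport_term hu ha' k j
  have hT : ∀ k, conj (a k) * transport u a k = ∑' l, F k l := by
    intro k
    simp only [hF, transport, cconv]
    rw [tsum_mul_left, Summable.tsum_finsetSum fun j _ => hcol k j]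
  -- Incompressibility at the frequency l - k gives k·û(l - k) = l·û(l - k). Together with reality
  -- of u this makes the kernel anti-Hermitian, so the absolutely convergent double sum has zero
  -- real part.
  have hanti : ∀ k l, F l k = -conj (F k l) := by
    intro k l
    have hd := hdiv (l - k)
    simp only [Pi.sub_apply, Int.cast_sub, sub_mul, Finset.sum_sub_distrib, sub_eq_zero] at hd
    have e1 : F l k = Complex.I * a k * conj (a l) * ∑ j, (k j : ℂ) * u j (l - k) := by
      simp only [hF, Finset.mul_sum]
      exact Finset.sum_congr rfl fun j _ => by ring
    have e2 : -conj (F k l) = Complex.I * a k * conj (a l) * ∑ j, (l j : ℂ) * u j (l - k) := by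
      simp only [hF, Finset.mul_sum, map_sum, ← Finset.sum_neg_distrib]
      refine Finset.sum_congr rfl fun j _ => ?_
      have : conj (u j (k - l)) = u j (l - k) := by rw [← hreal, neg_sub]
      simp only [map_mul, Complex.conj_conj, this, Complex.conj_I, map_intCast]
      ring
    rw [e1, e2, hd]
  have hS : ∑' k, ∑' l, F k l = -conj (∑' k, ∑' l, F k l) := by
    calc ∑' k, ∑' l, F k l = ∑' l, ∑' k, F k l := hsum.tsum_comm.symm
      _ = ∑' l, ∑' k, -conj (F l k) := by
          refine tsum_congr fun l => tsum_congr fun k => hanti l k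
      _ = -conj (∑' k, ∑' l, F k l) := by
          simp only [tsum_neg, Complex.conj_tsum]
  simp only [hT]
  have := congrArg Complex.re hS
  simp only [Complex.neg_re, Complex.conj_re] at this
  linarith

/-- The commutator of a Fourier multiplier with the transport. -/
def transportComm (V : Freq → ℝ) (u : Fin 3 → Freq → ℂ) (f : Freq → ℂ) (k : Freq) : ℂ :=
  V k * transport u f k - transport u (fun l => V l * f l) k

lemma mag_weight_le {V : Freq → ℝ} {B : ℝ} (hV : ∀ k, |V k| ≤ B) (f : Freq → ℂ) (k : Freq) :
    mag (fun l => V l * f l) k ≤ ENNReal.ofReal B * mag f k := by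
  simp only [mag, enorm_mul]
  gcongr
  rw [← ofReal_norm, Complex.norm_real]
  exact ENNReal.ofReal_le_ofReal (hV k)

lemma sqs_weight_ne_top {V : Freq → ℝ} {B : ℝ} (hV : ∀ k, |V k| ≤ B) {f : Freq → ℂ}
    {v : Freq → ℝ≥0∞} (hf : sqs (fun k => v k * mag f k) ≠ ∞) :
    sqs (fun k => v k * mag (fun l => V l * f l) k) ≠ ∞ := by
  have h : ∀ k, v k * mag (fun l => V l * f l) k ≤ ENNReal.ofReal B * (v k * mag f k) := by
    intro k
    calc _ ≤ v k * (ENNReal.ofReal B * mag f k) := by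
          gcongr
          exact mag_weight_le hV f k
      _ = _ := by ring
  refine ne_top_of_le_ne_top ?_ (sqs_mono h)
  rw [sqs_const_mul]
  exact ENNReal.mul_ne_top (ENNReal.pow_ne_top ENNReal.ofReal_ne_top) hf

lemma enorm_conj (z : ℂ) : ‖conj z‖ₑ = ‖z‖ₑ := by
  rw [← ofReal_norm, ← ofReal_norm, Complex.norm_conj]

lemma summable_conj_mul {a b : Freq → ℂ} (ha : sqs (mag a) ≠ ∞) (hb : sqs (mag b) ≠ ∞) :
    Summable fun k => conj (a k) * b k := by
  refine summable_of_tsum_enorm_ne_top ?_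
  simp only [enorm_mul, enorm_conj]
  exact tsum_mul_ne_top ha hb

lemma sqs_mag_le_wt (f : Freq → ℂ) : sqs (mag f) ≤ sqs (fun k => wt k * mag f k) := by
  refine sqs_mono fun k => ?_
  calc mag f k = 1 * mag f k := (one_mul _).symm
    _ ≤ wt k * mag f k := by
      gcongr
      exact_mod_cast one_le_wt k

/-- In a weighted energy identity only the commutator of the transport term contributes. -/
lemma re_tsum_weight_transport {V : Freq → ℝ} {B : ℝ} (hV : ∀ k, |V k| ≤ B)
    {u : Fin 3 → Freq → ℂ} {f : Freq → ℂ}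
    (hreal : ∀ j k, u j (-k) = conj (u j k)) (hdiv : ∀ k : Freq, ∑ j, (k j : ℂ) * u j k = 0)
    (hu : ∑' k, mag3 u k ≠ ∞) (hf : sqs (fun k => wt k * mag f k) ≠ ∞) :
    (∑' k, conj ((V k : ℂ) * f k) * ((V k : ℂ) * transport u f k)).re
      = (∑' k, conj ((V k : ℂ) * f k) * transportComm V u f k).re := by
  set a : Freq → ℂ := fun k => V k * f k with ha
  have ha' : sqs (fun k => wt k * mag a k) ≠ ∞ := sqs_weight_ne_top hV hf
  have ha0 : sqs (mag a) ≠ ∞ := ne_top_of_le_ne_top ha' (sqs_mag_le_wt a)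
  have h1 : sqs (mag (transport u a)) ≠ ∞ := sqs_transport_ne_top hu ha'
  have h2 : sqs (mag fun k => (V k : ℂ) * transport u f k) ≠ ∞ := by
    have := sqs_weight_ne_top (v := fun _ => 1) hV (f := transport u f)
      (by simpa using sqs_transport_ne_top hu hf)
    simpa using this
  have h3 : ∀ k, conj (a k) * transportComm V u f k
      = conj (a k) * ((V k : ℂ) * transport u f k) - conj (a k) * transport u a k := by
    intro k
    rw [transportComm, mul_sub]
  change (∑' k, conj (a k) * ((V k : ℂ) * transport u f k)).re
    = (∑' k, conj (a k) * transportComm V u f k).re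
  simp only [h3]
  rw [Summable.tsum_sub (summable_conj_mul ha0 h2) (summable_conj_mul ha0 h1), Complex.sub_re,
    re_tsum_transport_eq_zero hreal hdiv hu ha0 ha', sub_zero]

lemma transportComm_one (u : Fin 3 → Freq → ℂ) (f : Freq → ℂ) (k : Freq) :
    transportComm (fun _ => 1) u f k = 0 := by
  simp [transportComm]

/-- The commutator of the truncated weight with the transport. -/
lemma sqs_transportComm_le (N : ℕ) {u : Fin 3 → Freq → ℂ} {f : Freq → ℂ}
    (hu : ∑' k, mag3 u k ≠ ∞) (hf : sqs (fun k => wt k * mag f k) ≠ ∞) :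
    sqs (mag (transportComm (fun k => (trunc N k : ℝ) ^ 4) u f))
      ≤ 512 * wienerConst * (sqs (fun k => (wt k : ℝ≥0∞) ^ 3 * mag3 u k)
          * sqs (fun k => (wt k : ℝ≥0∞) ^ 4 * mag f k)
        + sqs (fun k => (wt k : ℝ≥0∞) ^ 3 * mag f k)
          * sqs (fun k => (wt k : ℝ≥0∞) ^ 4 * mag3 u k)) := by
  have hV : ∀ k, |(fun k => (trunc N k : ℝ) ^ 4) k| ≤ (N : ℝ) ^ 4 := by
    intro k
    rw [abs_of_nonneg (by positivity)]
    have : (trunc N k : ℝ) ≤ N := by exact_mod_cast trunc_le N k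
    dsimp only
    gcongr
  set V : Freq → ℝ := fun k => (trunc N k : ℝ) ^ 4 with hVdef
  have hVf : sqs (fun k => wt k * mag (fun l => V l * f l) k) ≠ ∞ := sqs_weight_ne_top hV hf
  -- The commutator has kernel V k - V l, whose Lipschitz bound recovers the derivative lost in the
  -- transport term.
  have hrep : ∀ k, transportComm V u f k
      = ∑ j, ∑' l, ((V k - V l : ℝ) : ℂ) * (u j (k - l) * (Complex.I * l j * f l)) := by
    intro k
    simp only [transportComm, transport, cconv, Finset.mul_sum]
    rw [← Finset.sum_sub_distrib]
    refine Finset.sum_congr rfl fun j _ => ?_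
    rw [← tsum_mul_left, ← Summable.tsum_sub ((summable_transport_term hu hf k j).mul_left _)
      (summable_transport_term hu hVf k j)]
    refine tsum_congr fun l => ?_
    push_cast
    ring
  have hb : ∀ k, mag (transportComm V u f) k
      ≤ 16 * (conv (fun k => wt k * mag3 u k) (fun l => (wt l : ℝ≥0∞) ^ 4 * mag f l) k
        + conv (fun k => (wt k : ℝ≥0∞) ^ 4 * mag3 u k) (fun l => wt l * mag f l) k) := by
    intro k
    have hterm : ∀ j l, ‖((V k - V l : ℝ) : ℂ) * (u j (k - l) * (Complex.I * l j * f l))‖ₑ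
        ≤ mag (u j) (k - l) * (ENNReal.ofReal (|V k - V l| * wt l) * mag f l) := by
      intro j l
      have e1 : ‖((V k - V l : ℝ) : ℂ)‖ₑ = ENNReal.ofReal |V k - V l| := by
        rw [← ofReal_norm, Complex.norm_real, Real.norm_eq_abs]
      rw [enorm_mul, enorm_mul, e1, ENNReal.ofReal_mul (abs_nonneg _), ENNReal.ofReal_natCast]
      calc _ ≤ ENNReal.ofReal |V k - V l| * (mag (u j) (k - l) * (wt l * mag f l)) := by
            gcongr
            · exact le_rfl
            · exact mag_deriv_le f j l
        _ = _ := by ring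
    have hw : ∀ l, ENNReal.ofReal (|V k - V l| * wt l)
        ≤ 16 * ((wt (k - l) : ℝ≥0∞) * (wt l : ℝ≥0∞) ^ 4 + (wt (k - l) : ℝ≥0∞) ^ 4 * wt l) := by
      intro l
      refine (ENNReal.ofReal_le_ofReal (abs_trunc_sub_le N k l)).trans (le_of_eq ?_)
      have : (16 * ((wt (k - l) : ℝ) * (wt l : ℝ) ^ 4 + (wt (k - l) : ℝ) ^ 4 * wt l))
        = ((16 * (wt (k - l) * wt l ^ 4 + wt (k - l) ^ 4 * wt l) : ℕ) : ℝ) := by push_cast; ring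
      rw [this, ENNReal.ofReal_natCast]
      push_cast
      ring
    rw [mag, hrep]
    calc _ ≤ ∑ j, ∑' l, mag (u j) (k - l) * (ENNReal.ofReal (|V k - V l| * wt l) * mag f l) := by
          refine (enorm_sum_le _ _).trans (Finset.sum_le_sum fun j _ => ?_)
          exact enorm_tsum_le_tsum_enorm.trans (ENNReal.tsum_le_tsum fun l => hterm j l)
      _ = ∑' l, mag3 u (k - l) * (ENNReal.ofReal (|V k - V l| * wt l) * mag f l) := by
          simp only [mag3, Finset.sum_mul]
          rw [Summable.tsum_finsetSum fun _ _ => ENNReal.summable]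
      _ ≤ ∑' l, mag3 u (k - l) * (16 * ((wt (k - l) : ℝ≥0∞) * (wt l : ℝ≥0∞) ^ 4
          + (wt (k - l) : ℝ≥0∞) ^ 4 * wt l) * mag f l) := by
          refine ENNReal.tsum_le_tsum fun l => ?_
          gcongr
          exact hw l
      _ = _ := by
          simp only [conv]
          rw [← ENNReal.tsum_add, ← ENNReal.tsum_mul_left]
          exact tsum_congr fun l => by ring
  refine (sqs_mono hb).trans ?_
  rw [sqs_const_mul]
  have h1 := sq_tsum_le (fun k => wt k * mag3 u k)
  have h2 := sq_tsum_le (fun k => wt k * mag f k)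
  have e : ∀ g : Freq → ℝ≥0∞, (fun k => (wt k : ℝ≥0∞) ^ 2 * (wt k * g k))
      = fun k => (wt k : ℝ≥0∞) ^ 3 * g k := by
    intro g
    ext k
    ring
  rw [e] at h1 h2
  calc _ ≤ (16 : ℝ≥0∞) ^ 2 * (2 * ((∑' k, wt k * mag3 u k) ^ 2
          * sqs (fun k => (wt k : ℝ≥0∞) ^ 4 * mag f k)
        + (∑' k, wt k * mag f k) ^ 2 * sqs (fun k => (wt k : ℝ≥0∞) ^ 4 * mag3 u k))) := by
        gcongr
        refine (sqs_add_le _ _).trans ?_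
        gcongr
        · exact sqs_conv_le _ _
        · refine le_trans (le_of_eq ?_) (sqs_conv_le _ _)
          exact congrArg sqs (funext fun k => conv_comm _ _ k)
    _ ≤ (16 : ℝ≥0∞) ^ 2 * (2 * ((wienerConst * sqs (fun k => (wt k : ℝ≥0∞) ^ 3 * mag3 u k))
          * sqs (fun k => (wt k : ℝ≥0∞) ^ 4 * mag f k)
        + (wienerConst * sqs (fun k => (wt k : ℝ≥0∞) ^ 3 * mag f k))
          * sqs (fun k => (wt k : ℝ≥0∞) ^ 4 * mag3 u k))) := by
        gcongr
    _ = _ := by ring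

/-! ### Nonlinear estimates for nonnegative sequences -/

/-- The `ℓ¹` norm of a frequency. -/
def freqAbs (k : Freq) : ℕ := ∑ i, (k i).natAbs

lemma wt_eq (k : Freq) : wt k = 1 + freqAbs k := rfl

lemma freqAbs_le_wt (k : Freq) : freqAbs k ≤ wt k := Nat.le_add_left _ _

lemma one_le_wt_cast (k : Freq) : (1 : ℝ≥0∞) ≤ wt k := by exact_mod_cast one_le_wt k

lemma sqs_wt_pow_mono {m n : ℕ} (h : m ≤ n) (f : Freq → ℝ≥0∞) :
    sqs (fun k => (wt k : ℝ≥0∞) ^ m * f k) ≤ sqs (fun k => (wt k : ℝ≥0∞) ^ n * f k) := by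
  refine sqs_mono fun k => ?_
  gcongr
  exact one_le_wt_cast k

lemma sqs_le_wt_pow (n : ℕ) (f : Freq → ℝ≥0∞) :
    sqs f ≤ sqs (fun k => (wt k : ℝ≥0∞) ^ n * f k) := by
  simpa using sqs_wt_pow_mono (Nat.zero_le n) f

lemma sqs_add_three_le (f g h : Freq → ℝ≥0∞) :
    sqs (fun k => f k + g k + h k) ≤ 4 * (sqs f + sqs g + sqs h) := by
  calc _ ≤ 2 * (2 * (sqs f + sqs g) + sqs h) := by
        refine (sqs_add_le _ _).trans ?_
        gcongr
        exact sqs_add_le _ _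
    _ = 4 * (sqs f + sqs g) + 2 * sqs h := by ring
    _ ≤ 4 * (sqs f + sqs g) + 4 * sqs h := by gcongr; norm_num
    _ = _ := by ring

lemma sqs_add_four_le (f g h i : Freq → ℝ≥0∞) :
    sqs (fun k => f k + g k + h k + i k) ≤ 8 * (sqs f + sqs g + sqs h + sqs i) := by
  calc _ ≤ 2 * (4 * (sqs f + sqs g + sqs h) + sqs i) := by
        refine (sqs_add_le _ _).trans ?_
        gcongr
        exact sqs_add_three_le _ _ _
    _ = 8 * (sqs f + sqs g + sqs h) + 2 * sqs i := by ring
    _ ≤ 8 * (sqs f + sqs g + sqs h) + 8 * sqs i := by gcongr; norm_num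
    _ = _ := by ring

lemma sq_tsum_le_of_sqs_le {f : Freq → ℝ≥0∞} {h : ℝ≥0∞} {n : ℕ} (hn : 2 ≤ n)
    (hf : sqs (fun k => (wt k : ℝ≥0∞) ^ n * f k) ≤ h) : (∑' k, f k) ^ 2 ≤ wienerConst * h := by
  refine (sq_tsum_le f).trans ?_
  gcongr
  exact (sqs_wt_pow_mono hn f).trans hf

lemma sq_tsum_wt_le_of_sqs_le {f : Freq → ℝ≥0∞} {h : ℝ≥0∞} {m n : ℕ} (hn : m + 2 ≤ n)
    (hf : sqs (fun k => (wt k : ℝ≥0∞) ^ n * f k) ≤ h) :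
    (∑' k, (wt k : ℝ≥0∞) ^ m * f k) ^ 2 ≤ wienerConst * h := by
  refine (sq_tsum_le _).trans ?_
  gcongr
  refine le_trans (le_of_eq ?_) ((sqs_wt_pow_mono hn f).trans hf)
  refine congrArg sqs (funext fun k => ?_)
  ring

/-- `H³` is an algebra. -/
lemma sqs_wt_cube_conv_le {f g : Freq → ℝ≥0∞} {a b : ℝ≥0∞}
    (hf : sqs (fun k => (wt k : ℝ≥0∞) ^ 3 * f k) ≤ a)
    (hg : sqs (fun k => (wt k : ℝ≥0∞) ^ 3 * g k) ≤ b) :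
    sqs (fun k => (wt k : ℝ≥0∞) ^ 3 * conv f g k) ≤ 64 * wienerConst * (a * b) := by
  have h := sqs_weight_conv_le (v := fun k => (wt k : ℝ≥0∞) ^ 3)
    (v₁ := fun k => (wt k : ℝ≥0∞) ^ 3) (v₂ := fun k => (wt k : ℝ≥0∞) ^ 3) (K := 4)
    (fun k l => by exact_mod_cast wt_cube_le k l) f g
  have h1 := sq_tsum_le_of_sqs_le (n := 3) (by norm_num) hf
  have h2 := sq_tsum_le_of_sqs_le (n := 3) (by norm_num) hg
  calc _ ≤ 2 * 4 ^ 2 * ((wienerConst * a) * b + (wienerConst * b) * a) := h.trans (by gcongr)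
    _ = _ := by ring

/-- Every monomial contains a factor W. That factor stays in ℓ² and the others are taken in ℓ¹, so
the bound carries `sqs W`, which is dissipated, and never the ℓ² norm of J, which is not. -/
lemma sqs_quadratic_cubic_le {W J q : Freq → ℝ≥0∞} {CQ : ℝ≥0∞}
    (hq : ∀ k, q k ≤ CQ * (conv W W k + conv J W k + conv W (conv J W) k)) {h : ℝ≥0∞}
    (h1 : h ≤ 1) (hW : sqs (fun k => (wt k : ℝ≥0∞) ^ 4 * W k) ≤ h)
    (hJ : sqs (fun k => (wt k : ℝ≥0∞) ^ 4 * J k) ≤ h) :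
    sqs q ≤ CQ ^ 2 * (4 * (2 * wienerConst + wienerConst ^ 2)) * (h * sqs W) := by
  have eW := sq_tsum_le_of_sqs_le (n := 4) (by norm_num) hW
  have eJ := sq_tsum_le_of_sqs_le (n := 4) (by norm_num) hJ
  refine (sqs_mono hq).trans ?_
  rw [sqs_const_mul]
  calc _ ≤ CQ ^ 2 * (4 * (wienerConst * h * sqs W + wienerConst * h * sqs W
          + wienerConst * h * (wienerConst * h * sqs W))) := by
        gcongr
        refine (sqs_add_three_le _ _ _).trans ?_
        gcongr
        · exact (sqs_conv_le _ _).trans (by gcongr)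
        · exact (sqs_conv_le _ _).trans (by gcongr)
        · refine (sqs_conv_le _ _).trans ?_
          gcongr
          exact (sqs_conv_le _ _).trans (by gcongr)
    _ ≤ CQ ^ 2 * (4 * (wienerConst * h * sqs W + wienerConst * h * sqs W
          + wienerConst * 1 * (wienerConst * h * sqs W))) := by gcongr
    _ = _ := by ring

lemma sqs_wt_cube_quadratic_cubic_le {W J q : Freq → ℝ≥0∞} {CQ : ℝ≥0∞}
    (hq : ∀ k, q k ≤ CQ * (conv W W k + conv J W k + conv W (conv J W) k)) {h : ℝ≥0∞}
    (h1 : h ≤ 1) (hW : sqs (fun k => (wt k : ℝ≥0∞) ^ 3 * W k) ≤ h)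
    (hJ : sqs (fun k => (wt k : ℝ≥0∞) ^ 3 * J k) ≤ h) :
    sqs (fun k => (wt k : ℝ≥0∞) ^ 3 * q k)
      ≤ CQ ^ 2 * (4 * (2 * (64 * wienerConst) + (64 * wienerConst) ^ 2)) * (h * h) := by
  set A := 64 * wienerConst with hA
  have e : ∀ k, (wt k : ℝ≥0∞) ^ 3 * q k ≤ CQ * ((wt k : ℝ≥0∞) ^ 3 * conv W W k
      + (wt k : ℝ≥0∞) ^ 3 * conv J W k + (wt k : ℝ≥0∞) ^ 3 * conv W (conv J W) k) := by
    intro k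
    calc _ ≤ (wt k : ℝ≥0∞) ^ 3 * (CQ * (conv W W k + conv J W k + conv W (conv J W) k)) := by
          gcongr
          exact hq k
      _ = _ := by ring
  refine (sqs_mono e).trans ?_
  rw [sqs_const_mul]
  have hJW : sqs (fun k => (wt k : ℝ≥0∞) ^ 3 * conv J W k) ≤ A * (h * h) :=
    sqs_wt_cube_conv_le hJ hW
  calc _ ≤ CQ ^ 2 * (4 * (A * (h * h) + A * (h * h) + A * (h * (A * (h * h))))) := by
        gcongr
        refine (sqs_add_three_le _ _ _).trans ?_
        gcongr
        · exact sqs_wt_cube_conv_le hW hW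
        · exact sqs_wt_cube_conv_le hW hJW
    _ ≤ CQ ^ 2 * (4 * (A * (h * h) + A * (h * h) + A * (1 * (A * (h * h))))) := by gcongr
    _ = _ := by ring

/-- The nonlinearity of the angular momentum equation in `H⁻¹`. -/
lemma exists_nonlinear_estimate_low {CR CA CQ : ℝ≥0∞} (hR : CR ≠ ∞) (hA : CA ≠ ∞) (hQ : CQ ≠ ∞) :
    ∃ C : ℝ≥0∞, C ≠ ∞ ∧ ∃ δ : ℝ≥0∞, δ ≠ 0 ∧ δ ≤ 1 ∧ ∀ (U W J a g q : Freq → ℝ≥0∞) (h : ℝ≥0∞),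
      (∀ k, g k ≤ CR * (freqAbs k * U k + wt k ^ 2 * W k + a k + q k) + CA * conv J g k) →
      (∀ k, q k ≤ CQ * (conv W W k + conv J W k + conv W (conv J W) k)) →
      sqs g ≠ ∞ → sqs (fun k => (wt k : ℝ≥0∞) ^ 4 * W k) ≤ h →
      sqs (fun k => (wt k : ℝ≥0∞) ^ 4 * J k) ≤ h → h ≤ δ →
      sqs (fun k => (wt k : ℝ≥0∞)⁻¹ * (q k + CA * conv J g k))
        ≤ C * h * (sqs (fun k => freqAbs k * U k) + sqs (fun k => wt k * W k) + sqs a) := by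
  have hw := wienerConst_ne_top
  set c₁ : ℝ≥0∞ := CQ ^ 2 * (4 * (2 * wienerConst + wienerConst ^ 2)) with hc₁
  set c₂ : ℝ≥0∞ := 2 * CA ^ 2 * (4 * wienerConst) with hc₂
  have hc₁t : c₁ ≠ ∞ := by finiteness
  have hc₂t : c₂ ≠ ∞ := by finiteness
  -- The bound 1 on δ reduces cubic terms to quadratic ones; the bound (2c₂)⁻¹ makes the feedback of
  -- g into itself at most one half.
  refine ⟨2 * c₁ + c₂ * (4 * (CR ^ 2 * (8 * (1 + c₁)))), by finiteness,
    min 1 ((2 * c₂)⁻¹), ?_, min_le_left _ _, ?_⟩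
  · exact (lt_min zero_lt_one (ENNReal.inv_pos.mpr (by finiteness))).ne'
  intro U W J a g q h hg hq hgt hW hJ hδ
  have h1 : h ≤ 1 := hδ.trans (min_le_left _ _)
  have h2 : c₂ * h ≤ 2⁻¹ := by
    by_cases hz : c₂ = 0
    · simp [hz]
    calc c₂ * h ≤ c₂ * (2 * c₂)⁻¹ := by
          gcongr
          exact hδ.trans (min_le_right _ _)
      _ = 2⁻¹ := by
          rw [ENNReal.mul_inv (by simp) (by simp), mul_comm, mul_assoc,
            ENNReal.inv_mul_cancel hz hc₂t, mul_one]
  have hwt : ∀ k, (wt k : ℝ≥0∞)⁻¹ ≤ 1 := fun k => ENNReal.inv_le_one.mpr (one_le_wt_cast k)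
  have hsq := sqs_quadratic_cubic_le hq h1 hW hJ
  have hWW : sqs W ≤ sqs (fun k => wt k * W k) := by simpa using sqs_le_wt_pow 1 W
  set D := sqs (fun k => freqAbs k * U k) + sqs (fun k => wt k * W k) + sqs a with hD
  have hqD : sqs q ≤ c₁ * (h * D) := by
    refine hsq.trans ?_
    gcongr
    refine hWW.trans ?_
    rw [hD]
    exact le_add_right le_add_self
  have hJ1 := sq_tsum_wt_le_of_sqs_le (m := 1) (n := 4) (by norm_num) hJ
  simp only [pow_one] at hJ1
  -- The sequence g is bounded only implicitly, by itself convolved with J. Its H⁻¹ norm x is finite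
  -- because g is square summable, so the small feedback term can be absorbed.
  set x := sqs (fun k => (wt k : ℝ≥0∞)⁻¹ * g k) with hx
  have hxt : x ≠ ∞ := by
    refine ne_top_of_le_ne_top hgt (sqs_mono fun k => ?_)
    calc _ ≤ 1 * g k := by gcongr; exact hwt k
      _ = g k := one_mul _
  have hconv : sqs (fun k => (wt k : ℝ≥0∞)⁻¹ * conv J g k) ≤ 4 * wienerConst * h * x := by
    have := sqs_weight_conv_le_mul (v := fun k => (wt k : ℝ≥0∞)⁻¹)
      (v₁ := fun k => (wt k : ℝ≥0∞)⁻¹) (v₂ := fun k => (wt k : ℝ≥0∞)) (K := 2) ?_ J g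
    · calc _ ≤ _ := this
        _ ≤ 2 ^ 2 * ((wienerConst * h) * x) := by gcongr
        _ = _ := by ring
    · intro k l
      rw [← div_eq_mul_inv, mul_div_assoc', ENNReal.le_div_iff_mul_le (by simp [wt_ne_zero])
        (by simp), mul_comm, ← div_eq_mul_inv]
      refine ENNReal.div_le_of_le_mul ?_
      have := wt_le_two_mul k l
      rw [mul_assoc]
      exact_mod_cast this
  have hRbound : sqs (fun k => (wt k : ℝ≥0∞)⁻¹ * (CR * (freqAbs k * U k + wt k ^ 2 * W k + a k
      + q k))) ≤ CR ^ 2 * (8 * (1 + c₁)) * D := by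
    have e : ∀ k, (wt k : ℝ≥0∞)⁻¹ * (CR * (freqAbs k * U k + wt k ^ 2 * W k + a k + q k))
        ≤ CR * (freqAbs k * U k + wt k * W k + a k + q k) := by
      intro k
      have e1 : (wt k : ℝ≥0∞)⁻¹ * (wt k : ℝ≥0∞) ^ 2 = wt k := by
        rw [pow_two, ← mul_assoc, ENNReal.inv_mul_cancel (by simp [wt_ne_zero]) (by simp), one_mul]
      calc _ = CR * ((wt k : ℝ≥0∞)⁻¹ * (freqAbs k * U k) + (wt k : ℝ≥0∞)⁻¹ * wt k ^ 2 * W k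
            + (wt k : ℝ≥0∞)⁻¹ * a k + (wt k : ℝ≥0∞)⁻¹ * q k) := by ring
        _ ≤ CR * (1 * (freqAbs k * U k) + wt k * W k + 1 * a k + 1 * q k) := by
          rw [e1]
          gcongr
          · exact hwt k
          · exact hwt k
          · exact hwt k
        _ = _ := by ring
    refine (sqs_mono e).trans ?_
    rw [sqs_const_mul]
    calc _ ≤ CR ^ 2 * (8 * (D + c₁ * (h * D))) := by
          gcongr
          refine (sqs_add_four_le _ _ _ _).trans ?_
          gcongr
      _ ≤ CR ^ 2 * (8 * (D + c₁ * (1 * D))) := by gcongr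
      _ = _ := by ring
  have hx2 : x ≤ 2 * (2 * (CR ^ 2 * (8 * (1 + c₁)) * D)) := by
    refine ENNReal.le_two_mul_of_le_add_half hxt h2 ?_
    have e : ∀ k, (wt k : ℝ≥0∞)⁻¹ * g k ≤ (wt k : ℝ≥0∞)⁻¹ * (CR * (freqAbs k * U k
        + wt k ^ 2 * W k + a k + q k)) + CA * ((wt k : ℝ≥0∞)⁻¹ * conv J g k) := by
      intro k
      calc _ ≤ (wt k : ℝ≥0∞)⁻¹ * (CR * (freqAbs k * U k + wt k ^ 2 * W k + a k + q k)
            + CA * conv J g k) := by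
            gcongr
            exact hg k
        _ = _ := by ring
    calc x ≤ 2 * (CR ^ 2 * (8 * (1 + c₁)) * D + CA ^ 2 * (4 * wienerConst * h * x)) := by
          refine (sqs_mono e).trans ((sqs_add_le _ _).trans ?_)
          rw [sqs_const_mul]
          gcongr
      _ = _ := by rw [hc₂]; ring
  have e : ∀ k, (wt k : ℝ≥0∞)⁻¹ * (q k + CA * conv J g k)
      ≤ q k + CA * ((wt k : ℝ≥0∞)⁻¹ * conv J g k) := by
    intro k
    calc _ = (wt k : ℝ≥0∞)⁻¹ * q k + CA * ((wt k : ℝ≥0∞)⁻¹ * conv J g k) := by ring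
      _ ≤ 1 * q k + CA * ((wt k : ℝ≥0∞)⁻¹ * conv J g k) := by
        gcongr
        exact hwt k
      _ = _ := by ring
  calc _ ≤ 2 * (c₁ * (h * D) + CA ^ 2 * (4 * wienerConst * h
        * (2 * (2 * (CR ^ 2 * (8 * (1 + c₁)) * D))))) := by
        refine (sqs_mono e).trans ((sqs_add_le _ _).trans ?_)
        rw [sqs_const_mul]
        gcongr
        exact hconv.trans (by gcongr)
    _ = _ := by rw [hc₂]; ring

/-- On a finite set of frequencies the truncation is inactive once N is large, so a bound uniform in
N passes to the full weight. -/
lemma sqs_wt_sq_le_of_trunc {g : Freq → ℝ≥0∞} {C : ℝ≥0∞}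
    (h : ∀ N : ℕ, 1 ≤ N → sqs (fun k => (trunc N k : ℝ≥0∞) ^ 2 * g k) ≤ C) :
    sqs (fun k => (wt k : ℝ≥0∞) ^ 2 * g k) ≤ C := by
  rw [sqs, ENNReal.tsum_eq_iSup_sum]
  refine iSup_le fun s => ?_
  refine le_trans ?_ (h (1 + ∑ k ∈ s, wt k) (Nat.le_add_right _ _))
  refine le_trans (Finset.sum_le_sum fun k hk => ?_) (ENNReal.sum_le_tsum s)
  have h1 : wt k ≤ ∑ k ∈ s, wt k := Finset.single_le_sum (fun _ _ => Nat.zero_le _) hk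
  have h2 : trunc (1 + ∑ k ∈ s, wt k) k = wt k := min_eq_left (by omega)
  simp only [h2, le_refl]

/-- The nonlinearity of the angular momentum equation in `H³`. -/
lemma exists_nonlinear_estimate_high {CR CA CQ : ℝ≥0∞} (hR : CR ≠ ∞) (hA : CA ≠ ∞)
    (hQ : CQ ≠ ∞) :
    ∃ C : ℝ≥0∞, C ≠ ∞ ∧ ∃ δ : ℝ≥0∞, δ ≠ 0 ∧ δ ≤ 1 ∧
      ∀ (N : ℕ) (U W J a g q : Freq → ℝ≥0∞) (h₃ h₄ : ℝ≥0∞),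
      (∀ k, g k ≤ CR * (freqAbs k * U k + wt k ^ 2 * W k + a k + q k) + CA * conv J g k) →
      (∀ k, q k ≤ CQ * (conv W W k + conv J W k + conv W (conv J W) k)) → (∀ k, a k ≤ J k) →
      sqs g ≠ ∞ → sqs (fun k => (wt k : ℝ≥0∞) ^ 4 * U k) ≤ h₄ →
      sqs (fun k => (wt k : ℝ≥0∞) ^ 3 * W k) ≤ h₃ → sqs (fun k => (wt k : ℝ≥0∞) ^ 4 * W k) ≤ h₄ →
      sqs (fun k => (wt k : ℝ≥0∞) ^ 3 * J k) ≤ h₃ → sqs (fun k => (wt k : ℝ≥0∞) ^ 4 * J k) ≤ h₄ →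
      h₃ ≤ h₄ → h₄ ≤ δ →
      sqs (fun k => dualWt N k * (q k + CA * conv J g k))
        ≤ C * h₃ * (sqs (fun k => (trunc N k : ℝ≥0∞) ^ 4 * (wt k * W k)) + h₄) := by
  have hw := wienerConst_ne_top
  set c₁ : ℝ≥0∞ := CQ ^ 2 * (4 * (2 * (64 * wienerConst) + (64 * wienerConst) ^ 2)) with hc₁
  set c₂ : ℝ≥0∞ := 2 * CA ^ 2 * (16 * wienerConst) with hc₂
  have hc₁t : c₁ ≠ ∞ := by finiteness
  have hc₂t : c₂ ≠ ∞ := by finiteness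
  set c₃ : ℝ≥0∞ := CR ^ 2 * (8 * (3 + c₁)) with hc₃
  have hc₃t : c₃ ≠ ∞ := by finiteness
  set c₄ : ℝ≥0∞ := 2048 * wienerConst * (2 * CA ^ 2) with hc₄
  have hc₄t : c₄ ≠ ∞ := by finiteness
  set c₅ : ℝ≥0∞ := 2 * (2048 * wienerConst * (2 * c₃ + 4 * c₃)) with hc₅
  have hc₅t : c₅ ≠ ∞ := by finiteness
  have small : ∀ {c h : ℝ≥0∞}, c ≠ ∞ → h ≤ (2 * c)⁻¹ → c * h ≤ 2⁻¹ := by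
    intro c h hc hh
    by_cases hz : c = 0
    · simp [hz]
    calc c * h ≤ c * (2 * c)⁻¹ := by gcongr
      _ = 2⁻¹ := by
          rw [ENNReal.mul_inv (by simp) (by simp), mul_comm, mul_assoc,
            ENNReal.inv_mul_cancel hz hc, mul_one]
  refine ⟨2 * (c₁ + CA ^ 2 * c₅), by finiteness,
    min 1 (min ((2 * c₂)⁻¹) ((2 * c₄)⁻¹)), ?_, min_le_left _ _, ?_⟩
  · exact (lt_min zero_lt_one (lt_min (ENNReal.inv_pos.mpr (by finiteness))
      (ENNReal.inv_pos.mpr (by finiteness)))).ne'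
  intro N U W J a g q h₃ h₄ hg hq haJ hgt hU hW3 hW4 hJ3 hJ4 h34 hδ
  have h1 : h₄ ≤ 1 := hδ.trans (min_le_left _ _)
  have h2 : c₂ * h₄ ≤ 2⁻¹ := small hc₂t (hδ.trans ((min_le_right _ _).trans (min_le_left _ _)))
  have h3 : c₄ * h₃ ≤ 2⁻¹ :=
    small hc₄t (h34.trans (hδ.trans ((min_le_right _ _).trans (min_le_right _ _))))
  have hq3 := sqs_wt_cube_quadratic_cubic_le hq (h34.trans h1) hW3 hJ3
  have hq34 : sqs (fun k => (wt k : ℝ≥0∞) ^ 3 * q k) ≤ c₁ * (h₃ * h₄) := by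
    refine hq3.trans ?_
    gcongr
  have hq4 : sqs (fun k => (wt k : ℝ≥0∞) ^ 3 * q k) ≤ c₁ * h₄ := by
    refine hq34.trans ?_
    calc c₁ * (h₃ * h₄) ≤ c₁ * (1 * h₄) := by gcongr; exact h34.trans h1
      _ = _ := by ring
  have hRle : ∀ v : Freq → ℝ≥0∞, sqs (fun k => v k * (CR * (freqAbs k * U k + wt k ^ 2 * W k
      + a k + q k))) ≤ CR ^ 2 * (8 * (sqs (fun k => v k * wt k * U k)
        + sqs (fun k => v k * wt k ^ 2 * W k) + sqs (fun k => v k * J k)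
        + sqs (fun k => v k * q k))) := by
    intro v
    have e : ∀ k, v k * (CR * (freqAbs k * U k + wt k ^ 2 * W k + a k + q k))
        ≤ CR * (v k * wt k * U k + v k * wt k ^ 2 * W k + v k * J k + v k * q k) := by
      intro k
      calc _ ≤ v k * (CR * (wt k * U k + wt k ^ 2 * W k + J k + q k)) := by
            gcongr
            · exact_mod_cast freqAbs_le_wt k
            · exact haJ k
        _ = _ := by ring
    refine (sqs_mono e).trans ?_
    rw [sqs_const_mul]
    gcongr
    exact sqs_add_four_le _ _ _ _
  have hsplit : ∀ v : Freq → ℝ≥0∞, sqs (fun k => v k * g k)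
      ≤ 2 * (sqs (fun k => v k * (CR * (freqAbs k * U k + wt k ^ 2 * W k + a k + q k)))
        + CA ^ 2 * sqs (fun k => v k * conv J g k)) := by
    intro v
    have e : ∀ k, v k * g k ≤ v k * (CR * (freqAbs k * U k
        + wt k ^ 2 * W k + a k + q k)) + CA * (v k * conv J g k) := by
      intro k
      calc _ ≤ v k * (CR * (freqAbs k * U k + wt k ^ 2 * W k + a k + q k)
            + CA * conv J g k) := by
            gcongr
            exact hg k
        _ = _ := by ring
    refine (sqs_mono e).trans ((sqs_add_le _ _).trans ?_)
    rw [sqs_const_mul]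
  -- A priori g is only square summable. Absorbing at each truncation level M, where the norm is
  -- finite, and letting M grow puts g in H², hence in ℓ¹.
  have hg2 : sqs (fun k => (wt k : ℝ≥0∞) ^ 2 * g k) ≤ 4 * (c₃ * h₄) := by
    refine sqs_wt_sq_le_of_trunc fun M hM => ?_
    set x := sqs (fun k => (trunc M k : ℝ≥0∞) ^ 2 * g k) with hx
    have hxt : x ≠ ∞ := by
      refine ne_top_of_le_ne_top ?_ (sqs_mono (g := fun k => (M : ℝ≥0∞) ^ 2 * g k) fun k => ?_)
      · rw [sqs_const_mul]
        finiteness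
      · gcongr
        exact_mod_cast trunc_le M k
    have hJ2 := sq_tsum_wt_le_of_sqs_le (m := 2) (n := 4) (by norm_num) hJ4
    have hconv : sqs (fun k => (trunc M k : ℝ≥0∞) ^ 2 * conv J g k)
        ≤ 16 * wienerConst * h₄ * x := by
      have := sqs_weight_conv_le_mul (v := fun k => (trunc M k : ℝ≥0∞) ^ 2)
        (v₁ := fun k => (trunc M k : ℝ≥0∞) ^ 2) (v₂ := fun k => (wt k : ℝ≥0∞) ^ 2) (K := 4) ?_ J g
      · calc _ ≤ _ := this
          _ ≤ 4 ^ 2 * ((wienerConst * h₄) * x) := by gcongr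
          _ = _ := by ring
      · intro k l
        norm_cast
        calc trunc M k ^ 2 ≤ (2 * (wt (k - l) * trunc M l)) ^ 2 :=
              Nat.pow_le_pow_left (trunc_le_two_mul hM k l) 2
          _ = _ := by ring
    have hRb : sqs (fun k => (trunc M k : ℝ≥0∞) ^ 2 * (CR * (freqAbs k * U k + wt k ^ 2 * W k
        + a k + q k))) ≤ c₃ * h₄ := by
      refine (hRle _).trans ?_
      calc _ ≤ CR ^ 2 * (8 * (h₄ + h₄ + h₄ + c₁ * h₄)) := by
            gcongr
            · refine (sqs_mono fun k => ?_).trans ((sqs_wt_pow_mono (by norm_num : 3 ≤ 4) U).trans hU)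
              calc _ ≤ (wt k : ℝ≥0∞) ^ 2 * wt k * U k := by gcongr; exact trunc_le_wt M k
                _ = _ := by ring
            · refine (sqs_mono fun k => ?_).trans hW4
              calc _ ≤ (wt k : ℝ≥0∞) ^ 2 * wt k ^ 2 * W k := by gcongr; exact trunc_le_wt M k
                _ = _ := by ring
            · refine (sqs_mono fun k => ?_).trans ((sqs_wt_pow_mono (by norm_num : 2 ≤ 4) J).trans hJ4)
              gcongr
              exact trunc_le_wt M k
            · refine (sqs_mono fun k => ?_).trans ((sqs_wt_pow_mono (by norm_num : 2 ≤ 3) q).trans hq4)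
              gcongr
              exact trunc_le_wt M k
        _ = _ := by rw [hc₃]; ring
    have : x ≤ 2 * (2 * (c₃ * h₄)) := by
      refine ENNReal.le_two_mul_of_le_add_half hxt h2 ?_
      calc x ≤ 2 * (c₃ * h₄ + CA ^ 2 * (16 * wienerConst * h₄ * x)) :=
            (hsplit _).trans (by gcongr)
        _ = _ := by rw [hc₂]; ring
    calc x ≤ _ := this
      _ = _ := by ring
  have hgsum : (∑' k, g k) ^ 2 ≤ wienerConst * (4 * (c₃ * h₄)) :=
    sq_tsum_le_of_sqs_le (n := 2) le_rfl hg2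
  have hJsum : (∑' k, J k) ^ 2 ≤ wienerConst * h₃ := sq_tsum_le_of_sqs_le (n := 3) (by norm_num) hJ3
  set D := sqs (fun k => (trunc N k : ℝ≥0∞) ^ 4 * (wt k * W k)) with hD
  -- This is finite because the dual weight is bounded by N⁴; the bound obtained below no longer
  -- depends on N.
  set y := sqs (fun k => dualWt N k * conv J g k) with hy
  have hyt : y ≠ ∞ := by
    have e : ∀ k, dualWt N k * conv J g k ≤ (N : ℝ≥0∞) ^ 4 * conv J g k := by
      intro k
      gcongr
      exact dualWt_le_const N k
    refine ne_top_of_le_ne_top ?_ (sqs_mono e)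
    rw [sqs_const_mul]
    have h5 : sqs (conv J g) ≠ ∞ := by
      refine ne_top_of_le_ne_top ?_ (sqs_conv_le _ _)
      refine ENNReal.mul_ne_top (ne_top_of_le_ne_top ?_ hJsum) hgt
      have : h₃ ≠ ∞ := ne_top_of_le_ne_top ENNReal.one_ne_top (h34.trans h1)
      finiteness
    finiteness
  have hXR : sqs (fun k => dualWt N k * (CR * (freqAbs k * U k + wt k ^ 2 * W k
      + a k + q k))) ≤ c₃ * (D + h₄) := by
    refine (hRle _).trans ?_
    calc _ ≤ CR ^ 2 * (8 * (h₄ + D + h₄ + c₁ * h₄)) := by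
          gcongr
          · refine (sqs_mono fun k => ?_).trans hU
            rw [dualWt_mul_wt]
            gcongr
            exact_mod_cast trunc_le_wt N k
          · refine (sqs_mono fun k => ?_)
            rw [pow_two, ← mul_assoc, dualWt_mul_wt, mul_assoc]
          · refine (sqs_mono fun k => ?_).trans ((sqs_wt_pow_mono (by norm_num : 3 ≤ 4) J).trans hJ4)
            gcongr
            exact dualWt_le N k
          · refine (sqs_mono fun k => ?_).trans hq4
            gcongr
            exact dualWt_le N k
      _ = CR ^ 2 * (8 * (1 * D + (2 + c₁) * h₄)) := by ring
      _ ≤ CR ^ 2 * (8 * ((3 + c₁) * D + (3 + c₁) * h₄)) := by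
          gcongr
          · exact le_add_right (by norm_num)
          · norm_num
      _ = _ := by rw [hc₃]; ring
  -- Either g receives the dual weight and J is summed with small ℓ¹ norm, or J receives three
  -- derivatives and g is summed. Only the first alternative returns y, multiplied by h₃.
  have hy1 : y ≤ 2048 * wienerConst * (h₃ * sqs (fun k => dualWt N k * g k)
      + 4 * (c₃ * h₄) * h₃) := by
    have := sqs_weight_conv_le (v := dualWt N) (v₁ := dualWt N)
      (v₂ := fun k => (wt k : ℝ≥0∞) ^ 3) (K := 32) (dualWt_le_add N) J g
    calc y ≤ _ := this
      _ ≤ 2 * 32 ^ 2 * ((wienerConst * h₃) * sqs (fun k => dualWt N k * g k)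
          + (wienerConst * (4 * (c₃ * h₄))) * h₃) := by gcongr
      _ = _ := by ring
  have hy2 : y ≤ 2 * (2048 * wienerConst * (2 * c₃ + 4 * c₃) * (h₃ * (D + h₄))) := by
    refine ENNReal.le_two_mul_of_le_add_half hyt h3 ?_
    calc y ≤ 2048 * wienerConst * (h₃ * (2 * (c₃ * (D + h₄) + CA ^ 2 * y))
          + 4 * (c₃ * (D + h₄)) * h₃) := by
          refine hy1.trans ?_
          gcongr
          · exact (hsplit _).trans (by gcongr)
          · exact le_add_self
      _ = _ := by rw [hc₄]; ring
  have e : ∀ k, dualWt N k * (q k + CA * conv J g k)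
      ≤ (wt k : ℝ≥0∞) ^ 3 * q k + CA * (dualWt N k * conv J g k) := by
    intro k
    calc _ = dualWt N k * q k + CA * (dualWt N k * conv J g k) := by ring
      _ ≤ _ := by
        gcongr
        exact dualWt_le N k
  calc _ ≤ 2 * (c₁ * (h₃ * (D + h₄)) + CA ^ 2 * (2 * (2048 * wienerConst * (2 * c₃ + 4 * c₃)
        * (h₃ * (D + h₄))))) := by
        refine (sqs_mono e).trans ((sqs_add_le _ _).trans ?_)
        rw [sqs_const_mul]
        gcongr
        exact hq34.trans (by gcongr; exact le_add_self)
    _ = _ := by rw [hc₅]; ring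

/-! ### The linear operator on a single Fourier mode -/

/-- The eigenvalues of `J_eq`. -/
def Constants.inertia (c : Constants) : Fin 3 → ℝ := ![c.lam, c.lam, c.nu]

/-- The magnitude of `ω_eq`. -/
def Constants.spin (c : Constants) : ℝ := c.τ / (2 * c.κ)

lemma Constants.Admissible.inertia_pos {c : Constants} (hc : c.Admissible) (i : Fin 3) :
    0 < c.inertia i := by
  fin_cases i
  · exact hc.lam_pos
  · exact hc.lam_pos
  · exact hc.nu_pos

/-- The curl of a Fourier mode. -/
def curlMode (k : Freq) (v : Fin 3 → ℂ) : Fin 3 → ℂ :=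
  ![Complex.I * k 1 * v 2 - Complex.I * k 2 * v 1, Complex.I * k 2 * v 0 - Complex.I * k 0 * v 2,
    Complex.I * k 0 * v 1 - Complex.I * k 1 * v 0]

/-- The Laplacian of a Fourier mode. -/
def lapMode (k : Freq) (v : Fin 3 → ℂ) (i : Fin 3) : ℂ :=
  ∑ j, Complex.I * k j * (Complex.I * k j * v i)

/-- The viscous and rotational stresses of a Fourier mode. -/
def stressMode (c : Constants) (k : Freq) (u w : Fin 3 → ℂ) (i : Fin 3) : ℂ :=
  c.κ * curlMode k u i - (2 * c.κ : ℝ) * w i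
    + (c.αt - c.γt : ℝ) * (Complex.I * k i * ∑ j, Complex.I * k j * w j)
    + c.γt * lapMode k w i

/-- The linear part of the precession of a Fourier mode. -/
def precMode (c : Constants) (w : Fin 3 → ℂ) (J : Fin 3 → Fin 3 → ℂ) : Fin 3 → ℂ :=
  ![(c.spin * (c.nu - c.lam) : ℝ) * w 1 - (c.spin ^ 2 : ℝ) * J 1 2,
    -((c.spin * (c.nu - c.lam) : ℝ) * w 0) + (c.spin ^ 2 : ℝ) * J 0 2, 0]

/-- The antisymmetric matrix of a complex vector. -/
def skewMode (w : Fin 3 → ℂ) : Matrix (Fin 3) (Fin 3) ℂ :=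
  !![0, -w 2, w 1; w 2, 0, -w 0; -w 1, w 0, 0]

/-- The linear part of the microinertia equation of a Fourier mode. -/
def inertiaMode (c : Constants) (w : Fin 3 → ℂ) (J : Fin 3 → Fin 3 → ℂ) (i j : Fin 3) : ℂ :=
  ∑ p, ((skew c.ωeq i p : ℝ) * J p j - J i p * (skew c.ωeq p j : ℝ))
    + (c.inertia j - c.inertia i : ℝ) * skewMode w i j

/-- Completing the square: the coefficients κ/2 + μ/2 and 2κs, with s = κ/(κ + μ), have product κ²,
exactly what 2κxy requires. Since μ̃ = (κ/2 + μ/2) + μ/2 and s < 1, positive parts μ/2 and 2κ(1 - s)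
of the dissipation remain. Lagrange's identity bounds |k × u| by |k||u|. -/
lemma coupling_le {κ μ : ℝ} (hκ : 0 < κ) (hμ : 0 < μ) (k u w : Fin 3 → ℝ) :
    2 * κ * (w 0 * (k 1 * u 2 - k 2 * u 1) + w 1 * (k 2 * u 0 - k 0 * u 2)
        + w 2 * (k 0 * u 1 - k 1 * u 0))
      ≤ (κ / 2 + μ / 2) * ((k 0 ^ 2 + k 1 ^ 2 + k 2 ^ 2) * (u 0 ^ 2 + u 1 ^ 2 + u 2 ^ 2))
        + 2 * κ * (κ / (κ + μ)) * (w 0 ^ 2 + w 1 ^ 2 + w 2 ^ 2) := by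
  set s := κ / (κ + μ) with hs
  have hsum : 0 < κ + μ := by linarith
  have hs0 : 0 < s := by positivity
  have hsm : s * (κ + μ) = κ := by rw [hs]; field_simp
  have hyoung : ∀ x y : ℝ, 2 * κ * (x * y) ≤ (κ / 2 + μ / 2) * y ^ 2 + 2 * κ * s * x ^ 2 := by
    intro x y
    have h : 0 ≤ (2 * s * x - y) ^ 2 := sq_nonneg _
    have h2 : 0 ≤ (κ + μ) * (2 * s * x - y) ^ 2 := mul_nonneg hsum.le h
    have h3 : (κ + μ) * (2 * s * x - y) ^ 2
        = 4 * s * (s * (κ + μ)) * x ^ 2 - 4 * (s * (κ + μ)) * (x * y) + (κ + μ) * y ^ 2 := by ring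
    rw [h3, hsm] at h2
    linarith
  have h0 := hyoung (w 0) (k 1 * u 2 - k 2 * u 1)
  have h1 := hyoung (w 1) (k 2 * u 0 - k 0 * u 2)
  have h2 := hyoung (w 2) (k 0 * u 1 - k 1 * u 0)
  have hlag : (k 1 * u 2 - k 2 * u 1) ^ 2 + (k 2 * u 0 - k 0 * u 2) ^ 2
      + (k 0 * u 1 - k 1 * u 0) ^ 2
      ≤ (k 0 ^ 2 + k 1 ^ 2 + k 2 ^ 2) * (u 0 ^ 2 + u 1 ^ 2 + u 2 ^ 2) := by
    nlinarith [sq_nonneg (k 0 * u 0 + k 1 * u 1 + k 2 * u 2)]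
  have := mul_le_mul_of_nonneg_left hlag (by linarith : 0 ≤ κ / 2 + μ / 2)
  linarith

lemma cauchy_schwarz_three (k w : Fin 3 → ℝ) :
    (k 0 * w 0 + k 1 * w 1 + k 2 * w 2) ^ 2
      ≤ (k 0 ^ 2 + k 1 ^ 2 + k 2 ^ 2) * (w 0 ^ 2 + w 1 ^ 2 + w 2 ^ 2) := by
  nlinarith [sq_nonneg (k 0 * w 1 - k 1 * w 0), sq_nonneg (k 0 * w 2 - k 2 * w 0),
    sq_nonneg (k 1 * w 2 - k 2 * w 1)]

lemma sq_sum_three_le (a b c : ℝ) : (a + b + c) ^ 2 ≤ 3 * (a ^ 2 + b ^ 2 + c ^ 2) := by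
  nlinarith [sq_nonneg (a - b), sq_nonneg (b - c), sq_nonneg (a - c)]

lemma freqAbs_cast (k : Freq) : (freqAbs k : ℝ) = |(k 0 : ℝ)| + |(k 1 : ℝ)| + |(k 2 : ℝ)| := by
  simp only [freqAbs, Fin.sum_univ_three]
  push_cast
  simp only [Nat.cast_natAbs, Int.cast_abs]

lemma freqAbs_sq_le (k : Freq) :
    (freqAbs k : ℝ) ^ 2 ≤ 3 * ((k 0 : ℝ) ^ 2 + (k 1 : ℝ) ^ 2 + (k 2 : ℝ) ^ 2) := by
  rw [freqAbs_cast]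
  simpa only [sq_abs] using sq_sum_three_le |(k 0 : ℝ)| |(k 1 : ℝ)| |(k 2 : ℝ)|

lemma wt_sq_le (k : Freq) :
    (wt k : ℝ) ^ 2 ≤ 4 * (1 + ((k 0 : ℝ) ^ 2 + (k 1 : ℝ) ^ 2 + (k 2 : ℝ) ^ 2)) := by
  have h := freqAbs_sq_le k
  rw [wt_eq]
  push_cast
  nlinarith [sq_nonneg ((freqAbs k : ℝ) - 3)]

/-- The factor i in the curl exchanges real and imaginary parts, so the coupling appears as two real
copies of the form in `coupling_le`. The pressure enters only through k·Re u and k·Im u, which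
vanish for a divergence-free mode. -/
lemma re_dissipation_eq (c : Constants) (k : Freq) (u w : Fin 3 → ℂ) (p : ℂ) :
    let q : Fin 3 → ℝ := fun i => (k i : ℝ)
    let a : Fin 3 → ℝ := fun i => (u i).re
    let b : Fin 3 → ℝ := fun i => (u i).im
    let x : Fin 3 → ℝ := fun i => (w i).re
    let y : Fin 3 → ℝ := fun i => (w i).im
    (∑ i, conj (u i) * (c.μt * lapMode k u i + c.κ * curlMode k w i
          - Complex.I * k i * p)).re
        + (∑ i, conj (w i) * stressMode c k u w i).re
      = -c.μt * ((q 0 ^ 2 + q 1 ^ 2 + q 2 ^ 2)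
          * ((a 0 ^ 2 + a 1 ^ 2 + a 2 ^ 2) + (b 0 ^ 2 + b 1 ^ 2 + b 2 ^ 2)))
        + 2 * c.κ * (x 0 * (q 1 * (-b 2) - q 2 * (-b 1)) + x 1 * (q 2 * (-b 0) - q 0 * (-b 2))
          + x 2 * (q 0 * (-b 1) - q 1 * (-b 0)))
        + 2 * c.κ * (y 0 * (q 1 * a 2 - q 2 * a 1) + y 1 * (q 2 * a 0 - q 0 * a 2)
          + y 2 * (q 0 * a 1 - q 1 * a 0))
        - 2 * c.κ * ((x 0 ^ 2 + x 1 ^ 2 + x 2 ^ 2) + (y 0 ^ 2 + y 1 ^ 2 + y 2 ^ 2))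
        - (c.αt - c.γt) * ((q 0 * x 0 + q 1 * x 1 + q 2 * x 2) ^ 2
          + (q 0 * y 0 + q 1 * y 1 + q 2 * y 2) ^ 2)
        - c.γt * ((q 0 ^ 2 + q 1 ^ 2 + q 2 ^ 2)
          * ((x 0 ^ 2 + x 1 ^ 2 + x 2 ^ 2) + (y 0 ^ 2 + y 1 ^ 2 + y 2 ^ 2)))
        + p.im * (q 0 * a 0 + q 1 * a 1 + q 2 * a 2)
        - p.re * (q 0 * b 0 + q 1 * b 1 + q 2 * b 2) := by
  simp only [Fin.sum_univ_three, lapMode, stressMode, curlMode, Matrix.cons_val_zero,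
    Matrix.cons_val_one, Matrix.cons_val, Complex.add_re, Complex.sub_re, Complex.mul_re,
    Complex.mul_im, Complex.add_im, Complex.sub_im, Complex.conj_re, Complex.conj_im,
    Complex.I_re, Complex.I_im, Complex.ofReal_re, Complex.ofReal_im, Complex.intCast_re,
    Complex.intCast_im]
  ring

/-- The dissipation of a single Fourier mode. -/
lemma exists_dissipation {c : Constants} (hc : c.Admissible) :
    ∃ c₁ : ℝ, 0 < c₁ ∧ ∀ (k : Freq) (u w : Fin 3 → ℂ) (p : ℂ), ∑ j, (k j : ℂ) * u j = 0 →
      (∑ i, conj (u i) * (c.μt * lapMode k u i + c.κ * curlMode k w i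
          - Complex.I * k i * p)).re
        + (∑ i, conj (w i) * stressMode c k u w i).re
      ≤ -c₁ * ((freqAbs k : ℝ) ^ 2 * (∑ i, ‖u i‖) ^ 2 + (wt k : ℝ) ^ 2 * (∑ i, ‖w i‖) ^ 2) := by
  have hκ := hc.κ_pos
  have hμ := hc.μ_pos
  have hα : 0 < c.αt := hc.αβ_pos
  have hγ : 0 < c.γt := hc.βγ_pos
  set s := c.κ / (c.κ + c.μ) with hs
  have hs1 : s < 1 := by
    rw [hs, div_lt_one (by linarith)]
    linarith
  -- A common lower bound for the four coefficients left over: viscosity, rotational damping, and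
  -- the longitudinal and transverse angular viscosities.
  obtain ⟨m, hm0, hm1, hm2, hm3, hm4⟩ : ∃ m : ℝ, 0 < m ∧ m ≤ c.μ / 2 ∧ m ≤ 2 * c.κ * (1 - s) ∧
      m ≤ c.αt ∧ m ≤ c.γt := by
    refine ⟨min (min (c.μ / 2) (2 * c.κ * (1 - s))) (min c.αt c.γt), ?_, ?_, ?_, ?_, ?_⟩
    · refine lt_min (lt_min (by linarith) ?_) (lt_min hα hγ)
      exact mul_pos (by linarith) (by linarith)
    · exact (min_le_left _ _).trans (min_le_left _ _)
    · exact (min_le_left _ _).trans (min_le_right _ _)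
    · exact (min_le_right _ _).trans (min_le_left _ _)
    · exact (min_le_right _ _).trans (min_le_right _ _)
  -- The loss 12 = 4·3 comes from comparing `wt k`² with 1 + |k|² and the squared sum of three norms
  -- with the sum of squares.
  refine ⟨m / 12, by positivity, fun k u w p hdiv => ?_⟩
  set κ' : Fin 3 → ℝ := fun i => (k i : ℝ) with hκ'
  set a : Fin 3 → ℝ := fun i => (u i).re with ha
  set b : Fin 3 → ℝ := fun i => (u i).im with hb
  set x : Fin 3 → ℝ := fun i => (w i).re with hx
  set y : Fin 3 → ℝ := fun i => (w i).im with hy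
  set n := κ' 0 ^ 2 + κ' 1 ^ 2 + κ' 2 ^ 2 with hn
  set Au := a 0 ^ 2 + a 1 ^ 2 + a 2 ^ 2 with hAu
  set Bu := b 0 ^ 2 + b 1 ^ 2 + b 2 ^ 2 with hBu
  set Xw := x 0 ^ 2 + x 1 ^ 2 + x 2 ^ 2 with hXw
  set Yw := y 0 ^ 2 + y 1 ^ 2 + y 2 ^ 2 with hYw
  set Dx := κ' 0 * x 0 + κ' 1 * x 1 + κ' 2 * x 2 with hDx
  set Dy := κ' 0 * y 0 + κ' 1 * y 1 + κ' 2 * y 2 with hDy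
  have hd1 : κ' 0 * a 0 + κ' 1 * a 1 + κ' 2 * a 2 = 0 := by
    have := congrArg Complex.re hdiv
    simpa [Fin.sum_univ_three, Complex.mul_re] using this
  have hd2 : κ' 0 * b 0 + κ' 1 * b 1 + κ' 2 * b 2 = 0 := by
    have := congrArg Complex.im hdiv
    simpa [Fin.sum_univ_three, Complex.mul_im] using this
  have hid := re_dissipation_eq c k u w p
  simp only at hid
  change _ = -c.μt * (n * (Au + Bu))
        + 2 * c.κ * (x 0 * (κ' 1 * (-b 2) - κ' 2 * (-b 1)) + x 1 * (κ' 2 * (-b 0) - κ' 0 * (-b 2))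
          + x 2 * (κ' 0 * (-b 1) - κ' 1 * (-b 0)))
        + 2 * c.κ * (y 0 * (κ' 1 * a 2 - κ' 2 * a 1) + y 1 * (κ' 2 * a 0 - κ' 0 * a 2)
          + y 2 * (κ' 0 * a 1 - κ' 1 * a 0))
        - 2 * c.κ * (Xw + Yw) - (c.αt - c.γt) * (Dx ^ 2 + Dy ^ 2) - c.γt * (n * (Xw + Yw))
        + p.im * (κ' 0 * a 0 + κ' 1 * a 1 + κ' 2 * a 2)
        - p.re * (κ' 0 * b 0 + κ' 1 * b 1 + κ' 2 * b 2) at hid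
  rw [hd1, hd2, mul_zero, mul_zero, add_zero, sub_zero] at hid
  rw [hid]
  have h1 := coupling_le hκ hμ κ' (fun i => -b i) x
  have h2 := coupling_le hκ hμ κ' a y
  have h3 := cauchy_schwarz_three κ' x
  have h4 := cauchy_schwarz_three κ' y
  simp only [neg_sq] at h1
  rw [← hn, ← hBu, ← hXw, ← hs] at h1
  rw [← hn, ← hAu, ← hYw, ← hs] at h2
  rw [← hn, ← hXw, ← hDx] at h3
  rw [← hn, ← hYw, ← hDy] at h4
  have hn0 : 0 ≤ n := by positivity
  have hk1 : (freqAbs k : ℝ) ^ 2 ≤ 3 * n := freqAbs_sq_le k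
  have hk2 : (wt k : ℝ) ^ 2 ≤ 4 * (1 + n) := wt_sq_le k
  have hAB : 0 ≤ Au + Bu := by positivity
  have hXY : 0 ≤ Xw + Yw := by positivity
  have hnu : (∑ i, ‖u i‖) ^ 2 ≤ 3 * (Au + Bu) := by
    rw [Fin.sum_univ_three]
    refine (sq_sum_three_le _ _ _).trans (le_of_eq ?_)
    simp only [Complex.sq_norm, Complex.normSq_apply, hAu, hBu, ha, hb]
    ring
  have hnw : (∑ i, ‖w i‖) ^ 2 ≤ 3 * (Xw + Yw) := by
    rw [Fin.sum_univ_three]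
    refine (sq_sum_three_le _ _ _).trans (le_of_eq ?_)
    simp only [Complex.sq_norm, Complex.normSq_apply, hXw, hYw, hx, hy]
    ring
  clear_value n Au Bu Xw Yw Dx Dy
  have h5 : (freqAbs k : ℝ) ^ 2 * (∑ i, ‖u i‖) ^ 2 ≤ (3 * n) * (3 * (Au + Bu)) :=
    mul_le_mul hk1 hnu (by positivity) (by positivity)
  have h6 : (wt k : ℝ) ^ 2 * (∑ i, ‖w i‖) ^ 2 ≤ (4 * (1 + n)) * (3 * (Xw + Yw)) :=
    mul_le_mul hk2 hnw (by positivity) (by positivity)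
  have hμt : c.μt = c.μ + c.κ / 2 := rfl
  have h7 : m * (n * (Au + Bu)) ≤ c.μ / 2 * (n * (Au + Bu)) := by gcongr
  have h8 : m * (Xw + Yw) ≤ 2 * c.κ * (1 - s) * (Xw + Yw) := by gcongr
  -- The difference α̃ - γ̃ may have either sign. Regrouping as α̃(k·w)² + γ̃(|k|²|w|² - (k·w)²)
  -- gives two nonnegative terms, by Cauchy–Schwarz.
  have h9 : m * (n * (Xw + Yw)) ≤ (c.αt - c.γt) * (Dx ^ 2 + Dy ^ 2) + c.γt * (n * (Xw + Yw)) := by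
    have hD : Dx ^ 2 + Dy ^ 2 ≤ n * (Xw + Yw) := by linarith
    have hD0 : 0 ≤ Dx ^ 2 + Dy ^ 2 := by positivity
    have e1 := mul_le_mul_of_nonneg_right hm3 hD0
    have e2 := mul_le_mul_of_nonneg_right hm4 (sub_nonneg.mpr hD)
    linarith
  have h10 : m / 12 * ((freqAbs k : ℝ) ^ 2 * (∑ i, ‖u i‖) ^ 2 + (wt k : ℝ) ^ 2 * (∑ i, ‖w i‖) ^ 2)
      ≤ m / 12 * ((3 * n) * (3 * (Au + Bu)) + (4 * (1 + n)) * (3 * (Xw + Yw))) := by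
    gcongr
  have h11 : 0 ≤ m * (n * (Au + Bu)) := by positivity
  rw [hμt]
  linarith

/-- The coupling between the horizontal angular velocity and the microinertia. -/
lemma re_coupling_le (c : Constants) (w : Fin 3 → ℂ) (J : Fin 3 → Fin 3 → ℂ)
    (hJ : ∀ i j, J i j = J j i) :
    -(∑ i, conj (w i) * precMode c w J i).re
        + (∑ i, ∑ j, conj (J i j) * inertiaMode c w J i j).re
      ≤ (c.spin ^ 2 + 2 * |c.nu - c.lam|) * (‖w 0‖ * ‖J 1 2‖ + ‖w 1‖ * ‖J 0 2‖) := by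
  -- The gyroscopic rotation of ω and the commutator with Ω_eq are antisymmetric and drop out. The
  -- commutator of Ω with J_eq sees only differences of eigenvalues, so the equality of the two
  -- horizontal ones leaves just the entries 13 and 23.
  have e : -(∑ i, conj (w i) * precMode c w J i).re
        + (∑ i, ∑ j, conj (J i j) * inertiaMode c w J i j).re
      = c.spin ^ 2 * ((conj (w 0) * J 1 2).re - (conj (w 1) * J 0 2).re)
        + 2 * (c.nu - c.lam) * ((conj (w 1) * J 0 2).re - (conj (w 0) * J 1 2).re) := by
    simp only [Fin.sum_univ_three, precMode, inertiaMode, skewMode, skew, Constants.ωeq,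
      Constants.inertia, hJ 1 0, hJ 2 0, hJ 2 1, Matrix.cons_val_zero, Matrix.cons_val_one,
      Matrix.cons_val, Matrix.of_apply, Complex.add_re, Complex.sub_re, Complex.mul_re,
      Complex.mul_im, Complex.add_im, Complex.sub_im, Complex.conj_re, Complex.conj_im,
      Complex.neg_re, Complex.neg_im, Complex.zero_re, Complex.zero_im,
      Complex.ofReal_re, Complex.ofReal_im]
    ring
  have h : ∀ z z' : ℂ, |(conj z * z').re| ≤ ‖z‖ * ‖z'‖ := by
    intro z z'
    refine (Complex.abs_re_le_norm _).trans (le_of_eq ?_)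
    rw [norm_mul, Complex.norm_conj]
  have h0 := h (w 0) (J 1 2)
  have h1 := h (w 1) (J 0 2)
  rw [e]
  set A := (conj (w 0) * J 1 2).re
  set B := (conj (w 1) * J 0 2).re
  have hAB : |A - B| ≤ ‖w 0‖ * ‖J 1 2‖ + ‖w 1‖ * ‖J 0 2‖ := (abs_sub _ _).trans (add_le_add h0 h1)
  have h2 : c.spin ^ 2 * (A - B) ≤ c.spin ^ 2 * |A - B| := by
    gcongr
    exact le_abs_self _
  have h3 : 2 * (c.nu - c.lam) * (B - A) ≤ 2 * |c.nu - c.lam| * |A - B| := by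
    rw [mul_assoc, mul_assoc, ← abs_mul, ← neg_sub A B, mul_neg]
    linarith [neg_le_abs ((c.nu - c.lam) * (A - B))]
  have h4 : (c.spin ^ 2 + 2 * |c.nu - c.lam|) * |A - B|
      ≤ (c.spin ^ 2 + 2 * |c.nu - c.lam|) * (‖w 0‖ * ‖J 1 2‖ + ‖w 1‖ * ‖J 0 2‖) := by
    gcongr
  linarith

/-! ### Weighted pairings -/

/-- The real inner product of two sequences with the squared weight `V`. -/
def pair (V : Freq → ℕ) (f g : Freq → ℂ) : ℝ := ∑' k, (V k : ℝ) ^ 2 * (conj (f k) * g k).re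

lemma summable_sq_of_sqs {f : Freq → ℂ} (h : sqs (mag f) ≠ ∞) : Summable fun k => ‖f k‖ ^ 2 := by
  have e : ∀ k, mag f k ^ 2 = ((‖f k‖₊ ^ 2 : NNReal) : ℝ≥0∞) := fun k => by
    simp [mag, enorm_eq_nnnorm]
  simp only [sqs, e] at h
  have := ENNReal.tsum_coe_ne_top_iff_summable.mp h
  have := NNReal.summable_coe.mpr this
  simpa using this

lemma sqs_mag_ne_top_of_summable {f : Freq → ℂ} (h : Summable fun k => ‖f k‖ ^ 2) :
    sqs (mag f) ≠ ∞ := by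
  have e : ∀ k, mag f k ^ 2 = ((‖f k‖₊ ^ 2 : NNReal) : ℝ≥0∞) := fun k => by
    simp [mag, enorm_eq_nnnorm]
  simp only [sqs, e]
  refine ENNReal.tsum_coe_ne_top_iff_summable.mpr (NNReal.summable_coe.mp ?_)
  simpa using h

lemma summable_and_toReal_sqs {f : Freq → ℝ≥0∞} {r : Freq → ℝ} (hr : ∀ k, 0 ≤ r k)
    (hf : ∀ k, f k = ENNReal.ofReal (r k)) (h : sqs f ≠ ∞) :
    Summable (fun k => r k ^ 2) ∧ (sqs f).toReal = ∑' k, r k ^ 2 := by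
  have e : ∀ k, f k ^ 2 = ENNReal.ofReal (r k ^ 2) := fun k => by
    rw [hf, ENNReal.ofReal_pow (hr k)]
  have hs : Summable fun k => r k ^ 2 := by
    have := ENNReal.summable_toReal h
    refine this.congr fun k => ?_
    rw [e, ENNReal.toReal_ofReal (sq_nonneg _)]
  refine ⟨hs, ?_⟩
  simp only [sqs, e]
  rw [← ENNReal.ofReal_tsum_of_nonneg (fun k => sq_nonneg _) hs,
    ENNReal.toReal_ofReal (tsum_nonneg fun k => sq_nonneg _)]

lemma abs_re_conj_mul_le (z w : ℂ) : |(conj z * w).re| ≤ ‖z‖ * ‖w‖ := by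
  refine (Complex.abs_re_le_norm _).trans (le_of_eq ?_)
  rw [norm_mul, Complex.norm_conj]

lemma summable_pair {V : Freq → ℕ} {B : ℕ} (hV : ∀ k, V k ≤ B) {f g : Freq → ℂ}
    (hf : sqs (mag f) ≠ ∞) (hg : sqs (mag g) ≠ ∞) :
    Summable fun k => (V k : ℝ) ^ 2 * (conj (f k) * g k).re := by
  have h := ((summable_sq_of_sqs hf).add (summable_sq_of_sqs hg)).mul_left ((B : ℝ) ^ 2)
  refine Summable.of_norm_bounded h fun k => ?_
  rw [Real.norm_eq_abs, abs_mul, abs_of_nonneg (by positivity)]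
  have h1 : (V k : ℝ) ≤ B := by exact_mod_cast hV k
  gcongr
  refine (abs_re_conj_mul_le _ _).trans ?_
  nlinarith [sq_nonneg (‖f k‖ - ‖g k‖), sq_nonneg ‖f k‖, sq_nonneg ‖g k‖]

lemma sqs_mag_sub_ne_top {f g : Freq → ℂ} (hf : sqs (mag f) ≠ ∞) (hg : sqs (mag g) ≠ ∞) :
    sqs (mag fun k => f k - g k) ≠ ∞ := by
  refine ne_top_of_le_ne_top ?_ ((sqs_mono fun k => ?_).trans (sqs_add_le (mag f) (mag g)))
  · finiteness
  · exact enorm_sub_le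

lemma sqs_mag_add_ne_top {f g : Freq → ℂ} (hf : sqs (mag f) ≠ ∞) (hg : sqs (mag g) ≠ ∞) :
    sqs (mag fun k => f k + g k) ≠ ∞ := by
  refine ne_top_of_le_ne_top ?_ ((sqs_mono fun k => ?_).trans (sqs_add_le (mag f) (mag g)))
  · finiteness
  · exact enorm_add_le _ _

lemma pair_add {V : Freq → ℕ} {B : ℕ} (hV : ∀ k, V k ≤ B) {f g h : Freq → ℂ}
    (hf : sqs (mag f) ≠ ∞) (hg : sqs (mag g) ≠ ∞) (hh : sqs (mag h) ≠ ∞) :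
    pair V f (fun k => g k + h k) = pair V f g + pair V f h := by
  simp only [pair, mul_add, Complex.add_re]
  exact Summable.tsum_add (summable_pair hV hf hg) (summable_pair hV hf hh)

lemma pair_sub {V : Freq → ℕ} {B : ℕ} (hV : ∀ k, V k ≤ B) {f g h : Freq → ℂ}
    (hf : sqs (mag f) ≠ ∞) (hg : sqs (mag g) ≠ ∞) (hh : sqs (mag h) ≠ ∞) :
    pair V f (fun k => g k - h k) = pair V f g - pair V f h := by
  simp only [pair, mul_sub, Complex.sub_re]
  exact Summable.tsum_sub (summable_pair hV hf hg) (summable_pair hV hf hh)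

/-- Young's inequality for a pairing. -/
lemma abs_re_tsum_conj_mul_le {a b : Freq → ℂ} {A B η : ℝ} (hη : 0 < η)
    (ha : sqs (mag a) ≤ ENNReal.ofReal A) (hb : sqs (mag b) ≤ ENNReal.ofReal B)
    (hA : 0 ≤ A) (hB : 0 ≤ B) :
    |(∑' k, conj (a k) * b k).re| ≤ (η * A + η⁻¹ * B) / 2 := by
  have hat : sqs (mag a) ≠ ∞ := ne_top_of_le_ne_top ENNReal.ofReal_ne_top ha
  have hbt : sqs (mag b) ≠ ∞ := ne_top_of_le_ne_top ENNReal.ofReal_ne_top hb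
  have hs : ∀ f : Freq → ℂ, ∀ k, mag f k = ENNReal.ofReal ‖f k‖ := fun f k => by
    rw [mag, ofReal_norm]
  obtain ⟨sa, ea⟩ := summable_and_toReal_sqs (fun k => norm_nonneg (a k)) (hs a) hat
  obtain ⟨sb, eb⟩ := summable_and_toReal_sqs (fun k => norm_nonneg (b k)) (hs b) hbt
  have hA' : ∑' k, ‖a k‖ ^ 2 ≤ A := by
    rw [← ea]
    exact ENNReal.toReal_le_of_le_ofReal hA ha
  have hB' : ∑' k, ‖b k‖ ^ 2 ≤ B := by
    rw [← eb]
    exact ENNReal.toReal_le_of_le_ofReal hB hb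
  have hab := summable_conj_mul hat hbt
  have hη' : 0 < η⁻¹ := inv_pos.mpr hη
  have hsum : Summable fun k => (η * ‖a k‖ ^ 2 + η⁻¹ * ‖b k‖ ^ 2) / 2 :=
    ((sa.mul_left η).add (sb.mul_left η⁻¹)).div_const 2
  have hpt : ∀ k, ‖conj (a k) * b k‖ ≤ (η * ‖a k‖ ^ 2 + η⁻¹ * ‖b k‖ ^ 2) / 2 := by
    intro k
    rw [norm_mul, Complex.norm_conj]
    have h1 : 0 ≤ η⁻¹ * (η * ‖a k‖ - ‖b k‖) ^ 2 := by positivity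
    have h2 : η⁻¹ * (η * ‖a k‖ - ‖b k‖) ^ 2
        = η * ‖a k‖ ^ 2 - 2 * (‖a k‖ * ‖b k‖) + η⁻¹ * ‖b k‖ ^ 2 := by
      field_simp
      ring
    linarith
  calc |(∑' k, conj (a k) * b k).re| ≤ ‖∑' k, conj (a k) * b k‖ := Complex.abs_re_le_norm _
    _ ≤ ∑' k, (η * ‖a k‖ ^ 2 + η⁻¹ * ‖b k‖ ^ 2) / 2 :=
        tsum_of_norm_bounded hsum.hasSum hpt
    _ = (η * ∑' k, ‖a k‖ ^ 2 + η⁻¹ * ∑' k, ‖b k‖ ^ 2) / 2 := by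
        rw [tsum_div_const, Summable.tsum_add (sa.mul_left η) (sb.mul_left η⁻¹), tsum_mul_left,
          tsum_mul_left]
    _ ≤ _ := by gcongr

lemma pair_eq_re_tsum {V : Freq → ℕ} {B : ℕ} (hV : ∀ k, V k ≤ B) {f g : Freq → ℂ}
    (hf : sqs (mag f) ≠ ∞) (hg : sqs (mag g) ≠ ∞) :
    pair V f g = (∑' k, conj (((V k : ℝ) : ℂ) * f k) * (((V k : ℝ) : ℂ) * g k)).re := by
  have hV' : ∀ k, |((V k : ℝ))| ≤ (B : ℝ) := fun k => by
    rw [abs_of_nonneg (Nat.cast_nonneg _)]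
    exact_mod_cast hV k
  have h1 : sqs (mag fun k => ((V k : ℝ) : ℂ) * f k) ≠ ∞ := by
    simpa using sqs_weight_ne_top (v := fun _ => 1) hV' (f := f) (by simpa using hf)
  have h2 : sqs (mag fun k => ((V k : ℝ) : ℂ) * g k) ≠ ∞ := by
    simpa using sqs_weight_ne_top (v := fun _ => 1) hV' (f := g) (by simpa using hg)
  rw [Complex.re_tsum (summable_conj_mul h1 h2), pair]
  refine tsum_congr fun k => ?_
  rw [map_mul, Complex.conj_ofReal]
  have : ((V k : ℝ) : ℂ) * conj (f k) * (((V k : ℝ) : ℂ) * g k)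
      = (((V k : ℝ) ^ 2 : ℝ) : ℂ) * (conj (f k) * g k) := by
    push_cast
    ring
  rw [this, Complex.re_ofReal_mul]

/-! ### The system in Fourier variables -/

/-- The sum of the norms of the components of a matrix field. -/
def mag9 (J : Fin 3 → Fin 3 → Freq → ℂ) (k : Freq) : ℝ≥0∞ := ∑ i, ∑ j, mag (J i j) k

lemma mag_le_mag9 (J : Fin 3 → Fin 3 → Freq → ℂ) (i j : Fin 3) (k : Freq) :
    mag (J i j) k ≤ mag9 J k := by
  refine (Finset.single_le_sum (f := fun j => mag (J i j) k) (fun _ _ => zero_le)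
    (Finset.mem_univ j)).trans ?_
  exact Finset.single_le_sum (f := fun i => ∑ j, mag (J i j) k) (fun _ _ => zero_le)
    (Finset.mem_univ i)

/-- The Fourier coefficients of a solution at a fixed time. `G` is the inertial term
`J_eq (∂ₜω + (u·∇)ω)`, `Q` the quadratic and cubic precession, `K` the commutator `[Ω, J]`. -/
structure ModeSystem (c : Constants) (CQ : ℝ≥0∞) where
  u : Fin 3 → Freq → ℂ
  w : Fin 3 → Freq → ℂ
  J : Fin 3 → Fin 3 → Freq → ℂ
  du : Fin 3 → Freq → ℂ
  dw : Fin 3 → Freq → ℂ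
  dJ : Fin 3 → Fin 3 → Freq → ℂ
  p : Freq → ℂ
  G : Fin 3 → Freq → ℂ
  Q : Fin 3 → Freq → ℂ
  K : Fin 3 → Fin 3 → Freq → ℂ
  symm : ∀ i j, J i j = J j i
  real_u : ∀ j k, u j (-k) = conj (u j k)
  div_u : ∀ k : Freq, ∑ j, (k j : ℂ) * u j k = 0
  eq_u : ∀ i k, du i k = c.μt * lapMode k (fun j => u j k) i + c.κ * curlMode k (fun j => w j k) i
    - Complex.I * k i * p k - transport u (u i) k
  eq_w : ∀ i k, (c.inertia i : ℂ) * dw i k = G i k - c.inertia i * transport u (w i) k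
  eq_G : ∀ i k, G i k + ∑ j, ((c.inertia j)⁻¹ : ℝ) * cconv (J i j) (G j) k
    = stressMode c k (fun j => u j k) (fun j => w j k) i
      - precMode c (fun j => w j k) (fun i j => J i j k) i - Q i k
  eq_J : ∀ i j k, dJ i j k = inertiaMode c (fun j => w j k) (fun i j => J i j k) i j + K i j k
    - transport u (J i j) k
  Q_le : ∀ k, mag3 Q k ≤ CQ * (conv (mag3 w) (mag3 w) k + conv (mag9 J) (mag3 w) k
    + conv (mag3 w) (conv (mag9 J) (mag3 w)) k)
  K_le : ∀ i j k, mag (K i j) k ≤ 2 * conv (mag3 w) (mag9 J) k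
  K_orth : ∑ i, ∑ j, pair (fun _ => 1) (J i j) (K i j) = 0
  fin_u : ∀ i, sqs (fun k => (wt k : ℝ≥0∞) ^ 4 * mag (u i) k) ≠ ∞
  fin_w : ∀ i, sqs (fun k => (wt k : ℝ≥0∞) ^ 4 * mag (w i) k) ≠ ∞
  fin_J : ∀ i j, sqs (fun k => (wt k : ℝ≥0∞) ^ 4 * mag (J i j) k) ≠ ∞
  fin_du : ∀ i, sqs (mag (du i)) ≠ ∞
  fin_dw : ∀ i, sqs (mag (dw i)) ≠ ∞
  fin_dJ : ∀ i j, sqs (mag (dJ i j)) ≠ ∞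
  fin_G : ∀ i, sqs (mag (G i)) ≠ ∞

lemma sqs_finset_sum_ne_top {ι : Type*} (s : Finset ι) {f : ι → Freq → ℝ≥0∞}
    (h : ∀ i ∈ s, sqs (f i) ≠ ∞) : sqs (fun k => ∑ i ∈ s, f i k) ≠ ∞ := by
  classical
  induction s using Finset.induction_on with
  | empty => simp [sqs]
  | insert a s ha ih =>
    simp only [Finset.sum_insert ha]
    refine ne_top_of_le_ne_top ?_ (sqs_add_le _ _)
    have h1 := h a (Finset.mem_insert_self a s)
    have h2 := ih fun i hi => h i (Finset.mem_insert_of_mem hi)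
    finiteness

lemma sqs_ne_top_of_wt {f : Freq → ℝ≥0∞} {n : ℕ}
    (h : sqs (fun k => (wt k : ℝ≥0∞) ^ n * f k) ≠ ∞) : sqs f ≠ ∞ :=
  ne_top_of_le_ne_top h (sqs_le_wt_pow n f)

namespace ModeSystem

variable {c : Constants} {CQ : ℝ≥0∞} (m : ModeSystem c CQ)

/-- The time derivative of half the weighted energy. -/
def energyRate (V : Freq → ℕ) : ℝ :=
  ∑ i, pair V (m.u i) (m.du i) + ∑ i, c.inertia i * pair V (m.w i) (m.dw i)
    + ∑ i, ∑ j, pair V (m.J i j) (m.dJ i j)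

/-- The contribution of the transport terms to the energy balance. -/
def transportRate (V : Freq → ℕ) : ℝ :=
  ∑ i, pair V (m.u i) (transport m.u (m.u i))
    + ∑ i, c.inertia i * pair V (m.w i) (transport m.u (m.w i))
    + ∑ i, ∑ j, pair V (m.J i j) (transport m.u (m.J i j))

/-- The contribution of the commutator `[Ω, J]` to the energy balance. -/
def commRate (V : Freq → ℕ) : ℝ := ∑ i, ∑ j, pair V (m.J i j) (m.K i j)

/-- The nonlinear part of the angular momentum balance. -/
def N (i : Fin 3) (k : Freq) : ℂ :=
  m.Q i k + ∑ j, ((c.inertia j)⁻¹ : ℝ) * cconv (m.J i j) (m.G j) k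

lemma fin_mag3_u : sqs (fun k => (wt k : ℝ≥0∞) ^ 4 * mag3 m.u k) ≠ ∞ := by
  simp only [mag3, Finset.mul_sum]
  exact sqs_finset_sum_ne_top _ fun i _ => m.fin_u i

lemma fin_mag3_w : sqs (fun k => (wt k : ℝ≥0∞) ^ 4 * mag3 m.w k) ≠ ∞ := by
  simp only [mag3, Finset.mul_sum]
  exact sqs_finset_sum_ne_top _ fun i _ => m.fin_w i

lemma fin_mag9_J : sqs (fun k => (wt k : ℝ≥0∞) ^ 4 * mag9 m.J k) ≠ ∞ := by
  simp only [mag9, Finset.mul_sum]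
  refine sqs_finset_sum_ne_top _ fun i _ => sqs_finset_sum_ne_top _ fun j _ => m.fin_J i j

lemma tsum_ne_top {f : Freq → ℝ≥0∞} (h : sqs (fun k => (wt k : ℝ≥0∞) ^ 4 * f k) ≠ ∞) :
    ∑' k, f k ≠ ∞ := by
  have h1 := sq_tsum_le_of_sqs_le (n := 4) (by norm_num) (le_refl
    (sqs (fun k => (wt k : ℝ≥0∞) ^ 4 * f k)))
  have h2 : (∑' k, f k) ^ 2 ≠ ∞ :=
    ne_top_of_le_ne_top (ENNReal.mul_ne_top wienerConst_ne_top h) h1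
  intro h3
  rw [h3] at h2
  simp at h2

lemma fin_wt {f : Freq → ℂ} (h : sqs (fun k => (wt k : ℝ≥0∞) ^ 4 * mag f k) ≠ ∞) :
    sqs (fun k => wt k * mag f k) ≠ ∞ := by
  refine ne_top_of_le_ne_top h ?_
  simpa using sqs_wt_pow_mono (by norm_num : 1 ≤ 4) (mag f)

lemma fin_transport {f : Freq → ℂ} (h : sqs (fun k => (wt k : ℝ≥0∞) ^ 4 * mag f k) ≠ ∞) :
    sqs (mag (transport m.u f)) ≠ ∞ :=
  sqs_transport_ne_top (tsum_ne_top m.fin_mag3_u) (fin_wt h)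

lemma fin_K (i j : Fin 3) : sqs (mag (m.K i j)) ≠ ∞ := by
  refine ne_top_of_le_ne_top ?_ (sqs_mono (m.K_le i j))
  rw [sqs_const_mul]
  have h1 := sqs_conv_le (mag3 m.w) (mag9 m.J)
  have h2 := tsum_ne_top m.fin_mag3_w
  have h3 := sqs_ne_top_of_wt m.fin_mag9_J
  have h4 : sqs (conv (mag3 m.w) (mag9 m.J)) ≠ ∞ := ne_top_of_le_ne_top (by finiteness) h1
  finiteness

/-- The energy balance with the transport and commutator terms separated. -/
lemma energyRate_le {c₁ : ℝ}
    (hdis : ∀ (k : Freq) (u w : Fin 3 → ℂ) (p : ℂ), ∑ j, (k j : ℂ) * u j = 0 →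
      (∑ i, conj (u i) * (c.μt * lapMode k u i + c.κ * curlMode k w i
          - Complex.I * k i * p)).re
        + (∑ i, conj (w i) * stressMode c k u w i).re
      ≤ -c₁ * ((freqAbs k : ℝ) ^ 2 * (∑ i, ‖u i‖) ^ 2 + (wt k : ℝ) ^ 2 * (∑ i, ‖w i‖) ^ 2))
    {V : Freq → ℕ} {B : ℕ} (hV : ∀ k, V k ≤ B) {R : Freq → ℝ} (hR : Summable R)
    (hle : ∀ k, (V k : ℝ) ^ 2 * (-c₁ * ((freqAbs k : ℝ) ^ 2 * (∑ i, ‖m.u i k‖) ^ 2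
        + (wt k : ℝ) ^ 2 * (∑ i, ‖m.w i k‖) ^ 2)
      + (c.spin ^ 2 + 2 * |c.nu - c.lam|) * (‖m.w 0 k‖ * ‖m.J 1 2 k‖ + ‖m.w 1 k‖ * ‖m.J 0 2 k‖)
      + (∑ i, ‖m.w i k‖) * ∑ i, ‖m.N i k‖) ≤ R k) :
    m.energyRate V ≤ ∑' k, R k + m.commRate V - m.transportRate V := by
  have su := fun i => sqs_ne_top_of_wt (m.fin_u i)
  have sw := fun i => sqs_ne_top_of_wt (m.fin_w i)
  have sJ := fun i j => sqs_ne_top_of_wt (m.fin_J i j)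
  have tu := fun i => m.fin_transport (m.fin_u i)
  have tw := fun i => m.fin_transport (m.fin_w i)
  have tJ := fun i j => m.fin_transport (m.fin_J i j)
  -- The rates with transport and [Ω, J] removed are local in frequency up to N, so their pairings
  -- can be estimated mode by mode.
  set lu : Fin 3 → Freq → ℂ := fun i k => m.du i k + transport m.u (m.u i) k with hlu
  set lw : Fin 3 → Freq → ℂ := fun i k => m.dw i k + transport m.u (m.w i) k with hlw
  set lJ : Fin 3 → Fin 3 → Freq → ℂ := fun i j k => m.dJ i j k + transport m.u (m.J i j) k
    - m.K i j k with hlJ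
  have flu : ∀ i, sqs (mag (lu i)) ≠ ∞ := fun i => sqs_mag_add_ne_top (m.fin_du i) (tu i)
  have flw : ∀ i, sqs (mag (lw i)) ≠ ∞ := fun i => sqs_mag_add_ne_top (m.fin_dw i) (tw i)
  have flJ' : ∀ i j, sqs (mag fun k => m.dJ i j k + transport m.u (m.J i j) k) ≠ ∞ :=
    fun i j => sqs_mag_add_ne_top (m.fin_dJ i j) (tJ i j)
  have flJ : ∀ i j, sqs (mag (lJ i j)) ≠ ∞ := fun i j => sqs_mag_sub_ne_top (flJ' i j) (m.fin_K i j)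
  have pu : ∀ i, pair V (m.u i) (lu i)
      = pair V (m.u i) (m.du i) + pair V (m.u i) (transport m.u (m.u i)) :=
    fun i => pair_add hV (su i) (m.fin_du i) (tu i)
  have pw : ∀ i, pair V (m.w i) (lw i)
      = pair V (m.w i) (m.dw i) + pair V (m.w i) (transport m.u (m.w i)) :=
    fun i => pair_add hV (sw i) (m.fin_dw i) (tw i)
  have pJ : ∀ i j, pair V (m.J i j) (lJ i j)
      = pair V (m.J i j) (m.dJ i j) + pair V (m.J i j) (transport m.u (m.J i j))
        - pair V (m.J i j) (m.K i j) := by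
    intro i j
    rw [← pair_add hV (sJ i j) (m.fin_dJ i j) (tJ i j)]
    exact pair_sub hV (sJ i j) (flJ' i j) (m.fin_K i j)
  have hrate : m.energyRate V + m.transportRate V - m.commRate V
      = ∑ i, pair V (m.u i) (lu i) + ∑ i, c.inertia i * pair V (m.w i) (lw i)
        + ∑ i, ∑ j, pair V (m.J i j) (lJ i j) := by
    simp only [energyRate, transportRate, commRate, pu, pw, pJ, Finset.sum_add_distrib,
      Finset.sum_sub_distrib, mul_add]
    ring
  have hsu : ∀ i, Summable fun k => (V k : ℝ) ^ 2 * (conj (m.u i k) * lu i k).re :=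
    fun i => summable_pair hV (su i) (flu i)
  have hsw : ∀ i, Summable fun k => c.inertia i * ((V k : ℝ) ^ 2 * (conj (m.w i k) * lw i k).re) :=
    fun i => (summable_pair hV (sw i) (flw i)).mul_left _
  have hsJ : ∀ i j, Summable fun k => (V k : ℝ) ^ 2 * (conj (m.J i j k) * lJ i j k).re :=
    fun i j => summable_pair hV (sJ i j) (flJ i j)
  have hsum : ∑ i, pair V (m.u i) (lu i) + ∑ i, c.inertia i * pair V (m.w i) (lw i)
        + ∑ i, ∑ j, pair V (m.J i j) (lJ i j)
      = ∑' k, (∑ i, (V k : ℝ) ^ 2 * (conj (m.u i k) * lu i k).re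
        + ∑ i, c.inertia i * ((V k : ℝ) ^ 2 * (conj (m.w i k) * lw i k).re)
        + ∑ i, ∑ j, (V k : ℝ) ^ 2 * (conj (m.J i j k) * lJ i j k).re) := by
    rw [Summable.tsum_add, Summable.tsum_add, Summable.tsum_finsetSum, Summable.tsum_finsetSum,
      Summable.tsum_finsetSum]
    · congr 1
      · congr 1
        refine Finset.sum_congr rfl fun i _ => ?_
        rw [pair, tsum_mul_left]
      · refine Finset.sum_congr rfl fun i _ => ?_
        rw [Summable.tsum_finsetSum fun j _ => hsJ i j]
        rfl
    · exact fun i _ => summable_sum fun j _ => hsJ i j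
    · exact fun i _ => hsw i
    · exact fun i _ => hsu i
    · exact summable_sum fun i _ => hsu i
    · exact summable_sum fun i _ => hsw i
    · exact (summable_sum fun i _ => hsu i).add (summable_sum fun i _ => hsw i)
    · exact summable_sum fun i _ => summable_sum fun j _ => hsJ i j
  have hmain : ∑' k, (∑ i, (V k : ℝ) ^ 2 * (conj (m.u i k) * lu i k).re
        + ∑ i, c.inertia i * ((V k : ℝ) ^ 2 * (conj (m.w i k) * lw i k).re)
        + ∑ i, ∑ j, (V k : ℝ) ^ 2 * (conj (m.J i j k) * lJ i j k).re) ≤ ∑' k, R k := by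
    refine Summable.tsum_le_tsum (fun k => ?_)
      (((summable_sum fun i _ => hsu i).add (summable_sum fun i _ => hsw i)).add
        (summable_sum fun i _ => summable_sum fun j _ => hsJ i j)) hR
    refine le_trans ?_ (hle k)
    have e1 : ∀ i, lu i k = c.μt * lapMode k (fun j => m.u j k) i
        + c.κ * curlMode k (fun j => m.w j k) i - Complex.I * k i * m.p k := by
      intro i
      rw [hlu]
      simp only [m.eq_u]
      ring
    have e2 : ∀ i, (c.inertia i : ℂ) * lw i k
        = stressMode c k (fun j => m.u j k) (fun j => m.w j k) i
          - precMode c (fun j => m.w j k) (fun i j => m.J i j k) i - m.N i k := by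
      intro i
      have h1 := m.eq_w i k
      have h2 := m.eq_G i k
      simp only [hlw, N]
      linear_combination h1 + h2
    have e3 : ∀ i j, lJ i j k = inertiaMode c (fun j => m.w j k) (fun i j => m.J i j k) i j := by
      intro i j
      simp only [hlJ, m.eq_J]
      ring
    have d1 := hdis k (fun j => m.u j k) (fun j => m.w j k) (m.p k) (m.div_u k)
    have d2 := re_coupling_le c (fun j => m.w j k) (fun i j => m.J i j k)
      (fun i j => congrFun (m.symm i j) k)
    have d3 : -(∑ i, conj (m.w i k) * m.N i k).re ≤ (∑ i, ‖m.w i k‖) * ∑ i, ‖m.N i k‖ := by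
      refine (neg_le_abs _).trans ((Complex.abs_re_le_norm _).trans ?_)
      refine (norm_sum_le _ _).trans ?_
      rw [Finset.sum_mul]
      refine Finset.sum_le_sum fun i _ => ?_
      rw [norm_mul, Complex.norm_conj]
      gcongr
      exact Finset.single_le_sum (f := fun i => ‖m.N i k‖) (fun _ _ => norm_nonneg _)
        (Finset.mem_univ i)
    have e4 : ∑ i, (V k : ℝ) ^ 2 * (conj (m.u i k) * lu i k).re
        = (V k : ℝ) ^ 2 * (∑ i, conj (m.u i k) * (c.μt * lapMode k (fun j => m.u j k) i
          + c.κ * curlMode k (fun j => m.w j k) i - Complex.I * k i * m.p k)).re := by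
      rw [← Finset.mul_sum, Complex.re_sum]
      simp only [e1]
    have e5 : ∑ i, c.inertia i * ((V k : ℝ) ^ 2 * (conj (m.w i k) * lw i k).re)
        = (V k : ℝ) ^ 2 * ((∑ i, conj (m.w i k)
            * stressMode c k (fun j => m.u j k) (fun j => m.w j k) i).re
          - (∑ i, conj (m.w i k) * precMode c (fun j => m.w j k) (fun i j => m.J i j k) i).re
          - (∑ i, conj (m.w i k) * m.N i k).re) := by
      rw [← Complex.sub_re, ← Complex.sub_re, ← Finset.sum_sub_distrib, ← Finset.sum_sub_distrib,
        Complex.re_sum, Finset.mul_sum]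
      refine Finset.sum_congr rfl fun i _ => ?_
      have : c.inertia i * (conj (m.w i k) * lw i k).re
          = (conj (m.w i k) * ((c.inertia i : ℂ) * lw i k)).re := by
        rw [← Complex.re_ofReal_mul]
        congr 1
        ring
      rw [mul_left_comm, this, e2]
      congr 2
      ring
    have e6 : ∑ i, ∑ j, (V k : ℝ) ^ 2 * (conj (m.J i j k) * lJ i j k).re
        = (V k : ℝ) ^ 2 * (∑ i, ∑ j, conj (m.J i j k)
          * inertiaMode c (fun j => m.w j k) (fun i j => m.J i j k) i j).re := by
      simp only [← Finset.mul_sum, Complex.re_sum, e3]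
    rw [e4, e5, e6, ← mul_add, ← mul_add]
    refine mul_le_mul_of_nonneg_left ?_ (sq_nonneg _)
    linarith
  linarith

end ModeSystem

/-! ### Size of the linear symbols and of the inertial term -/

lemma mag3_eq_ofReal (f : Fin 3 → Freq → ℂ) (k : Freq) :
    mag3 f k = ENNReal.ofReal (∑ i, ‖f i k‖) := by
  rw [ENNReal.ofReal_sum_of_nonneg fun _ _ => norm_nonneg _]
  exact Finset.sum_congr rfl fun i _ => (ofReal_norm _).symm

lemma abs_freq_le (k : Freq) (i : Fin 3) : |(k i : ℝ)| ≤ freqAbs k := by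
  rw [← Int.cast_abs, ← Nat.cast_natAbs]
  exact_mod_cast Finset.single_le_sum (f := fun i => (k i).natAbs) (fun _ _ => Nat.zero_le _)
    (Finset.mem_univ i)

lemma norm_deriv_mode_le (k : Freq) (i : Fin 3) (z : ℂ) :
    ‖Complex.I * k i * z‖ ≤ freqAbs k * ‖z‖ := by
  rw [norm_mul, norm_mul, Complex.norm_I, one_mul, Complex.norm_intCast]
  gcongr
  exact abs_freq_le k i

lemma norm_le_sum_three (v : Fin 3 → ℂ) (i : Fin 3) : ‖v i‖ ≤ ∑ i, ‖v i‖ :=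
  Finset.single_le_sum (f := fun i => ‖v i‖) (fun _ _ => norm_nonneg _) (Finset.mem_univ i)

lemma norm_curlMode_le (k : Freq) (v : Fin 3 → ℂ) (i : Fin 3) :
    ‖curlMode k v i‖ ≤ freqAbs k * ∑ i, ‖v i‖ := by
  have h : ∀ a b a' b' : Fin 3, b ≠ b' → ‖Complex.I * k a * v b - Complex.I * k a' * v b'‖
      ≤ freqAbs k * ∑ i, ‖v i‖ := by
    intro a b a' b' hb
    have h1 := norm_deriv_mode_le k a (v b)
    have h2 := norm_deriv_mode_le k a' (v b')
    have h3 : ‖v b‖ + ‖v b'‖ ≤ ∑ i, ‖v i‖ := by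
      rw [← Finset.sum_pair (f := fun i => ‖v i‖) hb]
      exact Finset.sum_le_sum_of_subset_of_nonneg (Finset.subset_univ _)
        fun _ _ _ => norm_nonneg _
    calc _ ≤ ‖Complex.I * k a * v b‖ + ‖Complex.I * k a' * v b'‖ := norm_sub_le _ _
      _ ≤ freqAbs k * (‖v b‖ + ‖v b'‖) := by linarith
      _ ≤ _ := by gcongr
  fin_cases i
  · exact h 1 2 2 1 (by decide)
  · exact h 2 0 0 2 (by decide)
  · exact h 0 1 1 0 (by decide)

lemma norm_stressMode_le (c : Constants) (k : Freq) (u w : Fin 3 → ℂ) (i : Fin 3) :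
    ‖stressMode c k u w i‖ ≤ (3 * |c.κ| + |c.αt - c.γt| + 3 * |c.γt|)
      * (freqAbs k * ∑ i, ‖u i‖ + (wt k : ℝ) ^ 2 * ∑ i, ‖w i‖) := by
  have hf : (freqAbs k : ℝ) ≤ wt k := by exact_mod_cast freqAbs_le_wt k
  have hw1 : (1 : ℝ) ≤ wt k := by exact_mod_cast one_le_wt k
  set nu := ∑ i, ‖u i‖ with hnu
  set nw := ∑ i, ‖w i‖ with hnw
  have hnu0 : 0 ≤ nu := Finset.sum_nonneg fun _ _ => norm_nonneg _
  have hnw0 : 0 ≤ nw := Finset.sum_nonneg fun _ _ => norm_nonneg _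
  have hff : (freqAbs k : ℝ) * freqAbs k ≤ (wt k : ℝ) ^ 2 := by
    rw [pow_two]
    gcongr
  have hw2 : (1 : ℝ) ≤ (wt k : ℝ) ^ 2 := one_le_pow₀ hw1
  have h1 := norm_curlMode_le k u i
  have h2 : ‖w i‖ ≤ (wt k : ℝ) ^ 2 * nw :=
    (norm_le_sum_three w i).trans (le_mul_of_one_le_left hnw0 hw2)
  have h3 : ‖Complex.I * k i * ∑ j, Complex.I * k j * w j‖ ≤ (wt k : ℝ) ^ 2 * nw := by
    refine (norm_deriv_mode_le k i _).trans ?_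
    have : ‖∑ j, Complex.I * k j * w j‖ ≤ freqAbs k * nw := by
      rw [hnw, Finset.mul_sum]
      exact (norm_sum_le _ _).trans (Finset.sum_le_sum fun j _ => norm_deriv_mode_le k j _)
    calc _ ≤ (freqAbs k : ℝ) * (freqAbs k * nw) := by gcongr
      _ = freqAbs k * freqAbs k * nw := by ring
      _ ≤ _ := by gcongr
  have h4 : ‖lapMode k w i‖ ≤ 3 * ((wt k : ℝ) ^ 2 * nw) := by
    have h5 : ∀ j ∈ (Finset.univ : Finset (Fin 3)),
        ‖Complex.I * k j * (Complex.I * k j * w i)‖ ≤ (wt k : ℝ) ^ 2 * nw := by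
      intro j _
      calc _ ≤ (freqAbs k : ℝ) * (freqAbs k * ‖w i‖) :=
            (norm_deriv_mode_le k j _).trans (by gcongr; exact norm_deriv_mode_le k j _)
        _ = freqAbs k * freqAbs k * ‖w i‖ := by ring
        _ ≤ _ := by
          gcongr
          exact norm_le_sum_three w i
    refine (norm_sum_le_of_le _ h5).trans (le_of_eq ?_)
    simp
  have hT : 0 ≤ freqAbs k * nu := by positivity
  have hS : 0 ≤ (wt k : ℝ) ^ 2 * nw := by positivity
  set T := freqAbs k * nu
  set S := (wt k : ℝ) ^ 2 * nw
  have e1 : ‖(c.κ : ℂ) * curlMode k u i‖ ≤ |c.κ| * T := by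
    rw [norm_mul, Complex.norm_real, Real.norm_eq_abs]
    gcongr
  have e2 : ‖((2 * c.κ : ℝ) : ℂ) * w i‖ ≤ 2 * |c.κ| * S := by
    rw [norm_mul, Complex.norm_real, Real.norm_eq_abs, abs_mul, abs_two]
    gcongr
  have e3 : ‖((c.αt - c.γt : ℝ) : ℂ) * (Complex.I * k i * ∑ j, Complex.I * k j * w j)‖
      ≤ |c.αt - c.γt| * S := by
    rw [norm_mul, Complex.norm_real, Real.norm_eq_abs]
    gcongr
  have e4 : ‖(c.γt : ℂ) * lapMode k w i‖ ≤ |c.γt| * (3 * S) := by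
    rw [norm_mul, Complex.norm_real, Real.norm_eq_abs]
    gcongr
  have e5 : ‖stressMode c k u w i‖ ≤ |c.κ| * T + 2 * |c.κ| * S + |c.αt - c.γt| * S
      + |c.γt| * (3 * S) := by
    refine (norm_add_le _ _).trans (add_le_add ((norm_add_le _ _).trans (add_le_add
      ((norm_sub_le _ _).trans (add_le_add e1 e2)) e3)) e4)
  have p1 : 0 ≤ |c.κ| * T := by positivity
  have p2 : 0 ≤ |c.κ| * S := by positivity
  have p3 : 0 ≤ |c.αt - c.γt| * T := by positivity
  have p4 : 0 ≤ |c.γt| * T := by positivity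
  linarith

lemma norm_precMode_le (c : Constants) (w : Fin 3 → ℂ) (J : Fin 3 → Fin 3 → ℂ) (i : Fin 3) :
    ‖precMode c w J i‖ ≤ (|c.spin * (c.nu - c.lam)| + c.spin ^ 2)
      * (∑ i, ‖w i‖ + (‖J 0 2‖ + ‖J 1 2‖)) := by
  have h0 := norm_le_sum_three w 0
  have h1 := norm_le_sum_three w 1
  set nw := ∑ i, ‖w i‖
  have hnw : 0 ≤ nw := (norm_nonneg _).trans h0
  have hs : 0 ≤ c.spin ^ 2 := sq_nonneg _
  have p0 := norm_nonneg (J 0 2)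
  have p1 := norm_nonneg (J 1 2)
  have key : ∀ z z' : ℂ, ‖z‖ ≤ nw → ‖z'‖ ≤ ‖J 0 2‖ + ‖J 1 2‖ →
      ‖((c.spin * (c.nu - c.lam) : ℝ) : ℂ) * z‖ + ‖((c.spin ^ 2 : ℝ) : ℂ) * z'‖
        ≤ (|c.spin * (c.nu - c.lam)| + c.spin ^ 2) * (nw + (‖J 0 2‖ + ‖J 1 2‖)) := by
    intro z z' hz hz'
    rw [norm_mul, norm_mul, Complex.norm_real, Complex.norm_real, Real.norm_eq_abs,
      Real.norm_eq_abs, abs_of_nonneg hs]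
    set A := |c.spin * (c.nu - c.lam)|
    have hA : 0 ≤ A := abs_nonneg _
    have e1 : A * ‖z‖ ≤ A * nw := by gcongr
    have e2 : c.spin ^ 2 * ‖z'‖ ≤ c.spin ^ 2 * (‖J 0 2‖ + ‖J 1 2‖) := by gcongr
    have e3 : 0 ≤ A * (‖J 0 2‖ + ‖J 1 2‖) := by positivity
    have e4 : 0 ≤ c.spin ^ 2 * nw := by positivity
    linarith
  fin_cases i
  · exact (norm_sub_le _ _).trans (key (w 1) (J 1 2) h1 (by linarith))
  · refine (norm_add_le _ _).trans ?_
    rw [norm_neg]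
    exact key (w 0) (J 0 2) h0 (by linarith)
  · simp only [precMode, Fin.reduceFinMk, Matrix.cons_val, norm_zero]
    positivity

/-- The norm of the linear part of the angular momentum balance. -/
def Constants.linConst (c : Constants) : ℝ :=
  3 * (3 * |c.κ| + |c.αt - c.γt| + 3 * |c.γt|) + 3 * (|c.spin * (c.nu - c.lam)| + c.spin ^ 2) + 1

/-- The norm of the inverse of `J_eq`. -/
def Constants.invConst (c : Constants) : ℝ := ∑ j, |(c.inertia j)⁻¹|

namespace ModeSystem

variable {c : Constants} {CQ : ℝ≥0∞} (m : ModeSystem c CQ)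

/-- The components of `J` that couple to the horizontal angular velocity. -/
def a (k : Freq) : ℝ≥0∞ := mag (m.J 0 2) k + mag (m.J 1 2) k

lemma a_le (k : Freq) : m.a k ≤ mag9 m.J k := by
  simp only [a, mag9, Fin.sum_univ_three]
  set x := mag (m.J 0 2) k
  set y := mag (m.J 1 2) k
  calc x + y ≤ (mag (m.J 0 0) k + mag (m.J 0 1) k + x) + (mag (m.J 1 0) k + mag (m.J 1 1) k + y) :=
        add_le_add le_add_self le_add_self
    _ ≤ _ := le_add_right le_rfl

lemma sum_inv_cconv_le (k : Freq) :
    ∑ i, ‖∑ j, (((c.inertia j)⁻¹ : ℝ) : ℂ) * cconv (m.J i j) (m.G j) k‖ₑ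
      ≤ ENNReal.ofReal c.invConst * conv (mag9 m.J) (mag3 m.G) k := by
  have h1 : ∀ j, ‖(((c.inertia j)⁻¹ : ℝ) : ℂ)‖ₑ ≤ ENNReal.ofReal c.invConst := by
    intro j
    rw [← ofReal_norm, Complex.norm_real, Real.norm_eq_abs]
    exact ENNReal.ofReal_le_ofReal (Finset.single_le_sum (f := fun j => |(c.inertia j)⁻¹|)
      (fun _ _ => abs_nonneg _) (Finset.mem_univ j))
  have h2 : ∀ i, ‖∑ j, (((c.inertia j)⁻¹ : ℝ) : ℂ) * cconv (m.J i j) (m.G j) k‖ₑ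
      ≤ ENNReal.ofReal c.invConst * ∑ j, conv (mag (m.J i j)) (mag (m.G j)) k := by
    intro i
    rw [Finset.mul_sum]
    refine (enorm_sum_le _ _).trans (Finset.sum_le_sum fun j _ => ?_)
    rw [enorm_mul]
    gcongr
    · exact h1 j
    · exact mag_cconv_le _ _ k
  refine (Finset.sum_le_sum fun i _ => h2 i).trans ?_
  rw [← Finset.mul_sum]
  gcongr
  have h3 : ∀ i, ∑ j, conv (mag (m.J i j)) (mag (m.G j)) k
      ≤ conv (fun k => ∑ j, mag (m.J i j) k) (mag3 m.G) k := by
    intro i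
    simp only [conv]
    rw [← Summable.tsum_finsetSum fun _ _ => ENNReal.summable]
    refine ENNReal.tsum_le_tsum fun l => ?_
    rw [Finset.sum_mul]
    refine Finset.sum_le_sum fun j _ => ?_
    gcongr
    exact mag_le_mag3 m.G j l
  refine (Finset.sum_le_sum fun i _ => h3 i).trans (le_of_eq ?_)
  simp only [conv, mag9]
  rw [← Summable.tsum_finsetSum fun _ _ => ENNReal.summable]
  exact tsum_congr fun l => (Finset.sum_mul _ _ _).symm

lemma mag3_N_le (k : Freq) :
    mag3 m.N k ≤ mag3 m.Q k + ENNReal.ofReal c.invConst * conv (mag9 m.J) (mag3 m.G) k := by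
  calc mag3 m.N k ≤ ∑ i, (mag (m.Q i) k
        + ‖∑ j, (((c.inertia j)⁻¹ : ℝ) : ℂ) * cconv (m.J i j) (m.G j) k‖ₑ) :=
        Finset.sum_le_sum fun i _ => enorm_add_le _ _
    _ ≤ _ := by
        rw [Finset.sum_add_distrib]
        exact add_le_add le_rfl (m.sum_inv_cconv_le k)

/-- Solving `eq_G` for the inertial term gives the implicit inequality on which both nonlinear
estimates run. In its linear part J appears only through `a`; with all of J instead, the L² balance
could not be closed by E_ins. -/
lemma mag3_G_le (k : Freq) :
    mag3 m.G k ≤ ENNReal.ofReal c.linConst * (freqAbs k * mag3 m.u k + wt k ^ 2 * mag3 m.w k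
        + m.a k + mag3 m.Q k)
      + ENNReal.ofReal c.invConst * conv (mag9 m.J) (mag3 m.G) k := by
  set L : Fin 3 → ℂ := fun i => stressMode c k (fun j => m.u j k) (fun j => m.w j k) i
      - precMode c (fun j => m.w j k) (fun i j => m.J i j k) i with hL
  have hG : ∀ i, m.G i k = L i - m.Q i k
      - ∑ j, (((c.inertia j)⁻¹ : ℝ) : ℂ) * cconv (m.J i j) (m.G j) k := by
    intro i
    rw [hL, eq_sub_iff_add_eq]
    exact m.eq_G i k
  have hle : mag3 m.G k ≤ ∑ i, ‖L i‖ₑ + mag3 m.Q k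
      + ENNReal.ofReal c.invConst * conv (mag9 m.J) (mag3 m.G) k := by
    refine le_trans ?_ (add_le_add le_rfl (m.sum_inv_cconv_le k))
    simp only [mag3]
    rw [← Finset.sum_add_distrib, ← Finset.sum_add_distrib]
    refine Finset.sum_le_sum fun i _ => ?_
    rw [mag, hG i]
    exact enorm_sub_le.trans (add_le_add enorm_sub_le le_rfl)
  refine hle.trans (add_le_add ?_ le_rfl)
  have hw1 : (1 : ℝ) ≤ wt k := by exact_mod_cast one_le_wt k
  have hLr : ∑ i, ‖L i‖ ≤ (c.linConst - 1) * (freqAbs k * ∑ i, ‖m.u i k‖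
      + (wt k : ℝ) ^ 2 * ∑ i, ‖m.w i k‖ + (‖m.J 0 2 k‖ + ‖m.J 1 2 k‖)) := by
    set S := freqAbs k * ∑ i, ‖m.u i k‖ + (wt k : ℝ) ^ 2 * ∑ i, ‖m.w i k‖ with hS
    set α := ‖m.J 0 2 k‖ + ‖m.J 1 2 k‖ with hα
    have hS1 : ∑ i, ‖m.w i k‖ ≤ S := by
      rw [hS]
      have h1 : ∑ i, ‖m.w i k‖ ≤ (wt k : ℝ) ^ 2 * ∑ i, ‖m.w i k‖ :=
        le_mul_of_one_le_left (Finset.sum_nonneg fun _ _ => norm_nonneg _) (one_le_pow₀ hw1)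
      have h2 : (0 : ℝ) ≤ freqAbs k * ∑ i, ‖m.u i k‖ := by positivity
      linarith
    have hα0 : 0 ≤ α := by positivity
    set A := 3 * |c.κ| + |c.αt - c.γt| + 3 * |c.γt| with hA
    set B := |c.spin * (c.nu - c.lam)| + c.spin ^ 2 with hB
    have hA0 : 0 ≤ A := by positivity
    have hB0 : 0 ≤ B := by positivity
    have hi : ∀ i ∈ (Finset.univ : Finset (Fin 3)), ‖L i‖ ≤ (A + B) * (S + α) := by
      intro i _
      have e1 := norm_stressMode_le c k (fun j => m.u j k) (fun j => m.w j k) i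
      have e2 := norm_precMode_le c (fun j => m.w j k) (fun i j => m.J i j k) i
      refine (norm_sub_le _ _).trans ((add_le_add e1 e2).trans ?_)
      have e3 : B * (∑ i, ‖m.w i k‖ + α) ≤ B * (S + α) := by gcongr
      have e4 : 0 ≤ A * α := by positivity
      linarith
    calc ∑ i, ‖L i‖ ≤ ∑ _i : Fin 3, (A + B) * (S + α) := Finset.sum_le_sum hi
      _ = 3 * ((A + B) * (S + α)) := by simp
      _ = _ := by
        rw [Constants.linConst, ← hA, ← hB]
        ring
  -- The summand 1 in `linConst` covers the unit coefficient of Q, while the remainder bounds the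
  -- linear part.
  have hc1 : 1 ≤ c.linConst := by
    rw [Constants.linConst]
    have h1 : 0 ≤ 3 * |c.κ| + |c.αt - c.γt| + 3 * |c.γt| := by positivity
    have h2 : 0 ≤ |c.spin * (c.nu - c.lam)| + c.spin ^ 2 := by positivity
    linarith
  have e1 : ∑ i, ‖L i‖ₑ = ENNReal.ofReal (∑ i, ‖L i‖) := by
    rw [ENNReal.ofReal_sum_of_nonneg fun _ _ => norm_nonneg _]
    exact Finset.sum_congr rfl fun i _ => (ofReal_norm _).symm
  have e2 : m.a k = ENNReal.ofReal (‖m.J 0 2 k‖ + ‖m.J 1 2 k‖) := by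
    rw [ENNReal.ofReal_add (norm_nonneg _) (norm_nonneg _), ofReal_norm, ofReal_norm]
    rfl
  have e3 : ((freqAbs k : ℝ≥0∞) * mag3 m.u k + wt k ^ 2 * mag3 m.w k + m.a k)
      = ENNReal.ofReal (freqAbs k * ∑ i, ‖m.u i k‖ + (wt k : ℝ) ^ 2 * ∑ i, ‖m.w i k‖
        + (‖m.J 0 2 k‖ + ‖m.J 1 2 k‖)) := by
    rw [ENNReal.ofReal_add (by positivity) (by positivity),
      ENNReal.ofReal_add (by positivity) (by positivity), ENNReal.ofReal_mul (by positivity),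
      ENNReal.ofReal_mul (by positivity), ENNReal.ofReal_pow (by positivity),
      ENNReal.ofReal_natCast, ENNReal.ofReal_natCast, ← mag3_eq_ofReal, ← mag3_eq_ofReal, ← e2]
  rw [e1, mul_add, e3, ← ENNReal.ofReal_mul (by linarith)]
  refine add_le_add (ENNReal.ofReal_le_ofReal (hLr.trans ?_)) ?_
  · gcongr
    linarith
  · calc mag3 m.Q k = 1 * mag3 m.Q k := (one_mul _).symm
      _ ≤ _ := by
        gcongr
        exact ENNReal.one_le_ofReal.mpr hc1

lemma fin_mag3_G : sqs (mag3 m.G) ≠ ∞ := sqs_finset_sum_ne_top _ fun i _ => m.fin_G i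

end ModeSystem

namespace ModeSystem

variable {c : Constants} {CQ : ℝ≥0∞} (m : ModeSystem c CQ)

lemma pair_transport_eq {V : Freq → ℕ} {B : ℕ} (hV : ∀ k, V k ≤ B) {f : Freq → ℂ}
    (hf : sqs (fun k => (wt k : ℝ≥0∞) ^ 4 * mag f k) ≠ ∞) :
    pair V f (transport m.u f)
      = (∑' k, conj (((V k : ℝ) : ℂ) * f k) * transportComm (fun k => (V k : ℝ)) m.u f k).re := by
  have hV' : ∀ k, |((V k : ℝ))| ≤ (B : ℝ) := fun k => by
    rw [abs_of_nonneg (Nat.cast_nonneg _)]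
    exact_mod_cast hV k
  rw [pair_eq_re_tsum hV (sqs_ne_top_of_wt hf) (m.fin_transport hf)]
  exact re_tsum_weight_transport hV' m.real_u m.div_u (tsum_ne_top m.fin_mag3_u) (fin_wt hf)

/-- The constant weight commutes with transport, so in L² no error term arises. -/
lemma transportRate_one : m.transportRate (fun _ => 1) = 0 := by
  have h : ∀ f : Freq → ℂ, sqs (fun k => (wt k : ℝ≥0∞) ^ 4 * mag f k) ≠ ∞ →
      pair (fun _ => 1) f (transport m.u f) = 0 := by
    intro f hf
    rw [m.pair_transport_eq (B := 1) (fun _ => le_rfl) hf]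
    simp [transportComm_one]
  simp only [transportRate, h _ (m.fin_u _), h _ (m.fin_w _), h _ (m.fin_J _ _), mul_zero,
    Finset.sum_const_zero, add_zero]

end ModeSystem

/-- The energy balance in `L²`: only the horizontal angular velocity and the off-diagonal
microinertia feed the energy. -/
lemma exists_energyRate_low {c : Constants} (hc : c.Admissible) {CQ : ℝ≥0∞} (hCQ : CQ ≠ ∞) :
    ∃ δ : ℝ, 0 < δ ∧ ∃ C : ℝ, 0 < C ∧ ∀ m : ModeSystem c CQ,
      sqs (fun k => (wt k : ℝ≥0∞) ^ 4 * mag3 m.w k) ≤ ENNReal.ofReal δ →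
      sqs (fun k => (wt k : ℝ≥0∞) ^ 4 * mag9 m.J k) ≤ ENNReal.ofReal δ →
      m.energyRate (fun _ => 1)
        ≤ C * ∑' k, (‖m.w 0 k‖ ^ 2 + ‖m.w 1 k‖ ^ 2 + (‖m.J 0 2 k‖ ^ 2 + ‖m.J 1 2 k‖ ^ 2)) := by
  obtain ⟨c₁, hc₁, hdis⟩ := exists_dissipation hc
  obtain ⟨Cn, hCn, δn, hδn, hδn1, hnl⟩ := exists_nonlinear_estimate_low
    (CR := ENNReal.ofReal c.linConst) (CA := ENNReal.ofReal c.invConst)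
    ENNReal.ofReal_ne_top ENNReal.ofReal_ne_top hCQ
  set C₀ : ℝ := c.spin ^ 2 + 2 * |c.nu - c.lam| with hC₀
  have hC₀0 : 0 ≤ C₀ := by positivity
  have hδnt : δn ≠ ∞ := ne_top_of_le_ne_top ENNReal.one_ne_top hδn1
  set Cr := Cn.toReal with hCr
  have hCr0 : 0 ≤ Cr := ENNReal.toReal_nonneg
  -- The second bound on δ makes the Young term of N at most (c₁/2)(DU + DW + 2 Ein), which fits
  -- into the available dissipation. The resulting c₁ Ein and the coupling C₀/2 give C; the extra 1
  -- is slack.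
  refine ⟨min δn.toReal (c₁ ^ 2 / (Cr + 1)), lt_min (ENNReal.toReal_pos hδn hδnt) (by positivity),
    C₀ / 2 + c₁ + 1, by positivity, fun m hW hJ => ?_⟩
  set δ := min δn.toReal (c₁ ^ 2 / (Cr + 1)) with hδ
  have hδ0 : 0 < δ := lt_min (ENNReal.toReal_pos hδn hδnt) (by positivity)
  have hδ1 : ENNReal.ofReal δ ≤ δn := by
    refine (ENNReal.ofReal_le_ofReal (min_le_left _ _)).trans ?_
    rw [ENNReal.ofReal_toReal hδnt]
  have hδ2 : Cr * δ ≤ c₁ ^ 2 := by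
    have h1 : δ ≤ c₁ ^ 2 / (Cr + 1) := min_le_right _ _
    rw [le_div_iff₀ (by positivity)] at h1
    linarith
  have hN := hnl (mag3 m.u) (mag3 m.w) (mag9 m.J) m.a (mag3 m.G) (mag3 m.Q) (ENNReal.ofReal δ)
    m.mag3_G_le m.Q_le m.fin_mag3_G hW hJ hδ1
  set nu : Freq → ℝ := fun k => ∑ i, ‖m.u i k‖ with hnu
  set nw : Freq → ℝ := fun k => ∑ i, ‖m.w i k‖ with hnw
  set nN : Freq → ℝ := fun k => ∑ i, ‖m.N i k‖ with hnN
  set ein : Freq → ℝ := fun k => ‖m.w 0 k‖ ^ 2 + ‖m.w 1 k‖ ^ 2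
    + (‖m.J 0 2 k‖ ^ 2 + ‖m.J 1 2 k‖ ^ 2) with hein
  have fU : sqs (fun k => freqAbs k * mag3 m.u k) ≠ ∞ := by
    refine ne_top_of_le_ne_top m.fin_mag3_u (sqs_mono fun k => ?_)
    gcongr
    have : freqAbs k ≤ wt k ^ 4 := (freqAbs_le_wt k).trans (Nat.le_self_pow (by norm_num) _)
    exact_mod_cast this
  have fW : sqs (fun k => wt k * mag3 m.w k) ≠ ∞ := by
    refine ne_top_of_le_ne_top m.fin_mag3_w (sqs_mono fun k => ?_)
    gcongr
    have : wt k ≤ wt k ^ 4 := Nat.le_self_pow (by norm_num) _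
    exact_mod_cast this
  have fa : sqs m.a ≠ ∞ :=
    ne_top_of_le_ne_top (sqs_ne_top_of_wt m.fin_mag9_J) (sqs_mono m.a_le)
  have fN' : sqs (fun k => (wt k : ℝ≥0∞)⁻¹ * mag3 m.N k) ≤ Cn * ENNReal.ofReal δ
      * (sqs (fun k => freqAbs k * mag3 m.u k) + sqs (fun k => wt k * mag3 m.w k) + sqs m.a) := by
    refine (sqs_mono fun k => ?_).trans hN
    gcongr
    exact m.mag3_N_le k
  have fN : sqs (fun k => (wt k : ℝ≥0∞)⁻¹ * mag3 m.N k) ≠ ∞ :=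
    ne_top_of_le_ne_top (by finiteness) fN'
  obtain ⟨sU, eU⟩ := summable_and_toReal_sqs (r := fun k => freqAbs k * nu k)
    (fun k => by positivity) (fun k => by
      rw [ENNReal.ofReal_mul (by positivity), ENNReal.ofReal_natCast, mag3_eq_ofReal]) fU
  obtain ⟨sW, eW⟩ := summable_and_toReal_sqs (r := fun k => wt k * nw k)
    (fun k => by positivity) (fun k => by
      rw [ENNReal.ofReal_mul (by positivity), ENNReal.ofReal_natCast, mag3_eq_ofReal]) fW
  obtain ⟨sa, ea⟩ := summable_and_toReal_sqs (r := fun k => ‖m.J 0 2 k‖ + ‖m.J 1 2 k‖)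
    (fun k => by positivity) (fun k => by
      rw [ENNReal.ofReal_add (norm_nonneg _) (norm_nonneg _), ofReal_norm, ofReal_norm]
      rfl) fa
  obtain ⟨sN, eN⟩ := summable_and_toReal_sqs (r := fun k => (wt k : ℝ)⁻¹ * nN k)
    (fun k => by positivity) (fun k => by
      rw [ENNReal.ofReal_mul (by positivity), ENNReal.ofReal_inv_of_pos
        (by exact_mod_cast one_le_wt k), ENNReal.ofReal_natCast, mag3_eq_ofReal]) fN
  have hsq : ∀ f : Freq → ℂ, sqs (fun k => (wt k : ℝ≥0∞) ^ 4 * mag f k) ≠ ∞ →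
      Summable fun k => ‖f k‖ ^ 2 := fun f hf => summable_sq_of_sqs (sqs_ne_top_of_wt hf)
  have sein : Summable ein := ((hsq _ (m.fin_w 0)).add (hsq _ (m.fin_w 1))).add
    ((hsq _ (m.fin_J 0 2)).add (hsq _ (m.fin_J 1 2)))
  have hNle : ∑' k, ((wt k : ℝ)⁻¹ * nN k) ^ 2 ≤ Cr * δ * (∑' k, (freqAbs k * nu k) ^ 2
      + ∑' k, (wt k * nw k) ^ 2 + ∑' k, (‖m.J 0 2 k‖ + ‖m.J 1 2 k‖) ^ 2) := by
    rw [← eN, ← eU, ← eW, ← ea]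
    have := ENNReal.toReal_mono (by finiteness) fN'
    rwa [ENNReal.toReal_mul, ENNReal.toReal_mul, ENNReal.toReal_ofReal hδ0.le,
      ENNReal.toReal_add (by finiteness) fa, ENNReal.toReal_add fU fW] at this
  have hale : ∑' k, (‖m.J 0 2 k‖ + ‖m.J 1 2 k‖) ^ 2 ≤ 2 * ∑' k, ein k := by
    rw [← tsum_mul_left]
    refine Summable.tsum_le_tsum (fun k => ?_) sa (sein.mul_left 2)
    simp only [hein]
    nlinarith [sq_nonneg (‖m.J 0 2 k‖ - ‖m.J 1 2 k‖), sq_nonneg ‖m.w 0 k‖, sq_nonneg ‖m.w 1 k‖]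
  set DU := ∑' k, (freqAbs k * nu k) ^ 2 with hDU
  set DW := ∑' k, (wt k * nw k) ^ 2 with hDW
  set SN := ∑' k, ((wt k : ℝ)⁻¹ * nN k) ^ 2 with hSN
  set Ein := ∑' k, ein k with hEin
  -- Half of the dissipation of ω pays for pairing ω in H¹ with N in H⁻¹; the other half stays
  -- available to absorb the bound on N.
  have hrate := m.energyRate_le hdis (V := fun _ => 1) (B := 1) (fun _ => le_rfl)
    (R := fun k => -c₁ * (freqAbs k * nu k) ^ 2 + -(c₁ / 2) * (wt k * nw k) ^ 2
      + 1 / (2 * c₁) * ((wt k : ℝ)⁻¹ * nN k) ^ 2 + C₀ / 2 * ein k)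
    ((((sU.mul_left _).add (sW.mul_left _)).add (sN.mul_left _)).add (sein.mul_left _)) ?_
  · rw [Summable.tsum_add (((sU.mul_left _).add (sW.mul_left _)).add (sN.mul_left _))
      (sein.mul_left _), Summable.tsum_add ((sU.mul_left _).add (sW.mul_left _)) (sN.mul_left _),
      Summable.tsum_add (sU.mul_left _) (sW.mul_left _), tsum_mul_left, tsum_mul_left,
      tsum_mul_left, tsum_mul_left, m.transportRate_one] at hrate
    have hcomm : m.commRate (fun _ => 1) = 0 := m.K_orth
    rw [hcomm] at hrate
    have hU0 : 0 ≤ DU := tsum_nonneg fun k => sq_nonneg _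
    have hW0 : 0 ≤ DW := tsum_nonneg fun k => sq_nonneg _
    have hE0 : 0 ≤ Ein := tsum_nonneg fun k => by positivity
    have h1 : SN ≤ c₁ ^ 2 * (DU + DW + 2 * Ein) := by
      refine hNle.trans ?_
      gcongr
    have h2 : 1 / (2 * c₁) * SN ≤ c₁ / 2 * (DU + DW + 2 * Ein) := by
      calc 1 / (2 * c₁) * SN ≤ 1 / (2 * c₁) * (c₁ ^ 2 * (DU + DW + 2 * Ein)) := by gcongr
        _ = _ := by field_simp
    have h3 : 0 ≤ c₁ * DU := by positivity
    nlinarith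
  · intro k
    have hwt : (0 : ℝ) < wt k := by exact_mod_cast one_le_wt k
    have h1 : nw k * nN k ≤ c₁ / 2 * (wt k * nw k) ^ 2
        + 1 / (2 * c₁) * ((wt k : ℝ)⁻¹ * nN k) ^ 2 := by
      have e : nw k * nN k = (wt k * nw k) * ((wt k : ℝ)⁻¹ * nN k) := by field_simp
      rw [e]
      set x := (wt k : ℝ) * nw k
      set y := (wt k : ℝ)⁻¹ * nN k
      have e2 : 0 ≤ 1 / (2 * c₁) * (c₁ * x - y) ^ 2 := by positivity
      have e3 : 1 / (2 * c₁) * (c₁ * x - y) ^ 2 = c₁ / 2 * x ^ 2 + 1 / (2 * c₁) * y ^ 2 - x * y := by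
        field_simp
        ring
      linarith
    have h2 : C₀ * (‖m.w 0 k‖ * ‖m.J 1 2 k‖ + ‖m.w 1 k‖ * ‖m.J 0 2 k‖) ≤ C₀ / 2 * ein k := by
      rw [div_mul_eq_mul_div, mul_div_assoc]
      gcongr
      simp only [hein]
      nlinarith [sq_nonneg (‖m.w 0 k‖ - ‖m.J 1 2 k‖), sq_nonneg (‖m.w 1 k‖ - ‖m.J 0 2 k‖)]
    have h3 : (wt k : ℝ) ^ 2 * (∑ i, ‖m.w i k‖) ^ 2 = (wt k * nw k) ^ 2 := by rw [mul_pow]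
    have h4 : (freqAbs k : ℝ) ^ 2 * (∑ i, ‖m.u i k‖) ^ 2 = (freqAbs k * nu k) ^ 2 := by
      rw [mul_pow]
    rw [h3, h4]
    simp only [Nat.cast_one, one_pow, one_mul]
    linarith

/-! ### The energy balance in H⁴ -/

lemma mag_trunc_mul_le (N : ℕ) (f : Freq → ℂ) (k : Freq) :
    mag (fun k => (((trunc N k ^ 4 : ℕ) : ℝ) : ℂ) * f k) k ≤ (wt k : ℝ≥0∞) ^ 4 * mag f k := by
  simp only [mag, enorm_mul]
  gcongr
  rw [← ofReal_norm, Complex.norm_real, Real.norm_natCast, ENNReal.ofReal_natCast]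
  exact_mod_cast Nat.pow_le_pow_left (trunc_le_wt N k) 4

/-- All four derivatives fall on one factor and the H³ norm of the other controls its ℓ¹ norm. The
bound is linear in the top-order quantity. -/
lemma sqs_wt_fourth_conv_le {f g : Freq → ℝ≥0∞} {h₃ h₄ : ℝ≥0∞}
    (f3 : sqs (fun k => (wt k : ℝ≥0∞) ^ 3 * f k) ≤ h₃)
    (g3 : sqs (fun k => (wt k : ℝ≥0∞) ^ 3 * g k) ≤ h₃)
    (f4 : sqs (fun k => (wt k : ℝ≥0∞) ^ 4 * f k) ≤ h₄)
    (g4 : sqs (fun k => (wt k : ℝ≥0∞) ^ 4 * g k) ≤ h₄) :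
    sqs (fun k => (wt k : ℝ≥0∞) ^ 4 * conv f g k) ≤ 256 * wienerConst * (h₃ * h₄) := by
  have h := sqs_weight_conv_le (v := fun k => (wt k : ℝ≥0∞) ^ 4)
    (v₁ := fun k => (wt k : ℝ≥0∞) ^ 4) (v₂ := fun k => (wt k : ℝ≥0∞) ^ 4) (K := 8)
    (fun k l => by exact_mod_cast wt_fourth_le k l) f g
  refine h.trans ?_
  have e1 := sq_tsum_le_of_sqs_le (n := 3) (by norm_num) f3
  have e2 := sq_tsum_le_of_sqs_le (n := 3) (by norm_num) g3
  calc _ ≤ 2 * 8 ^ 2 * (wienerConst * h₃ * h₄ + wienerConst * h₃ * h₄) := by gcongr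
    _ = _ := by ring

namespace ModeSystem

variable {c : Constants} {CQ : ℝ≥0∞} (m : ModeSystem c CQ)

/-- Bounds on the third and fourth order weighted norms of the unknowns. -/
structure Bounds (h₃ h₄ : ℝ) : Prop where
  u3 : sqs (fun k => (wt k : ℝ≥0∞) ^ 3 * mag3 m.u k) ≤ ENNReal.ofReal h₃
  w3 : sqs (fun k => (wt k : ℝ≥0∞) ^ 3 * mag3 m.w k) ≤ ENNReal.ofReal h₃
  J3 : sqs (fun k => (wt k : ℝ≥0∞) ^ 3 * mag9 m.J k) ≤ ENNReal.ofReal h₃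
  u4 : sqs (fun k => (wt k : ℝ≥0∞) ^ 4 * mag3 m.u k) ≤ ENNReal.ofReal h₄
  w4 : sqs (fun k => (wt k : ℝ≥0∞) ^ 4 * mag3 m.w k) ≤ ENNReal.ofReal h₄
  J4 : sqs (fun k => (wt k : ℝ≥0∞) ^ 4 * mag9 m.J k) ≤ ENNReal.ofReal h₄

variable {m}

/-- Young's inequality with parameter η: the product h₃h₄ is divided by η, and h₃ ≤ η² turns it back
into η h₄. In this way H³ smallness becomes a small coefficient in front of the H⁴ energy. -/
lemma abs_re_tsum_high_le {a b : Freq → ℂ} {h₃ h₄ η : ℝ} (hη : 0 < η) (h0 : 0 ≤ h₃)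
    (h04 : 0 ≤ h₄) (h3 : h₃ ≤ η ^ 2) (ha : sqs (mag a) ≤ ENNReal.ofReal h₄)
    (hb : sqs (mag b) ≤ 1024 * wienerConst * (ENNReal.ofReal h₃ * ENNReal.ofReal h₄)) :
    |(∑' k, conj (a k) * b k).re| ≤ (1 + 1024 * wienerConst.toReal) * (η * h₄) := by
  have hw := wienerConst_ne_top
  have hb' : sqs (mag b) ≤ ENNReal.ofReal (1024 * wienerConst.toReal * (h₃ * h₄)) := by
    rw [ENNReal.ofReal_mul (by positivity), ENNReal.ofReal_mul (by positivity),
      ENNReal.ofReal_mul h0, ENNReal.ofReal_toReal hw]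
    simpa using hb
  refine (abs_re_tsum_conj_mul_le hη ha hb' h04 (by positivity)).trans ?_
  have h1 : η⁻¹ * (1024 * wienerConst.toReal * (h₃ * h₄))
      ≤ 1024 * wienerConst.toReal * (η * h₄) := by
    calc _ ≤ η⁻¹ * (1024 * wienerConst.toReal * (η ^ 2 * h₄)) := by gcongr
      _ = _ := by field_simp
  have h2 : 0 ≤ η * h₄ := by positivity
  have h3 : 0 ≤ 1024 * wienerConst.toReal * (η * h₄) := by positivity
  linarith

lemma Bounds.abs_transport_le {h₃ h₄ η : ℝ} (hb : m.Bounds h₃ h₄) (hη : 0 < η) (h0 : 0 ≤ h₃)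
    (h04 : 0 ≤ h₄) (h3 : h₃ ≤ η ^ 2) (N : ℕ) {f : Freq → ℂ}
    (f3 : sqs (fun k => (wt k : ℝ≥0∞) ^ 3 * mag f k) ≤ ENNReal.ofReal h₃)
    (f4 : sqs (fun k => (wt k : ℝ≥0∞) ^ 4 * mag f k) ≤ ENNReal.ofReal h₄) :
    |pair (fun k => trunc N k ^ 4) f (transport m.u f)|
      ≤ (1 + 1024 * wienerConst.toReal) * (η * h₄) := by
  have ff : sqs (fun k => (wt k : ℝ≥0∞) ^ 4 * mag f k) ≠ ∞ :=
    ne_top_of_le_ne_top ENNReal.ofReal_ne_top f4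
  rw [m.pair_transport_eq (B := N ^ 4) (fun k => Nat.pow_le_pow_left (trunc_le N k) 4) ff]
  refine abs_re_tsum_high_le hη h0 h04 h3 ((sqs_mono (mag_trunc_mul_le N f)).trans f4) ?_
  have h := sqs_transportComm_le N (tsum_ne_top m.fin_mag3_u) (fin_wt ff)
  simp only [Nat.cast_pow]
  refine h.trans ?_
  have e3 := hb.u3
  have e4 := hb.u4
  calc _ ≤ 512 * wienerConst * (ENNReal.ofReal h₃ * ENNReal.ofReal h₄
        + ENNReal.ofReal h₃ * ENNReal.ofReal h₄) := by gcongr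
    _ = _ := by ring

lemma Bounds.abs_comm_le {h₃ h₄ η : ℝ} (hb : m.Bounds h₃ h₄) (hη : 0 < η) (h0 : 0 ≤ h₃)
    (h04 : 0 ≤ h₄) (h3 : h₃ ≤ η ^ 2) (N : ℕ) (i j : Fin 3) :
    |pair (fun k => trunc N k ^ 4) (m.J i j) (m.K i j)|
      ≤ (1 + 1024 * wienerConst.toReal) * (η * h₄) := by
  rw [pair_eq_re_tsum (B := N ^ 4) (fun k => Nat.pow_le_pow_left (trunc_le N k) 4)
    (sqs_ne_top_of_wt (m.fin_J i j)) (m.fin_K i j)]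
  refine abs_re_tsum_high_le hη h0 h04 h3 ?_ ?_
  · refine (sqs_mono fun k => ?_).trans hb.J4
    refine (mag_trunc_mul_le N _ k).trans ?_
    gcongr
    exact mag_le_mag9 m.J i j k
  · have h := sqs_wt_fourth_conv_le hb.w3 hb.J3 hb.w4 hb.J4
    calc _ ≤ sqs (fun k => 2 * ((wt k : ℝ≥0∞) ^ 4 * conv (mag3 m.w) (mag9 m.J) k)) := by
          refine sqs_mono fun k => (mag_trunc_mul_le N _ k).trans ?_
          rw [mul_left_comm]
          gcongr
          exact m.K_le i j k
      _ ≤ 2 ^ 2 * (256 * wienerConst * (ENNReal.ofReal h₃ * ENNReal.ofReal h₄)) := by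
          rw [sqs_const_mul]
          gcongr
      _ = _ := by ring

lemma Bounds.abs_commRate_le {h₃ h₄ η : ℝ} (hb : m.Bounds h₃ h₄) (hη : 0 < η) (h0 : 0 ≤ h₃)
    (h04 : 0 ≤ h₄) (h3 : h₃ ≤ η ^ 2) (N : ℕ) :
    |m.commRate (fun k => trunc N k ^ 4)| ≤ 9 * ((1 + 1024 * wienerConst.toReal) * (η * h₄)) := by
  rw [commRate]
  refine (Finset.abs_sum_le_sum_abs _ _).trans ?_
  refine (Finset.sum_le_sum fun i _ => (Finset.abs_sum_le_sum_abs _ _).trans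
    (Finset.sum_le_sum fun j _ => hb.abs_comm_le hη h0 h04 h3 N i j)).trans (le_of_eq ?_)
  simp only [Finset.sum_const, Finset.card_univ, Fintype.card_fin, nsmul_eq_mul]
  ring

lemma Bounds.abs_transportRate_le {h₃ h₄ η : ℝ} (hb : m.Bounds h₃ h₄) (hη : 0 < η) (h0 : 0 ≤ h₃)
    (h04 : 0 ≤ h₄) (h3 : h₃ ≤ η ^ 2) (N : ℕ) :
    |m.transportRate (fun k => trunc N k ^ 4)|
      ≤ (12 + ∑ i, |c.inertia i|) * ((1 + 1024 * wienerConst.toReal) * (η * h₄)) := by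
  set D := (1 + 1024 * wienerConst.toReal) * (η * h₄) with hD
  have mono3 : ∀ {n : ℕ} {F : Fin 3 → Freq → ℂ} {x : ℝ≥0∞} (i : Fin 3),
      sqs (fun k => (wt k : ℝ≥0∞) ^ n * mag3 F k) ≤ x →
      sqs (fun k => (wt k : ℝ≥0∞) ^ n * mag (F i) k) ≤ x := fun i h =>
    (sqs_mono fun k => by gcongr; exact mag_le_mag3 _ i k).trans h
  have mono9 : ∀ {n : ℕ} {F : Fin 3 → Fin 3 → Freq → ℂ} {x : ℝ≥0∞} (i j : Fin 3),
      sqs (fun k => (wt k : ℝ≥0∞) ^ n * mag9 F k) ≤ x →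
      sqs (fun k => (wt k : ℝ≥0∞) ^ n * mag (F i j) k) ≤ x := fun i j h =>
    (sqs_mono fun k => by gcongr; exact mag_le_mag9 _ i j k).trans h
  have hu := fun i => hb.abs_transport_le hη h0 h04 h3 N (mono3 i hb.u3) (mono3 i hb.u4)
  have hw := fun i => hb.abs_transport_le hη h0 h04 h3 N (mono3 i hb.w3) (mono3 i hb.w4)
  have hJ := fun i j => hb.abs_transport_le hη h0 h04 h3 N (mono9 i j hb.J3) (mono9 i j hb.J4)
  rw [transportRate]
  have e1 : |∑ i, pair (fun k => trunc N k ^ 4) (m.u i) (transport m.u (m.u i))| ≤ 3 * D :=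
    (Finset.abs_sum_le_sum_abs _ _).trans ((Finset.sum_le_sum fun i _ => hu i).trans (by simp [hD]))
  have e2 : |∑ i, c.inertia i * pair (fun k => trunc N k ^ 4) (m.w i) (transport m.u (m.w i))|
      ≤ (∑ i, |c.inertia i|) * D := by
    refine (Finset.abs_sum_le_sum_abs _ _).trans ?_
    rw [Finset.sum_mul]
    refine Finset.sum_le_sum fun i _ => ?_
    rw [abs_mul]
    gcongr
    exact hw i
  have e3 : |∑ i, ∑ j, pair (fun k => trunc N k ^ 4) (m.J i j) (transport m.u (m.J i j))|
      ≤ 9 * D := by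
    refine (Finset.abs_sum_le_sum_abs _ _).trans ?_
    refine (Finset.sum_le_sum fun i _ => (Finset.abs_sum_le_sum_abs _ _).trans
      (Finset.sum_le_sum fun j _ => hJ i j)).trans (le_of_eq ?_)
    simp only [Finset.sum_const, Finset.card_univ, Fintype.card_fin, nsmul_eq_mul, hD]
    ring
  refine (abs_add_three _ _ _).trans ?_
  linarith

end ModeSystem

set_option maxHeartbeats 800000 in
/-- The energy balance in `H⁴`, uniformly in the truncation. -/
lemma exists_energyRate_high {c : Constants} (hc : c.Admissible) {CQ : ℝ≥0∞} (hCQ : CQ ≠ ∞) :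
    ∃ δ : ℝ, 0 < δ ∧ ∃ C : ℝ, 0 < C ∧ ∀ (m : ModeSystem c CQ) (N : ℕ) (h₃ h₄ η : ℝ),
      m.Bounds h₃ h₄ → 0 ≤ h₃ → h₃ ≤ h₄ → h₄ ≤ δ → 0 < η → η ≤ 1 → h₃ ≤ η ^ 2 →
      m.energyRate (fun k => trunc N k ^ 4)
        ≤ C * (η * h₄ + (sqs (fun k => (wt k : ℝ≥0∞) ^ 3 * mag9 m.J k)).toReal) := by
  obtain ⟨c₁, hc₁, hdis⟩ := exists_dissipation hc
  obtain ⟨Cn, hCn, δn, hδn, hδn1, hnl⟩ := exists_nonlinear_estimate_high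
    (CR := ENNReal.ofReal c.linConst) (CA := ENNReal.ofReal c.invConst)
    ENNReal.ofReal_ne_top ENNReal.ofReal_ne_top hCQ
  set C₀ : ℝ := c.spin ^ 2 + 2 * |c.nu - c.lam| with hC₀
  have hC₀0 : 0 ≤ C₀ := by positivity
  have hδnt : δn ≠ ∞ := ne_top_of_le_ne_top ENNReal.one_ne_top hδn1
  set Cr := Cn.toReal with hCr
  have hCr0 : 0 ≤ Cr := ENNReal.toReal_nonneg
  set D := 1 + 1024 * wienerConst.toReal with hD
  have hD0 : 0 ≤ D := by positivity
  -- Nine commutator terms, and twelve transport terms for u and J besides the three for ω, which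
  -- carry the inertia.
  set Ct := 21 + ∑ i, |c.inertia i| with hCt
  have hCt0 : 0 ≤ Ct := by positivity
  refine ⟨min δn.toReal (c₁ ^ 2 / (2 * (Cr + 1))),
    lt_min (ENNReal.toReal_pos hδn hδnt) (by positivity),
    Ct * D + Cr / c₁ + C₀ ^ 2 / c₁ + 1, by positivity, fun m N h₃ h₄ η hb h0 h34 h4 hη hη1 h3 => ?_⟩
  have h04 : 0 ≤ h₄ := h0.trans h34
  have hδ1 : ENNReal.ofReal h₄ ≤ δn := by
    refine (ENNReal.ofReal_le_ofReal (h4.trans (min_le_left _ _))).trans ?_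
    rw [ENNReal.ofReal_toReal hδnt]
  have hδ2 : Cr * h₃ ≤ c₁ ^ 2 / 2 := by
    have h1 : h₃ ≤ c₁ ^ 2 / (2 * (Cr + 1)) := h34.trans (h4.trans (min_le_right _ _))
    rw [le_div_iff₀ (by positivity)] at h1
    linarith
  have hN := hnl N (mag3 m.u) (mag3 m.w) (mag9 m.J) m.a (mag3 m.G) (mag3 m.Q)
    (ENNReal.ofReal h₃) (ENNReal.ofReal h₄) m.mag3_G_le m.Q_le m.a_le m.fin_mag3_G hb.u4
    hb.w3 hb.w4 hb.J3 hb.J4 (ENNReal.ofReal_le_ofReal h34) hδ1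
  set nw : Freq → ℝ := fun k => ∑ i, ‖m.w i k‖ with hnw
  set nN : Freq → ℝ := fun k => ∑ i, ‖m.N i k‖ with hnN
  set nJ : Freq → ℝ := fun k => ‖m.J 0 2 k‖ + ‖m.J 1 2 k‖ with hnJ
  set X : Freq → ℝ := fun k => (trunc N k : ℝ) ^ 4 / wt k with hX
  have hX0 : ∀ k, 0 ≤ X k := fun k => by positivity
  have hXd : ∀ k, ENNReal.ofReal (X k) = dualWt N k := by
    intro k
    have hwt : (0 : ℝ) < wt k := by exact_mod_cast one_le_wt k
    rw [dualWt, hX, ENNReal.ofReal_div_of_pos hwt, ENNReal.ofReal_pow (by positivity),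
      ENNReal.ofReal_natCast, ENNReal.ofReal_natCast]
  have fW : sqs (fun k => (trunc N k : ℝ≥0∞) ^ 4 * (wt k * mag3 m.w k)) ≠ ∞ := by
    have h1 : sqs (fun k => (N : ℝ≥0∞) ^ 4 * ((wt k : ℝ≥0∞) ^ 4 * mag3 m.w k)) ≠ ∞ := by
      rw [sqs_const_mul]
      exact ENNReal.mul_ne_top (by finiteness) m.fin_mag3_w
    refine ne_top_of_le_ne_top h1 (sqs_mono fun k => ?_)
    gcongr
    · exact trunc_le N k
    · have : wt k ≤ wt k ^ 4 := Nat.le_self_pow (by norm_num) _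
      exact_mod_cast this
  have fJ3 : sqs (fun k => (wt k : ℝ≥0∞) ^ 3 * mag9 m.J k) ≠ ∞ :=
    ne_top_of_le_ne_top ENNReal.ofReal_ne_top hb.J3
  have fa' : sqs (fun k => dualWt N k * m.a k) ≤ sqs (fun k => (wt k : ℝ≥0∞) ^ 3 * mag9 m.J k) :=
    sqs_mono fun k => mul_le_mul' (dualWt_le N k) (m.a_le k)
  have fa : sqs (fun k => dualWt N k * m.a k) ≠ ∞ := ne_top_of_le_ne_top fJ3 fa'
  have fN' : sqs (fun k => dualWt N k * mag3 m.N k) ≤ Cn * ENNReal.ofReal h₃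
      * (sqs (fun k => (trunc N k : ℝ≥0∞) ^ 4 * (wt k * mag3 m.w k)) + ENNReal.ofReal h₄) := by
    refine (sqs_mono fun k => ?_).trans hN
    gcongr
    exact m.mag3_N_le k
  have fN : sqs (fun k => dualWt N k * mag3 m.N k) ≠ ∞ :=
    ne_top_of_le_ne_top (by finiteness) fN'
  obtain ⟨sW, eW⟩ := summable_and_toReal_sqs (r := fun k => (trunc N k : ℝ) ^ 4 * (wt k * nw k))
    (fun k => by positivity) (fun k => by
      rw [ENNReal.ofReal_mul (by positivity), ENNReal.ofReal_mul (by positivity),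
        ENNReal.ofReal_pow (by positivity), ENNReal.ofReal_natCast, ENNReal.ofReal_natCast,
        mag3_eq_ofReal]) fW
  obtain ⟨sa, ea⟩ := summable_and_toReal_sqs (r := fun k => X k * nJ k)
    (fun k => by positivity) (fun k => by
      rw [ENNReal.ofReal_mul (hX0 k), hXd, hnJ, ENNReal.ofReal_add (norm_nonneg _) (norm_nonneg _),
        ofReal_norm, ofReal_norm]
      rfl) fa
  obtain ⟨sN, eN⟩ := summable_and_toReal_sqs (r := fun k => X k * nN k)
    (fun k => by positivity) (fun k => by
      rw [ENNReal.ofReal_mul (hX0 k), hXd, mag3_eq_ofReal]) fN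
  have hNle : ∑' k, (X k * nN k) ^ 2 ≤ Cr * h₃ * (∑' k, ((trunc N k : ℝ) ^ 4 * (wt k * nw k)) ^ 2
      + h₄) := by
    rw [← eN, ← eW]
    have := ENNReal.toReal_mono (by finiteness) fN'
    rwa [ENNReal.toReal_mul, ENNReal.toReal_mul, ENNReal.toReal_ofReal h0,
      ENNReal.toReal_add fW (by finiteness), ENNReal.toReal_ofReal h04] at this
  have hale : ∑' k, (X k * nJ k) ^ 2
      ≤ (sqs (fun k => (wt k : ℝ≥0∞) ^ 3 * mag9 m.J k)).toReal := by
    rw [← ea]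
    exact ENNReal.toReal_mono fJ3 fa'
  set SJ := (sqs (fun k => (wt k : ℝ≥0∞) ^ 3 * mag9 m.J k)).toReal with hSJ
  have hSJ0 : 0 ≤ SJ := ENNReal.toReal_nonneg
  set DW := ∑' k, ((trunc N k : ℝ) ^ 4 * (wt k * nw k)) ^ 2 with hDW
  set SN := ∑' k, (X k * nN k) ^ 2 with hSN
  set Sa := ∑' k, (X k * nJ k) ^ 2 with hSa
  -- The dissipation of u is discarded. Of that of ω, one quarter pays for the pairing with N, one
  -- quarter for the coupling with J, and the remaining half absorbs the bound on N.
  have hrate := m.energyRate_le hdis (V := fun k => trunc N k ^ 4) (B := N ^ 4)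
    (fun k => Nat.pow_le_pow_left (trunc_le N k) 4)
    (R := fun k => -(c₁ / 2) * ((trunc N k : ℝ) ^ 4 * (wt k * nw k)) ^ 2
      + 1 / c₁ * (X k * nN k) ^ 2 + C₀ ^ 2 / c₁ * (X k * nJ k) ^ 2)
    (((sW.mul_left _).add (sN.mul_left _)).add (sa.mul_left _)) ?_
  · rw [Summable.tsum_add ((sW.mul_left _).add (sN.mul_left _)) (sa.mul_left _),
      Summable.tsum_add (sW.mul_left _) (sN.mul_left _), tsum_mul_left, tsum_mul_left,
      tsum_mul_left] at hrate
    have hW0 : 0 ≤ DW := tsum_nonneg fun k => sq_nonneg _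
    -- The smallness of h₃ is used twice: as Cr h₃ ≤ c₁²/2 in front of the dissipation, and as h₃ ≤
    -- η² ≤ η in front of h₄.
    have h1 : 1 / c₁ * SN ≤ c₁ / 2 * DW + Cr / c₁ * (η * h₄) := by
      calc 1 / c₁ * SN ≤ 1 / c₁ * (Cr * h₃ * (DW + h₄)) := by gcongr
        _ = 1 / c₁ * (Cr * h₃) * DW + 1 / c₁ * (Cr * (h₃ * h₄)) := by ring
        _ ≤ 1 / c₁ * (c₁ ^ 2 / 2) * DW + 1 / c₁ * (Cr * (η * h₄)) := by
            have : h₃ ≤ η := h3.trans (by nlinarith)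
            gcongr
        _ = _ := by field_simp
    have h2 : C₀ ^ 2 / c₁ * Sa ≤ C₀ ^ 2 / c₁ * SJ := by gcongr
    have e1 := (abs_le.mp (hb.abs_commRate_le hη h0 h04 h3 N)).2
    have e2 := (abs_le.mp (hb.abs_transportRate_le hη h0 h04 h3 N)).1
    rw [← hD] at e1 e2
    have e3 : 0 ≤ η * h₄ := by positivity
    have e4 : 0 ≤ Ct * D * SJ := by positivity
    have e5 : 0 ≤ Cr / c₁ * SJ := by positivity
    have e6 : 0 ≤ C₀ ^ 2 / c₁ * (η * h₄) := by positivity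
    have e7 : Ct * D * (η * h₄) = 9 * (D * (η * h₄)) + (12 + ∑ i, |c.inertia i|) * (D * (η * h₄)) := by
      rw [hCt]; ring
    have e8 : (Ct * D + Cr / c₁ + C₀ ^ 2 / c₁ + 1) * (η * h₄ + SJ)
        = Ct * D * (η * h₄) + Cr / c₁ * (η * h₄) + C₀ ^ 2 / c₁ * (η * h₄) + η * h₄
          + Ct * D * SJ + Cr / c₁ * SJ + C₀ ^ 2 / c₁ * SJ + SJ := by ring
    rw [e8]
    linarith
  · intro k
    have hwt : (0 : ℝ) < wt k := by exact_mod_cast one_le_wt k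
    have young : ∀ x y : ℝ, x * y ≤ c₁ / 4 * x ^ 2 + 1 / c₁ * y ^ 2 := by
      intro x y
      have e2 : 0 ≤ 1 / c₁ * (c₁ / 2 * x - y) ^ 2 := by positivity
      have e3 : 1 / c₁ * (c₁ / 2 * x - y) ^ 2 = c₁ / 4 * x ^ 2 + 1 / c₁ * y ^ 2 - x * y := by
        field_simp
        ring
      linarith
    set V : ℝ := (trunc N k : ℝ) ^ 4 with hVd
    have hV0 : 0 ≤ V := by positivity
    have hVX : V = X k * wt k := by simp only [hX, hVd]; field_simp
    have h1 : V ^ 2 * (nw k * nN k) ≤ c₁ / 4 * (V * (wt k * nw k)) ^ 2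
        + 1 / c₁ * (X k * nN k) ^ 2 := by
      have e : V ^ 2 * (nw k * nN k) = (V * (wt k * nw k)) * (X k * nN k) := by rw [hVX]; ring
      rw [e]
      exact young _ _
    -- Splitting V² as (V·wt)(V/wt) spends the extra derivative of ω on J, which is then needed only
    -- with the dual weight, hence in H³.
    have h2 : V ^ 2 * (C₀ * (‖m.w 0 k‖ * ‖m.J 1 2 k‖ + ‖m.w 1 k‖ * ‖m.J 0 2 k‖))
        ≤ c₁ / 4 * (V * (wt k * nw k)) ^ 2 + C₀ ^ 2 / c₁ * (X k * nJ k) ^ 2 := by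
      have e1 : ‖m.w 0 k‖ * ‖m.J 1 2 k‖ + ‖m.w 1 k‖ * ‖m.J 0 2 k‖ ≤ nw k * nJ k := by
        simp only [hnw, hnJ, Fin.sum_univ_three]
        have e : (‖m.w 0 k‖ + ‖m.w 1 k‖ + ‖m.w 2 k‖) * (‖m.J 0 2 k‖ + ‖m.J 1 2 k‖)
            = ‖m.w 0 k‖ * ‖m.J 1 2 k‖ + ‖m.w 1 k‖ * ‖m.J 0 2 k‖ + (‖m.w 0 k‖ * ‖m.J 0 2 k‖
              + ‖m.w 1 k‖ * ‖m.J 1 2 k‖ + ‖m.w 2 k‖ * (‖m.J 0 2 k‖ + ‖m.J 1 2 k‖)) := by ring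
        rw [e]
        exact le_add_of_nonneg_right (by positivity)
      calc _ ≤ V ^ 2 * (C₀ * (nw k * nJ k)) := by gcongr
        _ = (V * (wt k * nw k)) * (C₀ * (X k * nJ k)) := by rw [hVX]; ring
        _ ≤ c₁ / 4 * (V * (wt k * nw k)) ^ 2 + 1 / c₁ * (C₀ * (X k * nJ k)) ^ 2 := young _ _
        _ = _ := by ring
    have h3 : 0 ≤ V ^ 2 * (c₁ * ((freqAbs k : ℝ) ^ 2 * (∑ i, ‖m.u i k‖) ^ 2)) := by positivity
    have h4 : V ^ 2 * (c₁ * ((wt k : ℝ) ^ 2 * nw k ^ 2)) = c₁ * (V * (wt k * nw k)) ^ 2 := by ring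
    push_cast
    rw [← hVd]
    linarith

/-! ### Fourier coefficients of products of square-integrable functions -/

lemma fc_toLp {f : T3 → ℝ} (hf : MemLp f 2) (k : Freq) : fc (hf.toLp f) k = fc f k :=
  fc_congr hf.coeFn_toLp k

lemma fc_mul {f g : T3 → ℝ} (hf : MemLp f 2) (hg : MemLp g 2) (k : Freq) :
    fc (fun x => f x * g x) k = cconv (fc f) (fc g) k := by
  have h := (hasSum_fc_mul (hf.toLp f) (hg.toLp g) k).tsum_eq
  simp only [fc_toLp] at h
  rw [cconv, h]
  refine fc_congr ?_ k
  filter_upwards [hf.coeFn_toLp, hg.coeFn_toLp] with x h1 h2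
  rw [h1, h2]

lemma L2.memLp (f : L2) : MemLp f 2 := Lp.memLp f

lemma sqs_fc_ne_top {f : T3 → ℝ} (hf : MemLp f 2) : sqs (mag (fc f)) ≠ ∞ := by
  refine sqs_mag_ne_top_of_summable ?_
  have h := (hasSum_norm_sq_fc (hf.toLp f)).summable.mul_left torusVol⁻¹
  refine h.congr fun k => ?_
  rw [fc_toLp, ← mul_assoc, inv_mul_cancel₀ torusVol_pos.ne', one_mul]

lemma pair_one_fc {f g : T3 → ℝ} (hf : MemLp f 2) (hg : MemLp g 2) :
    torusVol * pair (fun _ => 1) (fc f) (fc g) = ∫ x, f x * g x := by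
  have h := (Complex.hasSum_re (hasSum_parseval (hf.toLp f) (hg.toLp g))).tsum_eq
  rw [Complex.ofReal_re] at h
  have e : ∫ x, (hf.toLp f) x * (hg.toLp g) x = ∫ x, f x * g x := by
    refine integral_congr_ae ?_
    filter_upwards [hf.coeFn_toLp, hg.coeFn_toLp] with x h1 h2
    rw [h1, h2]
  rw [← e, ← h, pair, ← tsum_mul_left]
  refine tsum_congr fun k => ?_
  rw [fc_toLp, fc_toLp, Complex.re_ofReal_mul]
  simp

lemma MemLp.integrable_two {f : T3 → ℝ} (hf : MemLp f 2) : Integrable f :=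
  hf.integrable (by norm_num)

lemma memLp_bdd_mul {f g : T3 → ℝ} {B : ℝ} (hf : AEStronglyMeasurable f)
    (hB : ∀ᵐ x, |f x| ≤ B) (hg : MemLp g 2) : MemLp (fun x => f x * g x) 2 := by
  refine MemLp.of_le_mul (c := B) hg (hf.mul hg.1) ?_
  filter_upwards [hB] with x hx
  rw [norm_mul]
  gcongr
  exact hx

lemma fc_coe_add (f g : L2) (k : Freq) : fc (f + g : L2) k = fc f k + fc g k := by
  rw [fc_congr (Lp.coeFn_add f g) k]
  exact fc_add f.integrable g.integrable k

lemma fc_coe_sub (f g : L2) (k : Freq) : fc (f - g : L2) k = fc f k - fc g k := by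
  rw [fc_congr (Lp.coeFn_sub f g) k]
  exact fc_sub f.integrable g.integrable k

lemma fc_coe_zero (k : Freq) : fc (0 : L2) k = 0 := by
  have h := fc_coe_sub 0 0 k
  simpa using h

lemma fc_coe_sum {ι : Type*} (s : Finset ι) (f : ι → L2) (k : Freq) :
    fc (∑ i ∈ s, f i : L2) k = ∑ i ∈ s, fc (f i) k := by
  classical
  induction s using Finset.induction_on with
  | empty => simpa using fc_coe_zero k
  | insert a s ha ih => rw [Finset.sum_insert ha, fc_coe_add, ih, Finset.sum_insert ha]

lemma fc_coe_smul (a : ℝ) (f : L2) (k : Freq) : fc (a • f : L2) k = a * fc f k := by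
  rw [fc_congr (Lp.coeFn_smul a f) k]
  exact fc_const_mul a f k

/-! ### Sobolev norms in Fourier variables -/

/-- The constant is 2048 = 4⁴·8, from `wt`² ≤ 4(1 + q) and (1 + q)⁴ ≤ 8(1 + q⁴) with q = |k|². -/
lemma wt_pow_le_symbolH (k : Freq) : (wt k : ℝ) ^ 8 ≤ 2048 * symbolH 4 k := by
  have h1 : (wt k : ℝ) ^ 2 ≤ 4 * (1 + ∑ j, (k j : ℝ) ^ 2) := by
    simpa [Fin.sum_univ_three] using wt_sq_le k
  have h0 : 0 ≤ ∑ j, (k j : ℝ) ^ 2 := by positivity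
  simp only [symbolH]
  set q := ∑ j, (k j : ℝ) ^ 2
  calc (wt k : ℝ) ^ 8 = ((wt k : ℝ) ^ 2) ^ 4 := by ring
    _ ≤ (4 * (1 + q)) ^ 4 := by gcongr
    _ = 256 * (1 + q) ^ 4 := by ring
    _ ≤ 256 * (8 * (1 + q ^ 4)) := by
        gcongr
        have := add_pow_le (zero_le_one (α := ℝ)) h0 4
        norm_num at this
        linarith
    _ ≤ _ := by
        have h2 : 0 ≤ q ^ 2 := by positivity
        have h3 : 0 ≤ q ^ 3 := by positivity
        linarith

lemma symbolH_le_wt_pow (k : Freq) : symbolH 4 k ≤ (wt k : ℝ) ^ 8 := by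
  have h0 : 0 ≤ ∑ j, (k j : ℝ) ^ 2 := by positivity
  have h1 : 1 + ∑ j, (k j : ℝ) ^ 2 ≤ (wt k : ℝ) ^ 2 := by
    simp only [wt, Fin.sum_univ_three]
    push_cast
    simp only [Nat.cast_natAbs, Int.cast_abs]
    have e : ∀ i, ((k i : ℝ)) ^ 2 = |(k i : ℝ)| ^ 2 := fun i => (sq_abs _).symm
    rw [e 0, e 1, e 2]
    have h0 := abs_nonneg (k 0 : ℝ)
    have h1 := abs_nonneg (k 1 : ℝ)
    have h2 := abs_nonneg (k 2 : ℝ)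
    nlinarith [mul_nonneg h0 h1, mul_nonneg h0 h2, mul_nonneg h1 h2]
  simp only [symbolH]
  set q := ∑ j, (k j : ℝ) ^ 2
  calc _ ≤ (1 + q) ^ 4 := by
        have h2 : 0 ≤ q ^ 2 := by positivity
        have h3 : 0 ≤ q ^ 3 := by positivity
        nlinarith
    _ ≤ ((wt k : ℝ) ^ 2) ^ 4 := by gcongr
    _ = _ := by ring

lemma sqs_wt_eq_tsum (n : ℕ) (f : Freq → ℂ) : sqs (fun k => (wt k : ℝ≥0∞) ^ n * mag f k)
    = ∑' k, ENNReal.ofReal ((wt k : ℝ) ^ (2 * n) * ‖f k‖ ^ 2) := by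
  refine tsum_congr fun k => ?_
  rw [ENNReal.ofReal_mul (by positivity), ENNReal.ofReal_pow (by positivity),
    ENNReal.ofReal_natCast, ENNReal.ofReal_pow (norm_nonneg _), ofReal_norm]
  simp only [mag]
  ring

lemma MemH.sqs_wt_le {f : L2} (hf : MemH 4 f) :
    sqs (fun k => (wt k : ℝ≥0∞) ^ 4 * mag (fc f) k)
      ≤ ENNReal.ofReal (2048 / torusVol * normSqH 4 f) := by
  have hv := torusVol_pos
  have h := hf.hasSum_normSqH.mul_left (2048 / torusVol)
  rw [sqs_wt_eq_tsum, ← h.tsum_eq, ENNReal.ofReal_tsum_of_nonneg _ h.summable]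
  · refine ENNReal.tsum_le_tsum fun k => ENNReal.ofReal_le_ofReal ?_
    have e : 2048 / torusVol * (torusVol * (symbolH 4 k * ‖fc f k‖ ^ 2))
        = 2048 * symbolH 4 k * ‖fc f k‖ ^ 2 := by field_simp
    rw [e]
    gcongr
    exact wt_pow_le_symbolH k
  · intro k
    have := (pow_nonneg (Nat.cast_nonneg (α := ℝ) (wt k)) 8).trans (wt_pow_le_symbolH k)
    have : 0 ≤ symbolH 4 k := by linarith
    positivity

lemma MemH.normSqH_le {f : L2} (hf : MemH 4 f) {h : ℝ} (h0 : 0 ≤ h)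
    (hle : sqs (fun k => (wt k : ℝ≥0∞) ^ 4 * mag (fc f) k) ≤ ENNReal.ofReal h) :
    normSqH 4 f ≤ torusVol * h := by
  have hv := torusVol_pos
  have hs := hf.hasSum_normSqH
  rw [sqs_wt_eq_tsum] at hle
  have hsum : Summable fun k => (wt k : ℝ) ^ (2 * 4) * ‖fc f k‖ ^ 2 := by
    have := ENNReal.summable_toReal (ne_top_of_le_ne_top ENNReal.ofReal_ne_top hle)
    refine this.congr fun k => ENNReal.toReal_ofReal (by positivity)
  rw [← ENNReal.ofReal_tsum_of_nonneg (fun k => by positivity) hsum,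
    ENNReal.ofReal_le_ofReal_iff h0] at hle
  rw [← hs.tsum_eq]
  calc ∑' k, torusVol * (symbolH 4 k * ‖fc f k‖ ^ 2)
      ≤ ∑' k, torusVol * ((wt k : ℝ) ^ (2 * 4) * ‖fc f k‖ ^ 2) := by
        refine Summable.tsum_le_tsum (fun k => ?_) hs.summable (hsum.mul_left _)
        gcongr
        exact symbolH_le_wt_pow k
    _ ≤ torusVol * h := by
        rw [tsum_mul_left]
        gcongr

lemma sqs_mag_fc (f : L2) : sqs (mag (fc f)) = ENNReal.ofReal (torusVol⁻¹ * ‖f‖ ^ 2) := by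
  have h := (hasSum_norm_sq_fc f).mul_left torusVol⁻¹
  rw [← h.tsum_eq, ENNReal.ofReal_tsum_of_nonneg _ h.summable]
  · refine tsum_congr fun k => ?_
    rw [← mul_assoc, inv_mul_cancel₀ torusVol_pos.ne', one_mul, ENNReal.ofReal_pow (norm_nonneg _),
      ofReal_norm, mag]
  · intro k
    have := torusVol_pos
    positivity

lemma normSqH_nonneg : ∀ (m : ℕ) (f : L2), 0 ≤ normSqH m f := by
  intro m
  induction m with
  | zero => intro f; exact sq_nonneg _
  | succ m ih => intro f; exact add_nonneg (sq_nonneg _) (Finset.sum_nonneg fun j _ => ih _)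

/-- Sobolev's inequality. -/
lemma ae_abs_le_of_sqs_le {f : L2} {h : ℝ} (h0 : 0 ≤ h)
    (hle : sqs (fun k => (wt k : ℝ≥0∞) ^ 4 * mag (fc f) k) ≤ ENNReal.ofReal h) :
    ∀ᵐ x, |f x| ≤ √(wienerConst.toReal * h) := by
  have h1 := sq_tsum_le_of_sqs_le (n := 4) (by norm_num) hle
  have hw := wienerConst_ne_top
  have h2 : (∑' k, mag (fc f) k) ≠ ∞ := by
    intro h3
    rw [h3] at h1
    refine ENNReal.mul_ne_top hw (ENNReal.ofReal_ne_top (r := h)) ?_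
    simpa using h1
  have h3 : Summable fun k => ‖fc f k‖ :=
    (ENNReal.summable_toReal h2).congr fun k => by simp [mag]
  filter_upwards [ae_abs_le_tsum_norm_fc f h3] with x hx
  refine hx.trans (Real.le_sqrt_of_sq_le ?_)
  have h4 : (∑' k, mag (fc f) k).toReal = ∑' k, ‖fc f k‖ := by
    rw [ENNReal.tsum_toReal_eq (fun k => by simp [mag])]
    simp [mag]
  rw [← h4, ← ENNReal.toReal_pow]
  have := ENNReal.toReal_mono (by finiteness) h1
  rwa [ENNReal.toReal_mul, ENNReal.toReal_ofReal h0] at this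

/-! ### The equations at a point -/

lemma Constants.Jeq_eq (c : Constants) : c.Jeq = Matrix.diagonal c.inertia := rfl

lemma Constants.Admissible.Jeq_inv {c : Constants} (hc : c.Admissible) :
    c.Jeq⁻¹ = Matrix.diagonal fun i => (c.inertia i)⁻¹ := by
  rw [c.Jeq_eq]
  refine Matrix.inv_eq_right_inv ?_
  rw [Matrix.diagonal_mul_diagonal, ← Matrix.diagonal_one]
  congr 1
  ext i
  exact mul_inv_cancel₀ (hc.inertia_pos i).ne'

lemma State.relJ_apply {c : Constants} (hc : c.Admissible) (Z : State) (x : T3) (i j : Fin 3) :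
    Z.relJ c x i j = Z.J i j x * (c.inertia j)⁻¹ := by
  rw [State.relJ, hc.Jeq_inv, Matrix.mul_diagonal]
  rfl

/-- Strict diagonal dominance: the absolute row sums of J J_eq⁻¹ stay below 1. -/
lemma State.isUnit_one_add_relJ {c : Constants} (hc : c.Admissible) {Z : State} {x : T3} {ε : ℝ}
    (hε : ε * c.invConst < 1) (hJ : ∀ i j, |Z.J i j x| ≤ ε) : IsUnit (1 + Z.relJ c x).det := by
  rw [isUnit_iff_ne_zero]
  refine det_ne_zero_of_sum_row_lt_diag fun i => ?_
  have h1 : ∑ j, |Z.relJ c x i j| ≤ ε * c.invConst := by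
    rw [Constants.invConst, Finset.mul_sum]
    refine Finset.sum_le_sum fun j _ => ?_
    rw [State.relJ_apply hc, abs_mul]
    gcongr
    exact hJ i j
  have h2 : ∑ j ∈ Finset.univ.erase i, ‖(1 + Z.relJ c x) i j‖
      = ∑ j ∈ Finset.univ.erase i, |Z.relJ c x i j| := by
    refine Finset.sum_congr rfl fun j hj => ?_
    rw [Matrix.add_apply, Matrix.one_apply_ne (Finset.ne_of_mem_erase hj).symm, zero_add,
      Real.norm_eq_abs]
  rw [h2, Matrix.add_apply, Matrix.one_apply_eq, Real.norm_eq_abs]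
  have h3 := Finset.add_sum_erase Finset.univ (fun j => |Z.relJ c x i j|) (Finset.mem_univ i)
  have h4 : 1 - |Z.relJ c x i i| ≤ |1 + Z.relJ c x i i| := by
    have h5 := neg_abs_le (Z.relJ c x i i)
    have h6 := le_abs_self (1 + Z.relJ c x i i)
    linarith
  linarith

/-- Since A m = 1 - m, the equation reads g + adv = m(F - Q), and multiplying by 1 + A removes the
inverse. No Sobolev estimate for the matrix inverse is needed afterwards. -/
lemma resolvent_identity {A m : Matrix (Fin 3) (Fin 3) ℝ} (hm : (1 + A) * m = 1)
    {g adv F Q : Fin 3 → ℝ} (h : g = F + (-adv - m *ᵥ Q - (A * m) *ᵥ F)) :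
    (1 + A) *ᵥ (g + adv) = F - Q := by
  have h1 : A * m = 1 - m := by
    rw [add_mul, one_mul] at hm
    rw [← hm]
    abel
  have h2 : g + adv = m *ᵥ (F - Q) := by
    rw [h, h1, Matrix.sub_mulVec, Matrix.one_mulVec, Matrix.mulVec_sub]
    abel
  rw [h2, Matrix.mulVec_mulVec, hm, Matrix.one_mulVec]

/-- The inertial term `J_eq (∂ₜω + (u·∇)ω)`. -/
def inertialTerm (c : Constants) (Z : State) (ωt : Fin 3 → L2) (i : Fin 3) (x : T3) : ℝ :=
  c.inertia i * (ωt i x + advect Z.u (Z.ω i) x)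

lemma inertialTerm_eq {c : Constants} (hc : c.Admissible) {Z : State} {ωt : Fin 3 → L2} {x : T3}
    (hdet : IsUnit (1 + Z.relJ c x).det)
    (h : c.Jeq *ᵥ vecAt ωt x = Z.linω c x + Z.N₂ c x) (i : Fin 3) :
    inertialTerm c Z ωt i x + ∑ j, (c.inertia j)⁻¹ * (Z.J i j x * inertialTerm c Z ωt j x)
      = Z.stress c x i - Z.linPrec c x i - Z.nonlinPrec c x i := by
  have hm : (1 + Z.relJ c x) * Z.mJ c x = 1 := Matrix.mul_nonsing_inv _ hdet
  have h1 := resolvent_identity hm (F := Z.linω c x) (Q := Z.nonlinPrec c x) h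
  have h2 : c.Jeq *ᵥ vecAt ωt x + c.Jeq *ᵥ (fun i => advect Z.u (Z.ω i) x)
      = fun i => inertialTerm c Z ωt i x := by
    ext i
    rw [Pi.add_apply, c.Jeq_eq, Matrix.mulVec_diagonal, Matrix.mulVec_diagonal, inertialTerm,
      mul_add]
    rfl
  rw [h2] at h1
  have h3 := congrFun h1 i
  rw [Matrix.add_mulVec, Matrix.one_mulVec, Pi.add_apply, Pi.sub_apply] at h3
  rw [State.linω, Pi.sub_apply] at h3
  rw [← h3]
  congr 1
  simp only [Matrix.mulVec, dotProduct]
  refine Finset.sum_congr rfl fun j _ => ?_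
  rw [State.relJ_apply hc]
  ring

/-- The product `J ω`. -/
def angMom (Z : State) (i : Fin 3) (x : T3) : ℝ := ∑ j, Z.J i j x * Z.ω j x

lemma Jeq_mulVec (c : Constants) (v : Fin 3 → ℝ) : c.Jeq *ᵥ v = fun i => c.inertia i * v i := by
  ext i
  rw [c.Jeq_eq, Matrix.mulVec_diagonal]

lemma matAt_mulVec_ωeq (c : Constants) (Z : State) (x : T3) :
    matAt Z.J x *ᵥ c.ωeq = fun i => Z.J i 2 x * c.spin := by
  ext i
  rw [Matrix.mulVec, dotProduct, Fin.sum_univ_three]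
  have h0 : c.ωeq 0 = 0 := rfl
  have h1 : c.ωeq 1 = 0 := rfl
  have h2 : c.ωeq 2 = c.spin := rfl
  rw [h0, h1, h2, mul_zero, mul_zero, zero_add, zero_add]
  rfl

lemma matAt_mulVec_vecAt (Z : State) (x : T3) :
    matAt Z.J x *ᵥ vecAt Z.ω x = fun i => angMom Z i x := rfl

/-- J acts on ω_eq through its third column, and the cross product with e₃ discards the vertical
entry, so only J₁₃ and J₂₃ feel the precession. -/
lemma linPrec_eq (c : Constants) (Z : State) (x : T3) :
    Z.linPrec c x = ![(c.spin * (c.nu - c.lam)) * Z.ω 1 x - c.spin ^ 2 * Z.J 1 2 x,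
      -((c.spin * (c.nu - c.lam)) * Z.ω 0 x) + c.spin ^ 2 * Z.J 0 2 x, 0] := by
  have h0 : c.ωeq = ![0, 0, c.spin] := rfl
  rw [State.linPrec, Jeq_mulVec, Jeq_mulVec, matAt_mulVec_ωeq, h0]
  ext i
  fin_cases i <;> simp [cross_apply, vecAt, Constants.inertia] <;> ring

lemma nonlinPrec_eq (c : Constants) (Z : State) (x : T3) :
    Z.nonlinPrec c x =
      ![Z.ω 1 x * angMom Z 2 x - Z.ω 2 x * angMom Z 1 x - c.spin * angMom Z 1 x
          + (c.nu - c.lam) * (Z.ω 1 x * Z.ω 2 x) + c.spin * (Z.ω 1 x * Z.J 2 2 x)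
          - c.spin * (Z.ω 2 x * Z.J 1 2 x),
        Z.ω 2 x * angMom Z 0 x - Z.ω 0 x * angMom Z 2 x + c.spin * angMom Z 0 x
          + (c.lam - c.nu) * (Z.ω 0 x * Z.ω 2 x) + c.spin * (Z.ω 2 x * Z.J 0 2 x)
          - c.spin * (Z.ω 0 x * Z.J 2 2 x),
        Z.ω 0 x * angMom Z 1 x - Z.ω 1 x * angMom Z 0 x
          + c.spin * (Z.ω 0 x * Z.J 1 2 x) - c.spin * (Z.ω 1 x * Z.J 0 2 x)] := by
  have h0 : c.ωeq = ![0, 0, c.spin] := rfl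
  rw [State.nonlinPrec, Jeq_mulVec, matAt_mulVec_ωeq, matAt_mulVec_vecAt, h0]
  ext i
  fin_cases i <;> simp [cross_apply, vecAt, Constants.inertia] <;> ring

/-- The entries of the commutator `[Ω, J]`. -/
def commTerm (Z : State) (i j : Fin 3) (x : T3) : ℝ :=
  ∑ p, (skew (vecAt Z.ω x) i p * Z.J p j x - Z.J i p x * skew (vecAt Z.ω x) p j)

lemma linJ_add_N₃_apply (c : Constants) (Z : State) (x : T3) (i j : Fin 3) :
    (Z.linJ c x + Z.N₃ x) i j
      = ∑ p, (skew c.ωeq i p * Z.J p j x - skew c.ωeq p j * Z.J i p x)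
        + (c.inertia j - c.inertia i) * skew (vecAt Z.ω x) i j + commTerm Z i j x
        - advect Z.u (Z.J i j) x := by
  simp only [State.linJ, State.N₃, comm, c.Jeq_eq, Matrix.add_apply, Matrix.sub_apply]
  rw [Matrix.mul_diagonal, Matrix.diagonal_mul]
  simp only [Matrix.mul_apply, commTerm, matAt, Matrix.of_apply,
    Finset.sum_sub_distrib]
  have e : ∀ p, skew c.ωeq p j * Z.J i p x = Z.J i p x * skew c.ωeq p j := fun p => mul_comm _ _
  simp only [e]
  ring

/-- The sum is tr(Ω J Jᵀ) - tr(Jᵀ J Ω), and each trace pairs an antisymmetric matrix with a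
symmetric one. -/
lemma sum_mul_commTerm (Z : State) (x : T3) : ∑ i, ∑ j, Z.J i j x * commTerm Z i j x = 0 := by
  simp only [commTerm, skew, Fin.sum_univ_three]
  simp
  ring

/-- The function is essentially bounded. -/
def EssBdd (f : T3 → ℝ) : Prop := AEStronglyMeasurable f ∧ ∃ B : ℝ, ∀ᵐ x, |f x| ≤ B

lemma EssBdd.mul_memLp {f g : T3 → ℝ} (hf : EssBdd f) (hg : MemLp g 2) :
    MemLp (fun x => f x * g x) 2 := by
  obtain ⟨h, B, hB⟩ := hf
  exact memLp_bdd_mul h hB hg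

lemma MemH.essBdd {f : L2} (hf : MemH 4 f) : EssBdd f :=
  ⟨Lp.aestronglyMeasurable f, _, ae_abs_le_of_sqs_le
    (mul_nonneg (div_nonneg (by norm_num) torusVol_pos.le) (normSqH_nonneg 4 f)) hf.sqs_wt_le⟩

/-! ### Differential operators in Fourier variables -/

lemma fc_lap {v : Fin 3 → L2} (hv : ∀ i, MemH 4 (v i)) (i : Fin 3) (k : Freq) :
    fc (lap v i) k = lapMode k (fun j => fc (v j) k) i := by
  rw [lap, fc_coe_sum, lapMode]
  refine Finset.sum_congr rfl fun j _ => ?_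
  rw [MemH.fc_wd ((hv i).memH_wd j), (hv i).fc_wd]

lemma fc_curl {v : Fin 3 → L2} (hv : ∀ i, MemH 4 (v i)) (i : Fin 3) (k : Freq) :
    fc (curl v i) k = curlMode k (fun j => fc (v j) k) i := by
  fin_cases i
  · exact (fc_coe_sub _ _ k).trans (by rw [(hv 2).fc_wd, (hv 1).fc_wd]; rfl)
  · exact (fc_coe_sub _ _ k).trans (by rw [(hv 0).fc_wd, (hv 2).fc_wd]; rfl)
  · exact (fc_coe_sub _ _ k).trans (by rw [(hv 1).fc_wd, (hv 0).fc_wd]; rfl)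

lemma fc_div {v : Fin 3 → L2} (hv : ∀ i, MemH 4 (v i)) (k : Freq) :
    fc (div v) k = ∑ j, Complex.I * k j * fc (v j) k := by
  rw [div, fc_coe_sum]
  exact Finset.sum_congr rfl fun j _ => (hv j).fc_wd j k

lemma memH_div {v : Fin 3 → L2} (hv : ∀ i, MemH 4 (v i)) : MemH 3 (div v) := by
  rw [div, Fin.sum_univ_three]
  exact (((hv 0).memH_wd 0).add ((hv 1).memH_wd 1)).add ((hv 2).memH_wd 2)

lemma fc_advect {u : Fin 3 → L2} {f : L2} (hf : MemH 4 f) (k : Freq) :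
    fc (advect u f) k = transport (fun j => fc (u j)) (fc f) k := by
  have h : advect u f = fun x => ∑ j, u j x * wd j f x := rfl
  rw [h, fc_sum _ fun j _ => (u j).integrable_mul (wd j f), transport]
  refine Finset.sum_congr rfl fun j _ => ?_
  rw [fc_mul (u j).memLp (wd j f).memLp]
  congr 1
  ext l
  exact hf.fc_wd j l

lemma memLp_advect {u : Fin 3 → L2} (hu : ∀ i, MemH 4 (u i)) (f : L2) : MemLp (advect u f) 2 := by
  have h : advect u f = fun x => ∑ j, u j x * wd j f x := rfl
  rw [h]
  exact memLp_finsetSum _ fun j _ => (hu j).essBdd.mul_memLp (wd j f).memLp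

/-! ### Bounds for products -/

/-- The Fourier coefficients of an integrable function are dominated by a sequence. -/
def FcLe (f : T3 → ℝ) (b : Freq → ℝ≥0∞) : Prop := Integrable f ∧ ∀ k, mag (fc f) k ≤ b k

lemma FcLe.add {f g : T3 → ℝ} {a b : Freq → ℝ≥0∞} (hf : FcLe f a) (hg : FcLe g b) :
    FcLe (fun x => f x + g x) (fun k => a k + b k) := by
  refine ⟨hf.1.add hg.1, fun k => ?_⟩
  rw [mag, fc_add hf.1 hg.1]
  exact (enorm_add_le _ _).trans (add_le_add (hf.2 k) (hg.2 k))

lemma FcLe.const_mul {f : T3 → ℝ} {a : Freq → ℝ≥0∞} (hf : FcLe f a) (r : ℝ) :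
    FcLe (fun x => r * f x) (fun k => ENNReal.ofReal |r| * a k) := by
  refine ⟨hf.1.const_mul r, fun k => ?_⟩
  rw [mag, fc_const_mul, enorm_mul, ← ofReal_norm (r : ℂ), Complex.norm_real, Real.norm_eq_abs]
  exact mul_le_mul' le_rfl (hf.2 k)

lemma FcLe.sub {f g : T3 → ℝ} {a b : Freq → ℝ≥0∞} (hf : FcLe f a) (hg : FcLe g b) :
    FcLe (fun x => f x - g x) (fun k => a k + b k) := by
  refine ⟨hf.1.sub hg.1, fun k => ?_⟩
  rw [mag, fc_sub hf.1 hg.1]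
  exact enorm_sub_le.trans (add_le_add (hf.2 k) (hg.2 k))

lemma FcLe.mono {f : T3 → ℝ} {a b : Freq → ℝ≥0∞} (hf : FcLe f a) (h : ∀ k, a k ≤ b k) :
    FcLe f b := ⟨hf.1, fun k => (hf.2 k).trans (h k)⟩

lemma fcLe_mul {f g : T3 → ℝ} (hf : MemLp f 2) (hg : MemLp g 2) {a b : Freq → ℝ≥0∞}
    (ha : ∀ k, mag (fc f) k ≤ a k) (hb : ∀ k, mag (fc g) k ≤ b k) :
    FcLe (fun x => f x * g x) (conv a b) := by
  refine ⟨hf.integrable_mul hg, fun k => ?_⟩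
  rw [mag, fc_mul hf hg]
  exact (mag_cconv_le _ _ k).trans (conv_mono ha hb k)

lemma conv_finset_sum_left {ι : Type*} (s : Finset ι) (f : ι → Freq → ℝ≥0∞) (g : Freq → ℝ≥0∞)
    (k : Freq) : ∑ i ∈ s, conv (f i) g k = conv (fun k => ∑ i ∈ s, f i k) g k := by
  simp only [conv, Finset.sum_mul]
  rw [Summable.tsum_finsetSum fun _ _ => ENNReal.summable]

lemma FcLe.sum {ι : Type*} (s : Finset ι) {f : ι → T3 → ℝ} {a : ι → Freq → ℝ≥0∞}
    (h : ∀ i ∈ s, FcLe (f i) (a i)) :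
    FcLe (fun x => ∑ i ∈ s, f i x) (fun k => ∑ i ∈ s, a i k) := by
  refine ⟨integrable_finsetSum _ fun i hi => (h i hi).1, fun k => ?_⟩
  rw [mag, fc_sum _ fun i hi => (h i hi).1]
  exact (enorm_sum_le _ _).trans (Finset.sum_le_sum fun i hi => (h i hi).2 k)

section Fields

variable {Z : State}

lemma fcLe_angMom (Z : State) (i : Fin 3) : FcLe (angMom Z i)
    (conv (mag9 fun i j => fc (Z.J i j)) (mag3 fun i => fc (Z.ω i))) := by
  have h : angMom Z i = fun x => ∑ j, Z.J i j x * Z.ω j x := rfl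
  rw [h]
  refine (FcLe.sum _ fun j _ => fcLe_mul (Z.J i j).memLp (Z.ω j).memLp (fun k => le_rfl)
    (mag_le_mag3 (fun i => fc (Z.ω i)) j)).mono fun k => ?_
  rw [conv_finset_sum_left]
  refine conv_mono (fun k => ?_) (fun _ => le_rfl) k
  exact Finset.single_le_sum (f := fun i => ∑ j, mag (fc (Z.J i j)) k) (fun _ _ => zero_le)
    (Finset.mem_univ i)

lemma memLp_angMom (hZ : Z.MemH 4) (i : Fin 3) : MemLp (angMom Z i) 2 := by
  have h : angMom Z i = fun x => ∑ j, Z.J i j x * Z.ω j x := rfl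
  rw [h]
  exact memLp_finsetSum _ fun j _ => (hZ.2.2 i j).essBdd.mul_memLp (Z.ω j).memLp

/-- The constant in the bound for the nonlinear precession. -/
def Constants.precConst (c : Constants) : ℝ≥0∞ :=
  18 * ENNReal.ofReal (1 + |c.nu - c.lam| + |c.spin|)

/-- Each component has at most six monomials, each dominated by the same sum of convolutions times
the largest coefficient. Summing the three components gives the 18 in `precConst`. -/
lemma fcLe_nonlinPrec (c : Constants) (hZ : Z.MemH 4) (i : Fin 3) :
    FcLe (fun x => Z.nonlinPrec c x i) (fun k =>
      6 * (ENNReal.ofReal (1 + |c.nu - c.lam| + |c.spin|)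
        * (conv (mag3 fun i => fc (Z.ω i)) (mag3 fun i => fc (Z.ω i)) k
          + conv (mag9 fun i j => fc (Z.J i j)) (mag3 fun i => fc (Z.ω i)) k
          + conv (mag3 fun i => fc (Z.ω i)) (conv (mag9 fun i j => fc (Z.J i j))
              (mag3 fun i => fc (Z.ω i))) k))) := by
  set W := mag3 fun i => fc (Z.ω i) with hW
  set J := mag9 fun i j => fc (Z.J i j) with hJ
  set S : Freq → ℝ≥0∞ := fun k => conv W W k + conv J W k + conv W (conv J W) k with hS
  set M := ENNReal.ofReal (1 + |c.nu - c.lam| + |c.spin|) with hM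
  have M1 : 1 ≤ M := by
    rw [hM, ← ENNReal.ofReal_one]
    refine ENNReal.ofReal_le_ofReal ?_
    have := abs_nonneg (c.nu - c.lam)
    have := abs_nonneg c.spin
    linarith
  have M2 : ENNReal.ofReal |c.spin| ≤ M := by
    refine ENNReal.ofReal_le_ofReal ?_
    have := abs_nonneg (c.nu - c.lam)
    linarith
  have M3 : ENNReal.ofReal |c.nu - c.lam| ≤ M := by
    refine ENNReal.ofReal_le_ofReal ?_
    have := abs_nonneg c.spin
    linarith
  have M4 : ENNReal.ofReal |c.lam - c.nu| ≤ M := by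
    rw [abs_sub_comm]
    exact M3
  have tWH : ∀ a b, FcLe (fun x => Z.ω a x * angMom Z b x) (fun k => M * S k) := fun a b =>
    (fcLe_mul (Z.ω a).memLp (memLp_angMom hZ b) (mag_le_mag3 (fun i => fc (Z.ω i)) a)
      (fcLe_angMom Z b).2).mono fun k => by
        calc _ ≤ 1 * S k := by rw [one_mul]; exact le_add_self
          _ ≤ _ := by gcongr
  have tH : ∀ b, FcLe (fun x => c.spin * angMom Z b x) (fun k => M * S k) := fun b =>
    ((fcLe_angMom Z b).const_mul c.spin).mono fun k => by
      gcongr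
      exact le_add_self.trans (le_add_right le_rfl)
  have tWW : ∀ r a b, ENNReal.ofReal |r| ≤ M →
      FcLe (fun x => r * (Z.ω a x * Z.ω b x)) (fun k => M * S k) := fun r a b hr =>
    ((fcLe_mul (Z.ω a).memLp (Z.ω b).memLp (mag_le_mag3 (fun i => fc (Z.ω i)) a)
      (mag_le_mag3 (fun i => fc (Z.ω i)) b)).const_mul r).mono fun k => by
        gcongr
        exact (le_add_right le_rfl).trans (le_add_right le_rfl)
  have tWJ : ∀ a b d, FcLe (fun x => c.spin * (Z.ω a x * Z.J b d x)) (fun k => M * S k) :=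
    fun a b d =>
    ((fcLe_mul (Z.ω a).memLp (Z.J b d).memLp (mag_le_mag3 (fun i => fc (Z.ω i)) a)
      (mag_le_mag9 (fun i j => fc (Z.J i j)) b d)).const_mul c.spin).mono fun k => by
        rw [conv_comm]
        gcongr
        exact le_add_self.trans (le_add_right le_rfl)
  have six : ∀ y : ℝ≥0∞, y + y + y + y + y + y ≤ 6 * y := fun y => le_of_eq (by ring)
  have four : ∀ y : ℝ≥0∞, y + y + y + y ≤ 6 * y := fun y => by
    calc y + y + y + y = 4 * y := by ring
      _ ≤ 6 * y := by gcongr; norm_num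
  fin_cases i
  · simp only [nonlinPrec_eq]
    exact ((((((tWH 1 2).sub (tWH 2 1)).sub (tH 1)).add (tWW _ 1 2 M3)).add (tWJ 1 2 2)).sub
      (tWJ 2 1 2)).mono fun k => six _
  · simp only [nonlinPrec_eq]
    exact ((((((tWH 2 0).sub (tWH 0 2)).add (tH 0)).add (tWW _ 0 2 M4)).add (tWJ 2 0 2)).sub
      (tWJ 0 2 2)).mono fun k => six _
  · simp only [nonlinPrec_eq]
    exact ((((tWH 0 1).sub (tWH 1 0)).add (tWJ 0 1 2)).sub (tWJ 1 0 2)).mono fun k => four _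

/-- The entries of the antisymmetric matrix `Ω`. -/
def skewTerm (Z : State) (i j : Fin 3) (x : T3) : ℝ := skew (vecAt Z.ω x) i j

lemma skewTerm_cases {P : (T3 → ℝ) → Prop} (h0 : P fun _ => 0) (hω : ∀ a, P (Z.ω a))
    (hn : ∀ a, P fun x => -Z.ω a x) (i j : Fin 3) : P (skewTerm Z i j) := by
  fin_cases i <;> fin_cases j
  · exact h0
  · exact hn 2
  · exact hω 1
  · exact hω 2
  · exact h0
  · exact hn 0
  · exact hn 1
  · exact hω 0
  · exact h0

lemma memLp_skewTerm (Z : State) (i j : Fin 3) : MemLp (skewTerm Z i j) 2 :=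
  skewTerm_cases (P := fun f => MemLp f 2) MemLp.zero' (fun a => (Z.ω a).memLp)
    (fun a => (Z.ω a).memLp.neg) i j

lemma fc_zero_fun (k : Freq) : fc (fun _ => 0) k = 0 := by simp [fc]

lemma fc_skewTerm (Z : State) (i j : Fin 3) (k : Freq) :
    fc (skewTerm Z i j) k = skewMode (fun a => fc (Z.ω a) k) i j := by
  fin_cases i <;> fin_cases j
  · exact fc_zero_fun k
  · exact fc_neg _ k
  · rfl
  · rfl
  · exact fc_zero_fun k
  · exact fc_neg _ k
  · exact fc_neg _ k
  · rfl
  · exact fc_zero_fun k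

/-- A row of Ω contains two different components of ω and a zero, so no component is counted twice.
-/
lemma sum_mag_skewTerm_le (Z : State) (i : Fin 3) (k : Freq) :
    ∑ p, mag (fc (skewTerm Z i p)) k ≤ mag3 (fun a => fc (Z.ω a)) k := by
  have e : ∀ p, mag (fc (skewTerm Z i p)) k = ‖skewMode (fun a => fc (Z.ω a) k) i p‖ₑ := fun p => by
    rw [mag, fc_skewTerm]
  rw [Finset.sum_congr rfl fun p _ => e p]
  simp only [mag3, mag, Fin.sum_univ_three]
  fin_cases i <;> simp [skewMode]
  · rw [add_comm (‖fc (Z.ω 2) k‖ₑ), add_assoc]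
    exact le_add_self
  · rw [add_comm (‖fc (Z.ω 2) k‖ₑ)]
    gcongr
    exact le_add_right le_rfl
  · rw [add_comm (‖fc (Z.ω 1) k‖ₑ)]
    exact le_add_right le_rfl

lemma mag_skewTerm_swap (Z : State) (i j : Fin 3) (k : Freq) :
    mag (fc (skewTerm Z i j)) k = mag (fc (skewTerm Z j i)) k := by
  rw [mag, mag, fc_skewTerm, fc_skewTerm]
  fin_cases i <;> fin_cases j <;> simp [skewMode]

lemma commTerm_eq (Z : State) (i j : Fin 3) : commTerm Z i j = fun x =>
    ∑ p, (skewTerm Z i p x * Z.J p j x - skewTerm Z p j x * Z.J i p x) := by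
  ext x
  simp only [commTerm, skewTerm]
  exact Finset.sum_congr rfl fun p _ => by ring

lemma memLp_commTerm (hZ : Z.MemH 4) (i j : Fin 3) : MemLp (commTerm Z i j) 2 := by
  rw [commTerm_eq]
  refine memLp_finsetSum _ fun p _ => MemLp.sub ?_ ?_
  · simpa only [mul_comm] using (hZ.2.2 p j).essBdd.mul_memLp (memLp_skewTerm Z i p)
  · simpa only [mul_comm] using (hZ.2.2 i p).essBdd.mul_memLp (memLp_skewTerm Z p j)

lemma fcLe_commTerm (Z : State) (i j : Fin 3) : FcLe (commTerm Z i j)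
    (fun k => 2 * conv (mag3 fun i => fc (Z.ω i)) (mag9 fun i j => fc (Z.J i j)) k) := by
  rw [commTerm_eq]
  set J := mag9 fun i j => fc (Z.J i j) with hJ
  refine (FcLe.sum _ fun p _ => (fcLe_mul (memLp_skewTerm Z i p) (Z.J p j).memLp
    (fun k => le_rfl) (mag_le_mag9 (fun i j => fc (Z.J i j)) p j)).sub
    (fcLe_mul (memLp_skewTerm Z p j) (Z.J i p).memLp (fun k => (mag_skewTerm_swap Z p j k).le)
      (mag_le_mag9 (fun i j => fc (Z.J i j)) i p))).mono fun k => ?_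
  rw [Finset.sum_add_distrib, conv_finset_sum_left, conv_finset_sum_left]
  refine le_of_le_of_eq ?_ (two_mul (conv (mag3 fun i => fc (Z.ω i)) J k)).symm
  exact add_le_add (conv_mono (sum_mag_skewTerm_le Z i) (fun _ => le_rfl) k)
    (conv_mono (sum_mag_skewTerm_le Z j) (fun _ => le_rfl) k)

end Fields

/-! ### From the equations at a fixed time to a mode system -/

section Modes

variable {c : Constants} {Z : State}

lemma integrable_fun_sub {f g : T3 → ℝ} (hf : Integrable f) (hg : Integrable g) :
    Integrable fun x => f x - g x := hf.sub hg

lemma memLp_inertialTerm (hZ : Z.MemH 4) (ωt : Fin 3 → L2) (i : Fin 3) :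
    MemLp (inertialTerm c Z ωt i) 2 :=
  ((ωt i).memLp.add (memLp_advect hZ.1 (Z.ω i))).const_mul (c.inertia i)

lemma integrable_advect (hZ : Z.MemH 4) (f : L2) : Integrable (advect Z.u f) :=
  MemLp.integrable_two (memLp_advect hZ.1 f)

lemma fc_linU (hZ : Z.MemH 4) {p : L2} (hp : MemH 1 p) {ut : Fin 3 → L2}
    (h : ∀ᵐ x : T3, vecAt ut x = Z.linU c x - vecAt (grad p) x + Z.N₁ x) (i : Fin 3) (k : Freq) :
    fc (ut i) k = c.μt * lapMode k (fun j => fc (Z.u j) k) i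
      + c.κ * curlMode k (fun j => fc (Z.ω j) k) i - Complex.I * k i * fc p k
      - transport (fun j => fc (Z.u j)) (fc (Z.u i)) k := by
  have e : (ut i : T3 → ℝ) =ᵐ[volume] fun x => c.μt * lap Z.u i x + c.κ * curl Z.ω i x
      - wd i p x - advect Z.u (Z.u i) x := by
    filter_upwards [h] with x hx
    exact (congrFun hx i).trans (sub_eq_add_neg _ _).symm
  have i1 : Integrable fun x => c.μt * lap Z.u i x := (lap Z.u i).integrable.const_mul _
  have i2 : Integrable fun x => c.κ * curl Z.ω i x := (curl Z.ω i).integrable.const_mul _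
  rw [fc_congr e, fc_sub (integrable_fun_sub (i1.fun_add i2) (wd i p).integrable) (integrable_advect hZ _),
    fc_sub (i1.fun_add i2) (wd i p).integrable, fc_add i1 i2, fc_const_mul, fc_const_mul,
    fc_lap hZ.1, fc_curl hZ.2.1, fc_advect (hZ.1 i), hp.fc_wd]

lemma fc_inertialTerm (hZ : Z.MemH 4) (ωt : Fin 3 → L2) (i : Fin 3) (k : Freq) :
    (c.inertia i : ℂ) * fc (ωt i) k = fc (inertialTerm c Z ωt i) k
      - c.inertia i * transport (fun j => fc (Z.u j)) (fc (Z.ω i)) k := by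
  have h : inertialTerm c Z ωt i
      = fun x => c.inertia i * (ωt i x + advect Z.u (Z.ω i) x) := rfl
  rw [h, fc_const_mul, fc_add (ωt i).integrable (integrable_advect hZ _), fc_advect (hZ.2.1 i)]
  ring

lemma fc_stress (hZ : Z.MemH 4) (i : Fin 3) (k : Freq) :
    Integrable (fun x => Z.stress c x i) ∧ fc (fun x => Z.stress c x i) k
      = stressMode c k (fun j => fc (Z.u j) k) (fun j => fc (Z.ω j) k) i := by
  have e : (fun x => Z.stress c x i) = fun x => c.κ * curl Z.u i x - (2 * c.κ) * Z.ω i x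
      + (c.αt - c.γt) * wd i (div Z.ω) x + c.γt * lap Z.ω i x := rfl
  have i1 : Integrable fun x => c.κ * curl Z.u i x := (curl Z.u i).integrable.const_mul _
  have i2 : Integrable fun x => (2 * c.κ) * Z.ω i x := (Z.ω i).integrable.const_mul _
  have i3 : Integrable fun x => (c.αt - c.γt) * wd i (div Z.ω) x :=
    (wd i (div Z.ω)).integrable.const_mul _
  have i4 : Integrable fun x => c.γt * lap Z.ω i x := (lap Z.ω i).integrable.const_mul _
  rw [e]
  refine ⟨((integrable_fun_sub i1 i2).fun_add i3).add i4, ?_⟩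
  rw [fc_add ((integrable_fun_sub i1 i2).fun_add i3) i4, fc_add (integrable_fun_sub i1 i2) i3, fc_sub i1 i2, fc_const_mul,
    fc_const_mul, fc_const_mul, fc_const_mul, fc_curl hZ.1, fc_lap hZ.2.1,
    (memH_div hZ.2.1).fc_wd, fc_div hZ.2.1]
  rfl

lemma fc_linPrec (c : Constants) (Z : State) (i : Fin 3) (k : Freq) :
    Integrable (fun x => Z.linPrec c x i) ∧ fc (fun x => Z.linPrec c x i) k
      = precMode c (fun j => fc (Z.ω j) k) (fun i j => fc (Z.J i j) k) i := by
  simp only [linPrec_eq]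
  have iω : ∀ (r : ℝ) (a : Fin 3), Integrable fun x => r * Z.ω a x := fun r a =>
    (Z.ω a).integrable.const_mul r
  have iJ : ∀ (r : ℝ) (a b : Fin 3), Integrable fun x => r * Z.J a b x := fun r a b =>
    (Z.J a b).integrable.const_mul r
  fin_cases i
  · refine ⟨(iω _ 1).sub (iJ _ 1 2), ?_⟩
    exact (fc_sub (iω _ 1) (iJ _ 1 2) k).trans (by rw [fc_const_mul, fc_const_mul]; rfl)
  · refine ⟨(iω _ 0).neg.add (iJ _ 0 2), ?_⟩
    exact (fc_add (iω _ 0).neg (iJ _ 0 2) k).trans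
      (by rw [fc_const_mul]; erw [fc_neg]; rw [fc_const_mul]; rfl)
  · exact ⟨integrable_zero _ _ _, fc_zero_fun k⟩

lemma fc_inertialTerm_eq (hZ : Z.MemH 4) {ωt : Fin 3 → L2}
    (h : ∀ᵐ x : T3, ∀ i, inertialTerm c Z ωt i x
      + ∑ j, (c.inertia j)⁻¹ * (Z.J i j x * inertialTerm c Z ωt j x)
      = Z.stress c x i - Z.linPrec c x i - Z.nonlinPrec c x i) (i : Fin 3) (k : Freq) :
    fc (inertialTerm c Z ωt i) k
      + ∑ j, ((c.inertia j)⁻¹ : ℝ) * cconv (fc (Z.J i j)) (fc (inertialTerm c Z ωt j)) k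
    = stressMode c k (fun j => fc (Z.u j) k) (fun j => fc (Z.ω j) k) i
      - precMode c (fun j => fc (Z.ω j) k) (fun i j => fc (Z.J i j) k) i
      - fc (fun x => Z.nonlinPrec c x i) k := by
  have hG := fun j => memLp_inertialTerm (c := c) hZ ωt j
  have i1 : ∀ j, Integrable fun x => (c.inertia j)⁻¹ * (Z.J i j x * inertialTerm c Z ωt j x) :=
    fun j => ((Z.J i j).memLp.integrable_mul (hG j)).const_mul _
  obtain ⟨s1, s2⟩ := fc_stress (c := c) hZ i k
  obtain ⟨p1, p2⟩ := fc_linPrec c Z i k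
  rw [← s2, ← p2, ← fc_sub s1 p1, ← fc_sub (integrable_fun_sub s1 p1) (fcLe_nonlinPrec c hZ i).1]
  have e : (fun x => Z.stress c x i - Z.linPrec c x i - Z.nonlinPrec c x i) =ᵐ[volume]
      fun x => inertialTerm c Z ωt i x
        + ∑ j, (c.inertia j)⁻¹ * (Z.J i j x * inertialTerm c Z ωt j x) := by
    filter_upwards [h] with x hx
    exact (hx i).symm
  rw [fc_congr e, fc_add (MemLp.integrable_two (hG i)) (integrable_finsetSum _ fun j _ => i1 j),
    fc_sum _ fun j _ => i1 j]
  congr 1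
  refine Finset.sum_congr rfl fun j _ => ?_
  rw [fc_const_mul, fc_mul (Z.J i j).memLp (hG j)]

lemma fc_linJ (hZ : Z.MemH 4) {Jt : Fin 3 → Fin 3 → L2}
    (h : ∀ᵐ x : T3, matAt Jt x = Z.linJ c x + Z.N₃ x) (i j : Fin 3) (k : Freq) :
    fc (Jt i j) k = inertiaMode c (fun j => fc (Z.ω j) k) (fun i j => fc (Z.J i j) k) i j
      + fc (commTerm Z i j) k - transport (fun j => fc (Z.u j)) (fc (Z.J i j)) k := by
  have e : (Jt i j : T3 → ℝ) =ᵐ[volume] fun x =>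
      ∑ p, (skew c.ωeq i p * Z.J p j x - skew c.ωeq p j * Z.J i p x)
        + (c.inertia j - c.inertia i) * skewTerm Z i j x + commTerm Z i j x
        - advect Z.u (Z.J i j) x := by
    filter_upwards [h] with x hx
    exact (congrFun (congrFun hx i) j).trans (linJ_add_N₃_apply c Z x i j)
  have i0 : ∀ (r : ℝ) (a b : Fin 3), Integrable fun x => r * Z.J a b x := fun r a b =>
    (Z.J a b).integrable.const_mul r
  have i1 : Integrable fun x => ∑ p, (skew c.ωeq i p * Z.J p j x - skew c.ωeq p j * Z.J i p x) :=
    integrable_finsetSum _ fun p _ => integrable_fun_sub (i0 _ p j) (i0 _ i p)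
  have i2 : Integrable fun x => (c.inertia j - c.inertia i) * skewTerm Z i j x :=
    (MemLp.integrable_two (memLp_skewTerm Z i j)).const_mul _
  have i3 := (fcLe_commTerm Z i j).1
  rw [fc_congr e, fc_sub ((i1.fun_add i2).fun_add i3) (integrable_advect hZ _), fc_add (i1.fun_add i2) i3,
    fc_add i1 i2, fc_sum _ fun p _ => integrable_fun_sub (i0 _ p j) (i0 _ i p), fc_const_mul,
    fc_skewTerm, fc_advect (hZ.2.2 i j), inertiaMode]
  congr 4
  ext p
  rw [fc_sub (i0 _ p j) (i0 _ i p), fc_const_mul, fc_const_mul]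
  ring

/-- With weight one, Parseval turns the pointwise orthogonality of J and [Ω, J] into orthogonality
of the coefficients. -/
lemma sum_pair_commTerm (hZ : Z.MemH 4) :
    ∑ i, ∑ j, pair (fun _ => 1) (fc (Z.J i j)) (fc (commTerm Z i j)) = 0 := by
  have h1 : ∀ i j, torusVol * pair (fun _ => 1) (fc (Z.J i j)) (fc (commTerm Z i j))
      = ∫ x, Z.J i j x * commTerm Z i j x := fun i j =>
    pair_one_fc (Z.J i j).memLp (memLp_commTerm hZ i j)
  have i1 : ∀ i j, Integrable fun x => Z.J i j x * commTerm Z i j x := fun i j =>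
    (Z.J i j).memLp.integrable_mul (memLp_commTerm hZ i j)
  have h2 : torusVol * ∑ i, ∑ j, pair (fun _ => 1) (fc (Z.J i j)) (fc (commTerm Z i j)) = 0 := by
    simp only [Finset.mul_sum, h1]
    have h3 : ∀ i, ∑ j, ∫ x, Z.J i j x * commTerm Z i j x
        = ∫ x, ∑ j, Z.J i j x * commTerm Z i j x := fun i =>
      (integral_finsetSum _ fun j _ => i1 i j).symm
    rw [Finset.sum_congr rfl fun i _ => h3 i,
      ← integral_finsetSum _ fun i _ => integrable_finsetSum _ fun j _ => i1 i j]
    simp only [sum_mul_commTerm, integral_zero]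
  exact (mul_eq_zero.mp h2).resolve_left (ne_of_gt torusVol_pos)

/-- The Fourier coefficients of a solution at a fixed time. -/
def modeSystem (hZ : Z.MemH 4) (hsymm : ∀ i j, Z.J i j = Z.J j i) {p : L2} (hp : MemH 1 p)
    (hdiv : div Z.u = 0) {ut ωt : Fin 3 → L2} {Jt : Fin 3 → Fin 3 → L2}
    (hu : ∀ᵐ x : T3, vecAt ut x = Z.linU c x - vecAt (grad p) x + Z.N₁ x)
    (hω : ∀ᵐ x : T3, ∀ i, inertialTerm c Z ωt i x
      + ∑ j, (c.inertia j)⁻¹ * (Z.J i j x * inertialTerm c Z ωt j x)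
      = Z.stress c x i - Z.linPrec c x i - Z.nonlinPrec c x i)
    (hJ : ∀ᵐ x : T3, matAt Jt x = Z.linJ c x + Z.N₃ x) : ModeSystem c c.precConst where
  u i := fc (Z.u i)
  w i := fc (Z.ω i)
  J i j := fc (Z.J i j)
  du i := fc (ut i)
  dw i := fc (ωt i)
  dJ i j := fc (Jt i j)
  p := fc p
  G i := fc (inertialTerm c Z ωt i)
  Q i := fc (fun x => Z.nonlinPrec c x i)
  K i j := fc (commTerm Z i j)
  symm i j := by rw [hsymm i j]
  real_u j k := fc_neg_freq _ k
  div_u k := by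
    have h := fc_div hZ.1 k
    rw [hdiv, fc_coe_zero] at h
    have h2 : Complex.I * ∑ j, (k j : ℂ) * fc (Z.u j) k = 0 := by
      rw [Finset.mul_sum, h]
      exact Finset.sum_congr rfl fun j _ => (mul_assoc _ _ _).symm
    exact (mul_eq_zero.mp h2).resolve_left Complex.I_ne_zero
  eq_u := fc_linU hZ hp hu
  eq_w := fc_inertialTerm hZ ωt
  eq_G := fc_inertialTerm_eq hZ hω
  eq_J := fc_linJ hZ hJ
  Q_le k := by
    have h := fun i => (fcLe_nonlinPrec c hZ i).2 k
    rw [mag3]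
    refine (Finset.sum_le_sum fun i _ => h i).trans (le_of_eq ?_)
    simp only [Finset.sum_const, Finset.card_univ, Fintype.card_fin, nsmul_eq_mul,
      Constants.precConst]
    push_cast
    ring
  K_le i j := (fcLe_commTerm Z i j).2
  K_orth := sum_pair_commTerm hZ
  fin_u i := ne_top_of_le_ne_top ENNReal.ofReal_ne_top (hZ.1 i).sqs_wt_le
  fin_w i := ne_top_of_le_ne_top ENNReal.ofReal_ne_top (hZ.2.1 i).sqs_wt_le
  fin_J i j := ne_top_of_le_ne_top ENNReal.ofReal_ne_top (hZ.2.2 i j).sqs_wt_le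
  fin_du i := sqs_fc_ne_top (ut i).memLp
  fin_dw i := sqs_fc_ne_top (ωt i).memLp
  fin_dJ i j := sqs_fc_ne_top (Jt i j).memLp
  fin_G i := sqs_fc_ne_top (memLp_inertialTerm hZ ωt i)

end Modes

lemma Constants.precConst_ne_top (c : Constants) : c.precConst ≠ ∞ := by
  rw [Constants.precConst]
  finiteness

/-! ### The weighted energy as a quadratic form -/

lemma pair_comm (V : Freq → ℕ) (f g : Freq → ℂ) : pair V f g = pair V g f := by
  refine tsum_congr fun k => ?_
  congr 1
  simp only [Complex.mul_re, Complex.conj_re, Complex.conj_im]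
  ring

lemma sqs_mag_weight_fc_le {V : Freq → ℕ} {B : ℕ} (hV : ∀ k, V k ≤ B) (f : L2) :
    sqs (mag fun k => ((V k : ℝ) : ℂ) * fc f k)
      ≤ ENNReal.ofReal ((B : ℝ) ^ 2 * (torusVol⁻¹ * ‖f‖ ^ 2)) := by
  have hV' : ∀ k, |((V k : ℝ))| ≤ (B : ℝ) := fun k => by
    rw [abs_of_nonneg (Nat.cast_nonneg _)]
    exact_mod_cast hV k
  calc _ ≤ sqs (fun k => ENNReal.ofReal (B : ℝ) * mag (fc f) k) :=
        sqs_mono fun k => mag_weight_le hV' (fc f) k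
    _ = _ := by
        rw [sqs_const_mul, sqs_mag_fc, ENNReal.ofReal_mul (sq_nonneg (B : ℝ)),
          ENNReal.ofReal_pow (Nat.cast_nonneg B)]

lemma abs_pair_fc_le {V : Freq → ℕ} {B : ℕ} (hV : ∀ k, V k ≤ B) (f g : L2) :
    |pair V (fc f) (fc g)| ≤ (B : ℝ) ^ 2 * torusVol⁻¹ * ‖f‖ * ‖g‖ := by
  have hv := torusVol_pos
  rcases eq_or_ne f 0 with rfl | hf
  · have h : pair V (fc (0 : L2)) (fc g) = 0 := by simp only [pair, fc_coe_zero]; simp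
    rw [h]
    simp
  rcases eq_or_ne g 0 with rfl | hg
  · have h : pair V (fc f) (fc (0 : L2)) = 0 := by simp only [pair, fc_coe_zero]; simp
    rw [h]
    simp
  have hf' : 0 < ‖f‖ := norm_pos_iff.mpr hf
  have hg' : 0 < ‖g‖ := norm_pos_iff.mpr hg
  rw [pair_eq_re_tsum hV (sqs_fc_ne_top f.memLp) (sqs_fc_ne_top g.memLp)]
  -- The optimal Young parameter recovers Cauchy–Schwarz; it requires both norms to be nonzero,
  -- hence the two cases above.
  refine (abs_re_tsum_conj_mul_le (η := ‖g‖ / ‖f‖) (by positivity) (sqs_mag_weight_fc_le hV f)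
    (sqs_mag_weight_fc_le hV g) (by positivity) (by positivity)).trans (le_of_eq ?_)
  field_simp
  ring

/-- The weighted pairing of Fourier coefficients as a bilinear form on `L²`. -/
def pairForm {V : Freq → ℕ} {B : ℕ} (hV : ∀ k, V k ≤ B) : L2 →L[ℝ] L2 →L[ℝ] ℝ :=
  LinearMap.mkContinuous₂
    (LinearMap.mk₂ ℝ (fun f g : L2 => pair V (fc f) (fc g))
      (fun f f' g => by
        rw [pair_comm, pair_comm V (fc f), pair_comm V (fc f'),
          ← pair_add hV (sqs_fc_ne_top g.memLp) (sqs_fc_ne_top f.memLp) (sqs_fc_ne_top f'.memLp)]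
        congr 1
        ext k
        exact fc_coe_add f f' k)
      (fun r f g => by
        rw [pair, pair, smul_eq_mul, ← tsum_mul_left]
        refine tsum_congr fun k => ?_
        rw [fc_coe_smul, map_mul, Complex.conj_ofReal, mul_assoc, Complex.re_ofReal_mul]
        ring)
      (fun f g g' => by
        rw [← pair_add hV (sqs_fc_ne_top f.memLp) (sqs_fc_ne_top g.memLp) (sqs_fc_ne_top g'.memLp)]
        congr 1
        ext k
        exact fc_coe_add g g' k)
      (fun r f g => by
        rw [pair, pair, smul_eq_mul, ← tsum_mul_left]
        refine tsum_congr fun k => ?_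
        rw [fc_coe_smul, mul_left_comm (conj (fc f k)), Complex.re_ofReal_mul]
        ring))
    ((B : ℝ) ^ 2 * torusVol⁻¹) (fun f g => abs_pair_fc_le hV f g)

lemma pairForm_apply {V : Freq → ℕ} {B : ℕ} (hV : ∀ k, V k ≤ B) (f g : L2) :
    pairForm hV f g = pair V (fc f) (fc g) := rfl

/-- A bounded weight gives a continuous bilinear form on L², so the product rule needs only the L²
derivative of the curve. This is the reason for truncating. -/
lemma hasDerivAt_pair {V : Freq → ℕ} {B : ℕ} (hV : ∀ k, V k ≤ B) {f : ℝ → L2} {f' : L2} {t : ℝ}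
    (h : HasDerivAt f f' t) :
    HasDerivAt (fun s => pair V (fc (f s)) (fc (f s))) (2 * pair V (fc (f t)) (fc f')) t := by
  have h1 := ContinuousLinearMap.hasDerivAt_of_bilinear (B := pairForm hV)
    (fun _ => h) (fun _ => h)
  have e : pairForm hV (f t) f' + pairForm hV f' (f t) = 2 * pair V (fc (f t)) (fc f') := by
    rw [pairForm_apply, pairForm_apply, pair_comm V (fc f')]
    exact (two_mul _).symm
  rw [e] at h1
  exact h1

lemma exists_lipschitz_pair {V : Freq → ℕ} {B : ℕ} (hV : ∀ k, V k ≤ B) {f : ℝ → L2} {s : Set ℝ}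
    (hs : IsCompact s) {K : NNReal} (hf : LipschitzOnWith K f s) :
    ∃ K', LipschitzOnWith K' (fun s => pair V (fc (f s)) (fc (f s))) s := by
  obtain ⟨M, hM⟩ := (hs.image_of_continuousOn hf.continuousOn).isBounded.exists_norm_le
  set b := ‖pairForm hV‖ with hb
  rcases s.eq_empty_or_nonempty with rfl | ⟨t₀, ht₀⟩
  · exact ⟨0, by simp⟩
  have hM0 : 0 ≤ M := (norm_nonneg _).trans (hM _ ⟨t₀, ht₀, rfl⟩)
  refine ⟨⟨2 * b * M * K, by positivity⟩, LipschitzOnWith.of_dist_le_mul fun x hx y hy => ?_⟩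
  have h1 : pair V (fc (f x)) (fc (f x)) - pair V (fc (f y)) (fc (f y))
      = pairForm hV (f x - f y) (f x) + pairForm hV (f y) (f x - f y) := by
    simp only [map_sub, sub_apply, pairForm_apply]
    ring
  have h2 := (pairForm hV).le_opNorm₂ (f x - f y) (f x)
  have h3 := (pairForm hV).le_opNorm₂ (f y) (f x - f y)
  have h4 := hf.dist_le_mul x hx y hy
  rw [dist_eq_norm] at h4
  rw [Real.dist_eq, h1]
  refine (abs_add_le _ _).trans ?_
  rw [Real.norm_eq_abs] at h2 h3
  have e1 := hM _ ⟨x, hx, rfl⟩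
  have e2 := hM _ ⟨y, hy, rfl⟩
  calc _ ≤ b * ‖f x - f y‖ * ‖f x‖ + b * ‖f y‖ * ‖f x - f y‖ := add_le_add h2 h3
    _ ≤ b * (K * dist x y) * M + b * M * (K * dist x y) := by gcongr
    _ = 2 * b * M * K * dist x y := by ring

/-- The energy of a state, weighted in frequency. -/
def energy (c : Constants) (V : Freq → ℕ) (Z : State) : ℝ :=
  ∑ i, pair V (fc (Z.u i)) (fc (Z.u i)) + ∑ i, c.inertia i * pair V (fc (Z.ω i)) (fc (Z.ω i))
    + ∑ i, ∑ j, pair V (fc (Z.J i j)) (fc (Z.J i j))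

lemma exists_lipschitz_sum {ι : Type*} (S : Finset ι) {f : ι → ℝ → ℝ} {s : Set ℝ}
    (h : ∀ i ∈ S, ∃ K, LipschitzOnWith K (f i) s) :
    ∃ K, LipschitzOnWith K (fun t => ∑ i ∈ S, f i t) s := by
  classical
  induction S using Finset.induction_on with
  | empty => exact ⟨0, by simp⟩
  | insert a S ha ih =>
    obtain ⟨K, hK⟩ := ih fun i hi => h i (Finset.mem_insert_of_mem hi)
    obtain ⟨K', hK'⟩ := h a (Finset.mem_insert_self a S)
    simp only [Finset.sum_insert ha]
    exact ⟨_, hK'.add hK⟩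

lemma IsSolution.exists_lipschitz_energy {c : Constants} {T : ℝ} {Z : ℝ → State} {p : ℝ → L2}
    (h : IsSolution c T Z p) {V : Freq → ℕ} {B : ℕ} (hV : ∀ k, V k ≤ B) :
    ∃ K, LipschitzOnWith K (fun t => energy c V (Z t)) (Icc 0 T) := by
  obtain ⟨Ku, hu⟩ := h.lip_u
  obtain ⟨Kw, hw⟩ := h.lip_ω
  obtain ⟨KJ, hJ⟩ := h.lip_J
  have bdd : IsCompact (Icc (0 : ℝ) T) := isCompact_Icc
  have hu' : ∀ i, LipschitzOnWith (1 * Ku) (fun t => (Z t).u i) (Icc 0 T) := fun i =>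
    (LipschitzWith.eval i).comp_lipschitzOnWith hu
  have hw' : ∀ i, LipschitzOnWith (1 * Kw) (fun t => (Z t).ω i) (Icc 0 T) := fun i =>
    (LipschitzWith.eval i).comp_lipschitzOnWith hw
  have hJ' : ∀ i j, LipschitzOnWith (1 * (1 * KJ)) (fun t => (Z t).J i j) (Icc 0 T) := fun i j =>
    (LipschitzWith.eval j).comp_lipschitzOnWith ((LipschitzWith.eval i).comp_lipschitzOnWith hJ)
  obtain ⟨K1, h1⟩ := exists_lipschitz_sum Finset.univ fun i _ =>
    exists_lipschitz_pair hV bdd (hu' i)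
  obtain ⟨K2, h2⟩ := exists_lipschitz_sum Finset.univ (f := fun i t =>
      c.inertia i * pair V (fc ((Z t).ω i)) (fc ((Z t).ω i))) (s := Icc 0 T) fun i _ => by
    obtain ⟨K, hK⟩ := exists_lipschitz_pair hV bdd (hw' i)
    exact ⟨_, (lipschitzWith_smul (c.inertia i)).comp_lipschitzOnWith hK⟩
  obtain ⟨K3, h3⟩ := exists_lipschitz_sum Finset.univ fun i _ =>
    exists_lipschitz_sum Finset.univ fun j _ => exists_lipschitz_pair hV bdd (hJ' i j)
  exact ⟨_, (h1.add h2).add h3⟩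

lemma hasDerivAt_energy (c : Constants) {V : Freq → ℕ} {B : ℕ} (hV : ∀ k, V k ≤ B)
    {Z : ℝ → State} {ut ωt : Fin 3 → L2} {Jt : Fin 3 → Fin 3 → L2} {t : ℝ}
    (hu : HasDerivAt (fun s => (Z s).u) ut t) (hω : HasDerivAt (fun s => (Z s).ω) ωt t)
    (hJ : HasDerivAt (fun s => (Z s).J) Jt t) :
    HasDerivAt (fun s => energy c V (Z s)) (2 * (∑ i, pair V (fc ((Z t).u i)) (fc (ut i))
      + ∑ i, c.inertia i * pair V (fc ((Z t).ω i)) (fc (ωt i))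
      + ∑ i, ∑ j, pair V (fc ((Z t).J i j)) (fc (Jt i j)))) t := by
  have hu' := fun i => hasDerivAt_pair hV (hasDerivAt_pi.mp hu i)
  have hω' := fun i => (hasDerivAt_pair hV (hasDerivAt_pi.mp hω i)).const_mul (c.inertia i)
  have hJ' := fun i j => hasDerivAt_pair hV (hasDerivAt_pi.mp (hasDerivAt_pi.mp hJ i) j)
  have h := ((HasDerivAt.fun_sum fun i (_ : i ∈ Finset.univ) => hu' i).add
    (HasDerivAt.fun_sum fun i (_ : i ∈ Finset.univ) => hω' i)).add
    (HasDerivAt.fun_sum fun i (_ : i ∈ Finset.univ) => HasDerivAt.fun_sum fun j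
      (_ : j ∈ Finset.univ) => hJ' i j)
  refine h.congr_deriv ?_
  simp only [mul_add, Finset.mul_sum]
  congr 2
  exact Finset.sum_congr rfl fun i _ => by ring

/-- A Lipschitz function is bounded through a bound on its derivative. -/
lemma le_add_integral_of_deriv_le {E b : ℝ → ℝ} {t : ℝ} (ht : 0 ≤ t) {K : NNReal}
    (hE : LipschitzOnWith K E (Icc 0 t)) (hb : Continuous b)
    (h : ∀ᵐ s ∂(volume.restrict (Icc 0 t)), deriv E s ≤ b s) :
    E t ≤ E 0 + ∫ s in (0 : ℝ)..t, b s := by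
  have hE' : AbsolutelyContinuousOnInterval E 0 t := by
    refine LipschitzOnWith.absolutelyContinuousOnInterval (K := K) ?_
    rwa [uIcc_of_le ht]
  have h1 := hE'.integral_deriv_eq_sub
  have h2 : ∫ s in (0 : ℝ)..t, deriv E s ≤ ∫ s in (0 : ℝ)..t, b s :=
    intervalIntegral.integral_mono_ae_restrict ht hE'.intervalIntegrable_deriv
      (hb.intervalIntegrable 0 t) h
  linarith

/-! ### Norms of states in Fourier variables -/

namespace State

/-- The square of the `H⁴` norm. -/
def sobSq (Z : State) : ℝ :=
  ∑ i, normSqH 4 (Z.u i) + ∑ i, normSqH 4 (Z.ω i) + ∑ i, ∑ j, normSqH 4 (Z.J i j)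

/-- The square of the `L²` norm. -/
def lebSq (Z : State) : ℝ := ∑ i, ‖Z.u i‖ ^ 2 + ∑ i, ‖Z.ω i‖ ^ 2 + ∑ i, ∑ j, ‖Z.J i j‖ ^ 2

lemma sobSq_nonneg (Z : State) : 0 ≤ Z.sobSq :=
  add_nonneg (add_nonneg (Finset.sum_nonneg fun _ _ => normSqH_nonneg _ _)
    (Finset.sum_nonneg fun _ _ => normSqH_nonneg _ _))
    (Finset.sum_nonneg fun _ _ => Finset.sum_nonneg fun _ _ => normSqH_nonneg _ _)

lemma lebSq_nonneg (Z : State) : 0 ≤ Z.lebSq := by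
  unfold lebSq
  positivity

lemma normH_sq (Z : State) : Z.normH 4 ^ 2 = Z.sobSq := Real.sq_sqrt Z.sobSq_nonneg

lemma norm_sq_le_normSqH (f : L2) : ‖f‖ ^ 2 ≤ normSqH 4 f :=
  le_add_of_nonneg_right (Finset.sum_nonneg fun _ _ => normSqH_nonneg _ _)

lemma lebSq_le_sobSq (Z : State) : Z.lebSq ≤ Z.sobSq :=
  add_le_add (add_le_add (Finset.sum_le_sum fun _ _ => norm_sq_le_normSqH _)
    (Finset.sum_le_sum fun _ _ => norm_sq_le_normSqH _))
    (Finset.sum_le_sum fun _ _ => Finset.sum_le_sum fun _ _ => norm_sq_le_normSqH _)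

end State

lemma sqs_mag3_le (n : ℕ) {f : Fin 3 → Freq → ℂ} {b : Fin 3 → ℝ} (hb : ∀ i, 0 ≤ b i)
    (h : ∀ i, sqs (fun k => (wt k : ℝ≥0∞) ^ n * mag (f i) k) ≤ ENNReal.ofReal (b i)) :
    sqs (fun k => (wt k : ℝ≥0∞) ^ n * mag3 f k) ≤ ENNReal.ofReal (4 * ∑ i, b i) := by
  simp only [mag3, Fin.sum_univ_three, mul_add]
  refine (sqs_add_three_le _ _ _).trans ?_
  rw [ENNReal.ofReal_add (by have := hb 0; have := hb 1; positivity) (by have := hb 2; positivity),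
    ENNReal.ofReal_add (by have := hb 0; positivity) (by have := hb 1; positivity)]
  simp only [ENNReal.ofReal_mul (show (0 : ℝ) ≤ 4 by norm_num), ENNReal.ofReal_ofNat]
  rw [← mul_add, ← mul_add]
  gcongr
  · exact h 0
  · exact h 1
  · exact h 2

lemma sqs_mag9_le (n : ℕ) {f : Fin 3 → Fin 3 → Freq → ℂ} {b : Fin 3 → Fin 3 → ℝ}
    (hb : ∀ i j, 0 ≤ b i j)
    (h : ∀ i j, sqs (fun k => (wt k : ℝ≥0∞) ^ n * mag (f i j) k) ≤ ENNReal.ofReal (b i j)) :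
    sqs (fun k => (wt k : ℝ≥0∞) ^ n * mag9 f k) ≤ ENNReal.ofReal (16 * ∑ i, ∑ j, b i j) := by
  have h1 : ∀ i, sqs (fun k => (wt k : ℝ≥0∞) ^ n * mag3 (f i) k)
      ≤ ENNReal.ofReal (4 * ∑ j, b i j) := fun i => sqs_mag3_le n (hb i) (h i)
  have e : ∀ k, mag9 f k = mag3 (f 0) k + mag3 (f 1) k + mag3 (f 2) k := fun k => by
    rw [mag9, Fin.sum_univ_three]
    rfl
  have p : ∀ i, 0 ≤ 4 * ∑ j, b i j := fun i =>
    mul_nonneg (by norm_num) (Finset.sum_nonneg fun j _ => hb i j)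
  simp only [e, mul_add]
  refine (sqs_add_three_le _ _ _).trans ?_
  have e2 : 16 * ∑ i, ∑ j, b i j
      = 4 * (4 * ∑ j, b 0 j + 4 * ∑ j, b 1 j + 4 * ∑ j, b 2 j) := by
    rw [Fin.sum_univ_three (fun i => ∑ j, b i j)]
    ring
  rw [e2, ENNReal.ofReal_mul (by norm_num), ENNReal.ofReal_add (add_nonneg (p 0) (p 1)) (p 2),
    ENNReal.ofReal_add (p 0) (p 1), ENNReal.ofReal_ofNat]
  gcongr
  · exact h1 0
  · exact h1 1
  · exact h1 2

/-- The constant comparing the weighted sequence norms with the `H⁴` norm. -/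
def sobConst : ℝ := 16 * (2048 / torusVol)

lemma sobConst_pos : 0 < sobConst := by
  have := torusVol_pos
  unfold sobConst
  positivity

/-- The constant comparing the sequence norms with the `L²` norm. -/
def lebConst : ℝ := 16 * torusVol⁻¹

lemma lebConst_pos : 0 < lebConst := by
  have := torusVol_pos
  unfold lebConst
  positivity

section Bounds

variable {Z : State}

lemma State.sum_u_le (Z : State) : ∑ i, normSqH 4 (Z.u i) ≤ Z.sobSq := by
  have h1 : 0 ≤ ∑ i, normSqH 4 (Z.ω i) := Finset.sum_nonneg fun _ _ => normSqH_nonneg _ _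
  have h2 : 0 ≤ ∑ i, ∑ j, normSqH 4 (Z.J i j) :=
    Finset.sum_nonneg fun _ _ => Finset.sum_nonneg fun _ _ => normSqH_nonneg _ _
  unfold sobSq
  linarith

lemma State.sum_ω_le (Z : State) : ∑ i, normSqH 4 (Z.ω i) ≤ Z.sobSq := by
  have h1 : 0 ≤ ∑ i, normSqH 4 (Z.u i) := Finset.sum_nonneg fun _ _ => normSqH_nonneg _ _
  have h2 : 0 ≤ ∑ i, ∑ j, normSqH 4 (Z.J i j) :=
    Finset.sum_nonneg fun _ _ => Finset.sum_nonneg fun _ _ => normSqH_nonneg _ _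
  unfold sobSq
  linarith

lemma State.sum_J_le (Z : State) : ∑ i, ∑ j, normSqH 4 (Z.J i j) ≤ Z.sobSq := by
  have h1 : 0 ≤ ∑ i, normSqH 4 (Z.u i) := Finset.sum_nonneg fun _ _ => normSqH_nonneg _ _
  have h2 : 0 ≤ ∑ i, normSqH 4 (Z.ω i) := Finset.sum_nonneg fun _ _ => normSqH_nonneg _ _
  unfold sobSq
  linarith

lemma sob_coeff_nonneg (f : L2) : 0 ≤ 2048 / torusVol * normSqH 4 f :=
  mul_nonneg (div_nonneg (by norm_num) torusVol_pos.le) (normSqH_nonneg 4 f)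

lemma State.sqs_sob_u (hZ : Z.MemH 4) :
    sqs (fun k => (wt k : ℝ≥0∞) ^ 4 * mag3 (fun i => fc (Z.u i)) k)
      ≤ ENNReal.ofReal (sobConst * Z.sobSq) := by
  refine (sqs_mag3_le 4 (fun i => sob_coeff_nonneg _) fun i => (hZ.1 i).sqs_wt_le).trans
    (ENNReal.ofReal_le_ofReal ?_)
  rw [← Finset.mul_sum, ← mul_assoc]
  have := torusVol_pos
  have := Z.sum_u_le
  have := Z.sobSq_nonneg
  refine mul_le_mul ?_ Z.sum_u_le (Finset.sum_nonneg fun _ _ => normSqH_nonneg _ _) sobConst_pos.le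
  unfold sobConst
  gcongr
  norm_num

lemma State.sqs_sob_ω (hZ : Z.MemH 4) :
    sqs (fun k => (wt k : ℝ≥0∞) ^ 4 * mag3 (fun i => fc (Z.ω i)) k)
      ≤ ENNReal.ofReal (sobConst * Z.sobSq) := by
  refine (sqs_mag3_le 4 (fun i => sob_coeff_nonneg _) fun i => (hZ.2.1 i).sqs_wt_le).trans
    (ENNReal.ofReal_le_ofReal ?_)
  rw [← Finset.mul_sum, ← mul_assoc]
  have := torusVol_pos
  refine mul_le_mul ?_ Z.sum_ω_le (Finset.sum_nonneg fun _ _ => normSqH_nonneg _ _) sobConst_pos.le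
  unfold sobConst
  gcongr
  norm_num

lemma State.sqs_sob_J (hZ : Z.MemH 4) :
    sqs (fun k => (wt k : ℝ≥0∞) ^ 4 * mag9 (fun i j => fc (Z.J i j)) k)
      ≤ ENNReal.ofReal (sobConst * Z.sobSq) := by
  refine (sqs_mag9_le 4 (fun i j => sob_coeff_nonneg _) fun i j => (hZ.2.2 i j).sqs_wt_le).trans
    (ENNReal.ofReal_le_ofReal ?_)
  simp only [← Finset.mul_sum]
  rw [← mul_assoc]
  exact mul_le_mul_of_nonneg_left Z.sum_J_le sobConst_pos.le

lemma leb_coeff_nonneg (f : L2) : 0 ≤ torusVol⁻¹ * ‖f‖ ^ 2 :=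
  mul_nonneg (inv_nonneg.mpr torusVol_pos.le) (sq_nonneg _)

lemma sqs_wt_zero_le (f : L2) : sqs (fun k => (wt k : ℝ≥0∞) ^ 0 * mag (fc f) k)
    ≤ ENNReal.ofReal (torusVol⁻¹ * ‖f‖ ^ 2) := by
  simpa using (sqs_mag_fc f).le

lemma State.sqs_leb_u (Z : State) :
    sqs (mag3 fun i => fc (Z.u i)) ≤ ENNReal.ofReal (lebConst * Z.lebSq) := by
  have h := sqs_mag3_le 0 (fun i => leb_coeff_nonneg _) fun i => sqs_wt_zero_le (Z.u i)
  simp only [pow_zero, one_mul] at h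
  refine h.trans (ENNReal.ofReal_le_ofReal ?_)
  rw [← Finset.mul_sum, ← mul_assoc]
  have := torusVol_pos
  have h1 : 0 ≤ ∑ i, ‖Z.ω i‖ ^ 2 := Finset.sum_nonneg fun _ _ => sq_nonneg _
  have h2 : 0 ≤ ∑ i, ∑ j, ‖Z.J i j‖ ^ 2 :=
    Finset.sum_nonneg fun _ _ => Finset.sum_nonneg fun _ _ => sq_nonneg _
  unfold lebConst lebSq
  gcongr
  · norm_num
  · linarith

lemma State.sqs_leb_ω (Z : State) :
    sqs (mag3 fun i => fc (Z.ω i)) ≤ ENNReal.ofReal (lebConst * Z.lebSq) := by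
  have h := sqs_mag3_le 0 (fun i => leb_coeff_nonneg _) fun i => sqs_wt_zero_le (Z.ω i)
  simp only [pow_zero, one_mul] at h
  refine h.trans (ENNReal.ofReal_le_ofReal ?_)
  rw [← Finset.mul_sum, ← mul_assoc]
  have := torusVol_pos
  have h1 : 0 ≤ ∑ i, ‖Z.u i‖ ^ 2 := Finset.sum_nonneg fun _ _ => sq_nonneg _
  have h2 : 0 ≤ ∑ i, ∑ j, ‖Z.J i j‖ ^ 2 :=
    Finset.sum_nonneg fun _ _ => Finset.sum_nonneg fun _ _ => sq_nonneg _
  unfold lebConst lebSq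
  gcongr
  · norm_num
  · linarith

lemma State.sqs_leb_J (Z : State) :
    sqs (mag9 fun i j => fc (Z.J i j)) ≤ ENNReal.ofReal (lebConst * Z.lebSq) := by
  have h := sqs_mag9_le 0 (fun i j => leb_coeff_nonneg _) fun i j => sqs_wt_zero_le (Z.J i j)
  simp only [pow_zero, one_mul] at h
  refine h.trans (ENNReal.ofReal_le_ofReal ?_)
  simp only [← Finset.mul_sum]
  rw [← mul_assoc]
  have := torusVol_pos
  have h1 : 0 ≤ ∑ i, ‖Z.u i‖ ^ 2 := Finset.sum_nonneg fun _ _ => sq_nonneg _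
  have h2 : 0 ≤ ∑ i, ‖Z.ω i‖ ^ 2 := Finset.sum_nonneg fun _ _ => sq_nonneg _
  unfold lebConst lebSq
  gcongr
  linarith

/-- Interpolation between the unweighted norm and the norm of order four. -/
lemma sqs_wt_cube_le_interp {τ : ℝ} (hτ : 0 < τ) {f : Freq → ℝ≥0∞} {h₀ h₄ : ℝ} (hh₀ : 0 ≤ h₀)
    (hh₄ : 0 ≤ h₄) (f0 : sqs f ≤ ENNReal.ofReal h₀)
    (f4 : sqs (fun k => (wt k : ℝ≥0∞) ^ 4 * f k) ≤ ENNReal.ofReal h₄) :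
    sqs (fun k => (wt k : ℝ≥0∞) ^ 3 * f k) ≤ ENNReal.ofReal (τ * h₄ + τ⁻¹ ^ 3 * h₀) := by
  have hpt : ∀ k : Freq, (wt k : ℝ≥0∞) ^ 6
      ≤ ENNReal.ofReal τ * (wt k : ℝ≥0∞) ^ 8 + ENNReal.ofReal (τ⁻¹ ^ 3) := by
    intro k
    have hr : (wt k : ℝ) ^ 6 ≤ τ * (wt k : ℝ) ^ 8 + τ⁻¹ ^ 3 := by
      set x := (wt k : ℝ) ^ 2 with hx
      have hx0 : 0 ≤ x := by positivity
      have e6 : (wt k : ℝ) ^ 6 = x ^ 3 := by rw [hx]; ring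
      have e8 : (wt k : ℝ) ^ 8 = x ^ 4 := by rw [hx]; ring
      rw [e6, e8]
      -- Below the threshold `wt`² ≤ τ⁻¹ the sixth power is at most τ⁻³; above it, two further
      -- powers of the weight are worth at least a factor τ⁻¹.
      rcases le_total x τ⁻¹ with h | h
      · have h1 : x ^ 3 ≤ τ⁻¹ ^ 3 := by gcongr
        have h2 : 0 ≤ τ * x ^ 4 := by positivity
        linarith
      · have h1 : 1 ≤ τ * x := by
          calc (1 : ℝ) = τ * τ⁻¹ := (mul_inv_cancel₀ hτ.ne').symm
            _ ≤ τ * x := by gcongr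
        have h2 : 0 ≤ τ⁻¹ ^ 3 := by positivity
        have h3 : x ^ 3 * 1 ≤ x ^ 3 * (τ * x) := by gcongr
        linarith [show x ^ 3 * (τ * x) = τ * x ^ 4 by ring]
    have := ENNReal.ofReal_le_ofReal hr
    rwa [ENNReal.ofReal_add (by positivity) (by positivity), ENNReal.ofReal_mul hτ.le,
      ENNReal.ofReal_pow (by positivity), ENNReal.ofReal_pow (by positivity),
      ENNReal.ofReal_natCast] at this
  calc sqs (fun k => (wt k : ℝ≥0∞) ^ 3 * f k)
      ≤ ∑' k, (ENNReal.ofReal τ * ((wt k : ℝ≥0∞) ^ 4 * f k) ^ 2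
          + ENNReal.ofReal (τ⁻¹ ^ 3) * f k ^ 2) := by
        refine ENNReal.tsum_le_tsum fun k => ?_
        calc ((wt k : ℝ≥0∞) ^ 3 * f k) ^ 2 = (wt k : ℝ≥0∞) ^ 6 * f k ^ 2 := by ring
          _ ≤ (ENNReal.ofReal τ * (wt k : ℝ≥0∞) ^ 8 + ENNReal.ofReal (τ⁻¹ ^ 3)) * f k ^ 2 := by
              gcongr
              exact hpt k
          _ = _ := by ring
    _ = ENNReal.ofReal τ * sqs (fun k => (wt k : ℝ≥0∞) ^ 4 * f k)
          + ENNReal.ofReal (τ⁻¹ ^ 3) * sqs f := by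
        rw [ENNReal.tsum_add, ENNReal.tsum_mul_left, ENNReal.tsum_mul_left]
        rfl
    _ ≤ ENNReal.ofReal τ * ENNReal.ofReal h₄ + ENNReal.ofReal (τ⁻¹ ^ 3) * ENNReal.ofReal h₀ := by
        gcongr
    _ = _ := by
        rw [ENNReal.ofReal_add (by positivity) (by positivity), ENNReal.ofReal_mul hτ.le,
          ENNReal.ofReal_mul (by positivity)]

end Bounds

/-! ### Energies -/

lemma pair_one_self (f : L2) : pair (fun _ => 1) (fc f) (fc f) = torusVol⁻¹ * ‖f‖ ^ 2 := by
  rw [norm_sq_eq_integral, ← pair_one_fc f.memLp f.memLp, ← mul_assoc,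
    inv_mul_cancel₀ torusVol_pos.ne', one_mul]

lemma pair_self_nonneg (V : Freq → ℕ) (f : Freq → ℂ) : 0 ≤ pair V f f := by
  refine tsum_nonneg fun k => mul_nonneg (sq_nonneg _) ?_
  rw [← Complex.normSq_eq_conj_mul_self, Complex.ofReal_re]
  exact Complex.normSq_nonneg _

lemma pair_self_eq (V : Freq → ℕ) (f : Freq → ℂ) :
    pair V f f = ∑' k, (V k : ℝ) ^ 2 * ‖f k‖ ^ 2 := by
  refine tsum_congr fun k => ?_
  rw [← Complex.normSq_eq_conj_mul_self, Complex.ofReal_re, Complex.normSq_eq_norm_sq]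

lemma summable_weight_norm_sq {V : Freq → ℕ} {B : ℕ} (hV : ∀ k, V k ≤ B) (f : L2) :
    Summable fun k => (V k : ℝ) ^ 2 * ‖fc f k‖ ^ 2 := by
  refine (summable_pair hV (sqs_fc_ne_top f.memLp) (sqs_fc_ne_top f.memLp)).congr fun k => ?_
  rw [← Complex.normSq_eq_conj_mul_self, Complex.ofReal_re, Complex.normSq_eq_norm_sq]

lemma pair_trunc_le {f : L2} (hf : MemH 4 f) (N : ℕ) :
    pair (fun k => trunc N k ^ 4) (fc f) (fc f) ≤ 2048 / torusVol * normSqH 4 f := by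
  have hv := torusVol_pos
  have h := hf.hasSum_normSqH.mul_left (2048 / torusVol)
  rw [pair_self_eq, ← h.tsum_eq]
  refine Summable.tsum_le_tsum (fun k => ?_)
    (summable_weight_norm_sq (B := N ^ 4) (fun k => Nat.pow_le_pow_left (trunc_le N k) 4) f)
    h.summable
  have e : 2048 / torusVol * (torusVol * (symbolH 4 k * ‖fc f k‖ ^ 2))
      = 2048 * symbolH 4 k * ‖fc f k‖ ^ 2 := by field_simp
  rw [e]
  gcongr
  refine le_trans ?_ (wt_pow_le_symbolH k)
  have h1 : ((trunc N k : ℕ) : ℝ) ≤ wt k := by exact_mod_cast trunc_le_wt N k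
  calc (((trunc N k ^ 4 : ℕ) : ℝ)) ^ 2 = (trunc N k : ℝ) ^ 8 := by push_cast; ring
    _ ≤ _ := by gcongr

/-- Each finite partial sum is unaffected by truncation at the sum of its own weights, so a bound
uniform in N gives the full weighted sum. -/
lemma sqs_wt_fourth_le_of_trunc {f : L2} {b : ℝ}
    (h : ∀ N : ℕ, pair (fun k => trunc N k ^ 4) (fc f) (fc f) ≤ b) :
    sqs (fun k => (wt k : ℝ≥0∞) ^ 4 * mag (fc f) k) ≤ ENNReal.ofReal b := by
  rw [sqs_wt_eq_tsum, ENNReal.tsum_eq_iSup_sum]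
  refine iSup_le fun s => ?_
  rw [← ENNReal.ofReal_sum_of_nonneg fun k _ => by positivity]
  refine ENNReal.ofReal_le_ofReal ?_
  set N := ∑ k ∈ s, wt k with hN
  refine le_trans ?_ (h N)
  rw [pair_self_eq]
  have hs := summable_weight_norm_sq (V := fun k => trunc N k ^ 4) (B := N ^ 4)
    (fun k => Nat.pow_le_pow_left (trunc_le N k) 4) f
  refine le_trans (le_of_eq ?_) (hs.sum_le_tsum s fun k _ => by positivity)
  refine Finset.sum_congr rfl fun k hk => ?_
  have e : trunc N k = wt k :=
    min_eq_left (Finset.single_le_sum (f := wt) (fun _ _ => Nat.zero_le _) hk)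
  rw [e]
  push_cast
  ring

/-- The frequency-weighted norm of a state. -/
def plainEnergy (V : Freq → ℕ) (Z : State) : ℝ :=
  ∑ i, pair V (fc (Z.u i)) (fc (Z.u i)) + ∑ i, pair V (fc (Z.ω i)) (fc (Z.ω i))
    + ∑ i, ∑ j, pair V (fc (Z.J i j)) (fc (Z.J i j))

/-- An upper bound for `1` and the eigenvalues of `J_eq`. -/
def Constants.massSup (c : Constants) : ℝ := 1 + c.lam + c.nu

/-- A lower bound for `1` and the eigenvalues of `J_eq`. -/
def Constants.massInf (c : Constants) : ℝ := min 1 (min c.lam c.nu)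

namespace Constants.Admissible

lemma massSup_pos {c : Constants} (hc : c.Admissible) : 0 < c.massSup := by
  have := hc.lam_pos
  have := hc.nu_pos
  unfold massSup
  positivity

lemma massInf_pos {c : Constants} (hc : c.Admissible) : 0 < c.massInf := lt_min one_pos (lt_min hc.lam_pos hc.nu_pos)

lemma inertia_le {c : Constants} (hc : c.Admissible) (i : Fin 3) : c.inertia i ≤ c.massSup := by
  have := hc.lam_pos
  have := hc.nu_pos
  unfold massSup
  fin_cases i
  · change c.lam ≤ _; linarith
  · change c.lam ≤ _; linarith
  · change c.nu ≤ _; linarith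

lemma le_inertia (c : Constants) (i : Fin 3) : c.massInf ≤ c.inertia i := by
  unfold massInf
  fin_cases i
  · exact (min_le_right _ _).trans (min_le_left _ _)
  · exact (min_le_right _ _).trans (min_le_left _ _)
  · exact (min_le_right _ _).trans (min_le_right _ _)

end Constants.Admissible

lemma energy_le {c : Constants} (hc : c.Admissible) (V : Freq → ℕ) (Z : State) :
    energy c V Z ≤ c.massSup * plainEnergy V Z := by
  have h1 : 1 ≤ c.massSup := by
    have := hc.lam_pos
    have := hc.nu_pos
    unfold Constants.massSup
    linarith
  unfold energy plainEnergy
  rw [mul_add, mul_add, Finset.mul_sum, Finset.mul_sum, Finset.mul_sum]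
  refine add_le_add (add_le_add ?_ ?_) ?_
  · exact Finset.sum_le_sum fun i _ => le_mul_of_one_le_left (pair_self_nonneg _ _) h1
  · exact Finset.sum_le_sum fun i _ =>
      mul_le_mul_of_nonneg_right (hc.inertia_le i) (pair_self_nonneg _ _)
  · exact Finset.sum_le_sum fun i _ => le_mul_of_one_le_left
      (Finset.sum_nonneg fun j _ => pair_self_nonneg _ _) h1

lemma le_energy (c : Constants) (V : Freq → ℕ) (Z : State) :
    c.massInf * plainEnergy V Z ≤ energy c V Z := by
  have h1 : c.massInf ≤ 1 := min_le_left _ _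
  unfold energy plainEnergy
  rw [mul_add, mul_add, Finset.mul_sum, Finset.mul_sum, Finset.mul_sum]
  refine add_le_add (add_le_add ?_ ?_) ?_
  · exact Finset.sum_le_sum fun i _ => mul_le_of_le_one_left (pair_self_nonneg _ _) h1
  · exact Finset.sum_le_sum fun i _ =>
      mul_le_mul_of_nonneg_right (Constants.Admissible.le_inertia c i) (pair_self_nonneg _ _)
  · exact Finset.sum_le_sum fun i _ => mul_le_of_le_one_left
      (Finset.sum_nonneg fun j _ => pair_self_nonneg _ _) h1

lemma plainEnergy_one (Z : State) : plainEnergy (fun _ => 1) Z = torusVol⁻¹ * Z.lebSq := by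
  simp only [plainEnergy, pair_one_self, State.lebSq, mul_add, Finset.mul_sum]

lemma plainEnergy_trunc_le {Z : State} (hZ : Z.MemH 4) (N : ℕ) :
    plainEnergy (fun k => trunc N k ^ 4) Z ≤ 2048 / torusVol * Z.sobSq := by
  simp only [plainEnergy, State.sobSq, mul_add, Finset.mul_sum]
  exact add_le_add (add_le_add (Finset.sum_le_sum fun i _ => pair_trunc_le (hZ.1 i) N)
    (Finset.sum_le_sum fun i _ => pair_trunc_le (hZ.2.1 i) N))
    (Finset.sum_le_sum fun i _ => Finset.sum_le_sum fun j _ => pair_trunc_le (hZ.2.2 i j) N)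

/-- A uniform bound on the truncated energies bounds the `H⁴` norm. -/
lemma sobSq_le_of_plainEnergy_le {Z : State} (hZ : Z.MemH 4) {b : ℝ}
    (h : ∀ N : ℕ, plainEnergy (fun k => trunc N k ^ 4) Z ≤ b) :
    Z.sobSq ≤ 15 * torusVol * b := by
  have nu : ∀ N, 0 ≤ ∑ i, pair (fun k => trunc N k ^ 4) (fc (Z.u i)) (fc (Z.u i)) := fun N =>
    Finset.sum_nonneg fun _ _ => pair_self_nonneg _ _
  have nw : ∀ N, 0 ≤ ∑ i, pair (fun k => trunc N k ^ 4) (fc (Z.ω i)) (fc (Z.ω i)) := fun N =>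
    Finset.sum_nonneg fun _ _ => pair_self_nonneg _ _
  have nJ : ∀ N, 0 ≤ ∑ i, ∑ j, pair (fun k => trunc N k ^ 4) (fc (Z.J i j)) (fc (Z.J i j)) :=
    fun N => Finset.sum_nonneg fun _ _ => Finset.sum_nonneg fun _ _ => pair_self_nonneg _ _
  have hb : 0 ≤ b := by
    refine le_trans ?_ (h 0)
    exact add_nonneg (add_nonneg (nu 0) (nw 0)) (nJ 0)
  have key : ∀ f : L2, MemH 4 f → (∀ N, pair (fun k => trunc N k ^ 4) (fc f) (fc f) ≤ b) →
      normSqH 4 f ≤ torusVol * b := fun f hf hN => hf.normSqH_le hb (sqs_wt_fourth_le_of_trunc hN)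
  have ku : ∀ i, normSqH 4 (Z.u i) ≤ torusVol * b := fun i => key _ (hZ.1 i) fun N => by
    have h1 := Finset.single_le_sum (f := fun i => pair (fun k => trunc N k ^ 4) (fc (Z.u i))
      (fc (Z.u i))) (fun _ _ => pair_self_nonneg _ _) (Finset.mem_univ i)
    have h2 := h N
    have h3 := nw N
    have h4 := nJ N
    unfold plainEnergy at h2
    linarith
  have kw : ∀ i, normSqH 4 (Z.ω i) ≤ torusVol * b := fun i => key _ (hZ.2.1 i) fun N => by
    have h1 := Finset.single_le_sum (f := fun i => pair (fun k => trunc N k ^ 4) (fc (Z.ω i))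
      (fc (Z.ω i))) (fun _ _ => pair_self_nonneg _ _) (Finset.mem_univ i)
    have h2 := h N
    have h3 := nu N
    have h4 := nJ N
    unfold plainEnergy at h2
    linarith
  have kJ : ∀ i j, normSqH 4 (Z.J i j) ≤ torusVol * b := fun i j => key _ (hZ.2.2 i j) fun N => by
    have h1 := Finset.single_le_sum (f := fun j => pair (fun k => trunc N k ^ 4) (fc (Z.J i j))
      (fc (Z.J i j))) (fun _ _ => pair_self_nonneg _ _) (Finset.mem_univ j)
    have h1' := Finset.single_le_sum (f := fun i => ∑ j, pair (fun k => trunc N k ^ 4)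
      (fc (Z.J i j)) (fc (Z.J i j))) (fun _ _ => Finset.sum_nonneg fun _ _ => pair_self_nonneg _ _)
      (Finset.mem_univ i)
    have h2 := h N
    have h3 := nu N
    have h4 := nw N
    unfold plainEnergy at h2
    linarith
  -- The constant 15 counts scalar components: three for u, three for ω, nine for J.
  have e1 : ∑ i, normSqH 4 (Z.u i) ≤ 3 * (torusVol * b) :=
    (Finset.sum_le_sum fun i _ => ku i).trans (by simp)
  have e2 : ∑ i, normSqH 4 (Z.ω i) ≤ 3 * (torusVol * b) :=
    (Finset.sum_le_sum fun i _ => kw i).trans (by simp)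
  have e3 : ∑ i, ∑ j, normSqH 4 (Z.J i j) ≤ 9 * (torusVol * b) :=
    (Finset.sum_le_sum fun i _ => Finset.sum_le_sum fun j _ => kJ i j).trans (le_of_eq (by
      simp only [Finset.sum_const, Finset.card_univ, Fintype.card_fin, nsmul_eq_mul]
      push_cast
      ring))
  unfold State.sobSq
  linarith

/-! ### Integration of the energy inequalities in time -/

/-- The smallness under which `I + J J_eq⁻¹` is invertible. -/
def Small (c : Constants) (d : ℝ) : Prop :=
  √(wienerConst.toReal * (sobConst * d)) * c.invConst < 1

/-- At almost every time the Fourier coefficients of a solution solve the mode system, and the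
energies are differentiable. -/
lemma IsSolution.ae_modeSystem {c : Constants} (hc : c.Admissible) {T : ℝ} {Z : ℝ → State}
    {p : ℝ → L2} (h : IsSolution c T Z p) {d : ℝ} (hd : Small c d)
    (hZ : ∀ t ∈ Icc 0 T, (Z t).MemH 4 ∧ (Z t).sobSq ≤ d) :
    ∀ᵐ t ∂(volume.restrict (Icc 0 T)), t ∈ Icc 0 T ∧ ∃ m : ModeSystem c c.precConst,
      (m.u = fun i => fc ((Z t).u i)) ∧ (m.w = fun i => fc ((Z t).ω i)) ∧
      (m.J = fun i j => fc ((Z t).J i j)) ∧ ∀ (V : Freq → ℕ) (B : ℕ), (∀ k, V k ≤ B) →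
        HasDerivAt (fun s => energy c V (Z s)) (2 * m.energyRate V) t := by
  filter_upwards [h.pressure, h.div_free, h.eqn, ae_restrict_mem measurableSet_Icc]
    with t hp hdiv ⟨ut, ωt, Jt, hut, hωt, hJt, heq⟩ ht
  obtain ⟨hH, hn⟩ := hZ t ht
  have h0 : 0 ≤ sobConst * d :=
    mul_nonneg sobConst_pos.le ((State.sobSq_nonneg _).trans hn)
  have hbd : ∀ i j, ∀ᵐ x, |(Z t).J i j x| ≤ √(wienerConst.toReal * (sobConst * d)) := by
    intro i j
    refine ae_abs_le_of_sqs_le h0 ?_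
    refine (sqs_mono fun k => ?_).trans ((State.sqs_sob_J hH).trans (ENNReal.ofReal_le_ofReal
      (mul_le_mul_of_nonneg_left hn sobConst_pos.le)))
    exact mul_le_mul' le_rfl (mag_le_mag9 (fun i j => fc ((Z t).J i j)) i j k)
  have hbd' : ∀ᵐ x, ∀ i j, |(Z t).J i j x| ≤ √(wienerConst.toReal * (sobConst * d)) :=
    ae_all_iff.mpr fun i => ae_all_iff.mpr fun j => hbd i j
  have hG : ∀ᵐ x : T3, ∀ i, inertialTerm c (Z t) ωt i x
      + ∑ j, (c.inertia j)⁻¹ * ((Z t).J i j x * inertialTerm c (Z t) ωt j x)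
      = (Z t).stress c x i - (Z t).linPrec c x i - (Z t).nonlinPrec c x i := by
    filter_upwards [hbd', heq] with x hx hx' i
    exact inertialTerm_eq hc (State.isUnit_one_add_relJ hc hd hx) hx'.2.1 i
  refine ⟨ht, modeSystem hH (h.symm t ht) hp hdiv (heq.mono fun x hx => hx.1) hG
    (heq.mono fun x hx => hx.2.2), rfl, rfl, rfl, fun V B hV => ?_⟩
  exact hasDerivAt_energy c hV hut hωt hJt

lemma exists_small (c : Constants) : ∃ d : ℝ, 0 < d ∧ ∀ d' ≤ d, Small c d' := by
  set w := wienerConst.toReal with hw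
  have hw0 : 0 ≤ w := ENNReal.toReal_nonneg
  have hs := sobConst_pos
  have hi : 0 ≤ c.invConst := Finset.sum_nonneg fun _ _ => abs_nonneg _
  refine ⟨(w * sobConst * c.invConst ^ 2 + 1)⁻¹ / 2, by positivity, fun d' hd' => ?_⟩
  have h1 : w * (sobConst * d') ≤ w * (sobConst * ((w * sobConst * c.invConst ^ 2 + 1)⁻¹ / 2)) := by
    gcongr
  have h2 : √(w * (sobConst * d')) * c.invConst
      ≤ √(w * (sobConst * ((w * sobConst * c.invConst ^ 2 + 1)⁻¹ / 2))) * c.invConst := by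
    gcongr
  refine lt_of_le_of_lt h2 ?_
  refine lt_of_pow_lt_pow_left₀ 2 zero_le_one ?_
  rw [mul_pow, Real.sq_sqrt (by positivity), one_pow]
  have h3 : w * (sobConst * ((w * sobConst * c.invConst ^ 2 + 1)⁻¹ / 2)) * c.invConst ^ 2
      = (w * sobConst * c.invConst ^ 2) / (2 * (w * sobConst * c.invConst ^ 2 + 1)) := by
    field_simp
  rw [h3, div_lt_one (by positivity)]
  have : 0 ≤ w * sobConst * c.invConst ^ 2 := by positivity
  linarith

/-- Positivity of ψ is used here: each time integration costs one factor ψ⁻¹ and preserves the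
exponential rate. -/
lemma integral_mul_exp_le {a ψ t : ℝ} (ha : 0 ≤ a) (hψ : 0 < ψ) :
    ∫ s in (0 : ℝ)..t, a * Real.exp (ψ * s) ≤ a * ψ⁻¹ * Real.exp (ψ * t) := by
  rw [intervalIntegral.integral_const_mul,
    intervalIntegral.integral_comp_mul_left Real.exp hψ.ne', integral_exp, smul_eq_mul, mul_assoc]
  gcongr
  have := Real.exp_pos (ψ * 0)
  linarith

lemma hasSum_Eins (Z : State) : HasSum (fun k => ‖fc (Z.ω 0) k‖ ^ 2 + ‖fc (Z.ω 1) k‖ ^ 2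
    + (‖fc (Z.J 0 2) k‖ ^ 2 + ‖fc (Z.J 1 2) k‖ ^ 2)) (torusVol⁻¹ * Z.Eins) := by
  have h : ∀ f : L2, HasSum (fun k => ‖fc f k‖ ^ 2) (torusVol⁻¹ * ‖f‖ ^ 2) := fun f => by
    have h1 := (hasSum_norm_sq_fc f).mul_left torusVol⁻¹
    simpa only [← mul_assoc, inv_mul_cancel₀ torusVol_pos.ne', one_mul] using h1
  have e : torusVol⁻¹ * Z.Eins = torusVol⁻¹ * ‖Z.ω 0‖ ^ 2 + torusVol⁻¹ * ‖Z.ω 1‖ ^ 2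
      + (torusVol⁻¹ * ‖Z.J 0 2‖ ^ 2 + torusVol⁻¹ * ‖Z.J 1 2‖ ^ 2) := by
    unfold State.Eins
    ring
  rw [e]
  exact ((h _).add (h _)).add ((h _).add (h _))

/-- The `L²` norm grows no faster than the unstable part of the energy. -/
lemma exists_lebSq_le {c : Constants} (hc : c.Admissible) :
    ∃ d : ℝ, 0 < d ∧ ∃ C : ℝ, 0 < C ∧ ∀ (ψ : ℝ), 0 < ψ → ∀ (T : ℝ) (Z : ℝ → State) (p : ℝ → L2),
      IsSolution c T Z p → (∀ t ∈ Icc 0 T, (Z t).MemH 4 ∧ (Z t).sobSq ≤ d) →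
      ∀ Cins : ℝ, 0 < Cins → (∀ t ∈ Ioc 0 T, (Z t).Eins ≤ Cins * Real.exp (ψ * t)) →
      ∀ t ∈ Icc 0 T, (Z t).lebSq ≤ C * (1 + ψ⁻¹) * ((Z 0).sobSq + Cins) * Real.exp (ψ * t) := by
  obtain ⟨δ, hδ, C, hC, hrate⟩ := exists_energyRate_low hc c.precConst_ne_top
  obtain ⟨d₀, hd₀, hsmall⟩ := exists_small c
  have hs := sobConst_pos
  have hv := torusVol_pos
  have hsup := hc.massSup_pos
  have hinf := hc.massInf_pos
  refine ⟨min d₀ (δ / sobConst), lt_min hd₀ (by positivity),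
    c.massInf⁻¹ * (c.massSup + 2 * C), by positivity, ?_⟩
  intro ψ hψ T Z p hsol hZ Cins hCins hEins t ht
  have hae := hsol.ae_modeSystem hc (hsmall _ (min_le_left _ _)) hZ
  obtain ⟨K, hK⟩ := hsol.exists_lipschitz_energy (V := fun _ => 1) (B := 1) fun _ => le_rfl
  have hsub : Icc 0 t ⊆ Icc 0 T := Icc_subset_Icc_right ht.2
  -- The hypothesis on E_ins starts at positive times; the instant 0 is a null set for the integral.
  have hne : ∀ᵐ s ∂(volume.restrict (Icc 0 t)), s ≠ (0 : ℝ) :=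
    ae_restrict_of_ae (by simp [ae_iff])
  have hder : ∀ᵐ s ∂(volume.restrict (Icc 0 t)),
      deriv (fun s => energy c (fun _ => 1) (Z s)) s
        ≤ 2 * C * torusVol⁻¹ * Cins * Real.exp (ψ * s) := by
    filter_upwards [ae_restrict_of_ae_restrict_of_subset hsub hae, hne]
      with s ⟨hsT, m, mu, mw, mJ, hm⟩ hs0
    rw [(hm (fun _ => 1) 1 fun _ => le_rfl).deriv]
    obtain ⟨hH, hn⟩ := hZ s hsT
    have hle : ENNReal.ofReal (sobConst * (Z s).sobSq) ≤ ENNReal.ofReal δ := by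
      refine ENNReal.ofReal_le_ofReal ?_
      have := hn.trans (min_le_right _ _)
      rwa [le_div_iff₀ hs, mul_comm] at this
    have h1 := hrate m (by rw [mw]; exact (State.sqs_sob_ω hH).trans hle)
      (by rw [mJ]; exact (State.sqs_sob_J hH).trans hle)
    rw [mw, mJ, (hasSum_Eins (Z s)).tsum_eq] at h1
    have h2 := hEins s ⟨lt_of_le_of_ne hsT.1 (Ne.symm hs0), hsT.2⟩
    calc 2 * m.energyRate (fun _ => 1) ≤ 2 * (C * (torusVol⁻¹ * (Z s).Eins)) := by gcongr
      _ ≤ 2 * (C * (torusVol⁻¹ * (Cins * Real.exp (ψ * s)))) := by gcongr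
      _ = _ := by ring
  have h1 := le_add_integral_of_deriv_le ht.1 (hK.mono hsub) (by fun_prop) hder
  have h2 := integral_mul_exp_le (t := t) (a := 2 * C * torusVol⁻¹ * Cins) (by positivity) hψ
  have h3 := le_energy c (fun _ => 1) (Z t)
  have h4 := energy_le hc (fun _ => 1) (Z 0)
  rw [plainEnergy_one] at h3 h4
  have h5 := (Z 0).lebSq_le_sobSq
  have h6 := (Z 0).sobSq_nonneg
  have h7 : 1 ≤ Real.exp (ψ * t) := Real.one_le_exp (mul_nonneg hψ.le ht.1)
  set X := Real.exp (ψ * t) with hX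
  have h8 : c.massInf * (torusVol⁻¹ * (Z t).lebSq)
      ≤ c.massSup * (torusVol⁻¹ * (Z 0).sobSq) * X + 2 * C * torusVol⁻¹ * Cins * ψ⁻¹ * X := by
    have e1 : c.massSup * (torusVol⁻¹ * (Z 0).lebSq) ≤ c.massSup * (torusVol⁻¹ * (Z 0).sobSq) := by
      gcongr
    have e2 : c.massSup * (torusVol⁻¹ * (Z 0).sobSq)
        ≤ c.massSup * (torusVol⁻¹ * (Z 0).sobSq) * X := le_mul_of_one_le_right (by positivity) h7
    linarith
  have h9 : (Z t).lebSq ≤ c.massInf⁻¹ * (c.massSup * (Z 0).sobSq + 2 * C * Cins * ψ⁻¹) * X := by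
    have e : (Z t).lebSq = c.massInf⁻¹ * torusVol * (c.massInf * (torusVol⁻¹ * (Z t).lebSq)) := by
      field_simp
    rw [e]
    calc _ ≤ c.massInf⁻¹ * torusVol * (c.massSup * (torusVol⁻¹ * (Z 0).sobSq) * X
          + 2 * C * torusVol⁻¹ * Cins * ψ⁻¹ * X) := by gcongr
      _ = _ := by field_simp
  refine h9.trans (mul_le_mul_of_nonneg_right ?_ (zero_le_one.trans h7))
  rw [mul_assoc c.massInf⁻¹, mul_assoc c.massInf⁻¹]
  refine mul_le_mul_of_nonneg_left ?_ (inv_nonneg.mpr hinf.le)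
  have e1 : 0 ≤ 2 * C * (Z 0).sobSq := by positivity
  have e2 : 0 ≤ (c.massSup + 2 * C) * ψ⁻¹ * (Z 0).sobSq := by positivity
  have e3 : 0 ≤ (c.massSup + 2 * C) * Cins := by positivity
  have e4 : 0 ≤ c.massSup * ψ⁻¹ * Cins := by positivity
  nlinarith

/-- Control of the supremum of a bounded function through a self-improving bound. -/
lemma le_two_mul_of_self_improving {F : ℝ → ℝ} {t A B : ℝ}
    (hB : ∀ s ∈ Icc 0 t, F s ≤ B) (h0 : ∀ s ∈ Icc 0 t, 0 ≤ F s)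
    (h : ∀ S, 0 ≤ S → (∀ s ∈ Icc 0 t, F s ≤ S) → ∀ r ∈ Icc 0 t, F r ≤ S / 2 + A) :
    ∀ r ∈ Icc 0 t, F r ≤ 2 * A := by
  intro r hr
  -- The a priori bound B only makes the supremum finite and does not enter the conclusion. No
  -- continuity of F is used.
  have hbdd : BddAbove (F '' Icc 0 t) := ⟨B, by rintro _ ⟨s, hs, rfl⟩; exact hB s hs⟩
  have hle : ∀ s ∈ Icc 0 t, F s ≤ sSup (F '' Icc 0 t) := fun s hs => le_csSup hbdd ⟨s, hs, rfl⟩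
  have hS : sSup (F '' Icc 0 t) ≤ sSup (F '' Icc 0 t) / 2 + A := by
    refine csSup_le ⟨_, r, hr, rfl⟩ ?_
    rintro _ ⟨s, hs, rfl⟩
    exact h _ ((h0 r hr).trans (hle r hr)) hle s hs
  have := hle r hr
  linarith

/-- Integration of the `H⁴` energy balance under exponential bounds on the norms. -/
lemma exists_sobSq_le {c : Constants} (hc : c.Admissible) :
    ∃ d : ℝ, 0 < d ∧ ∃ C : ℝ, 0 < C ∧ ∀ (ψ : ℝ), 0 < ψ → ∀ (T : ℝ) (Z : ℝ → State) (p : ℝ → L2),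
      IsSolution c T Z p → (∀ t ∈ Icc 0 T, (Z t).MemH 4 ∧ (Z t).sobSq ≤ d) →
      ∀ (η τ S A : ℝ), 0 < η → η ≤ 1 → 0 < τ → 0 ≤ S → 0 ≤ A → ∀ t ∈ Icc 0 T,
      (∀ s ∈ Icc 0 t, (Z s).sobSq ≤ S * Real.exp (ψ * s)) →
      (∀ s ∈ Icc 0 t, (Z s).lebSq ≤ A * Real.exp (ψ * s)) →
      (∀ s ∈ Icc 0 t, τ * (sobConst * (Z s).sobSq) + τ⁻¹ ^ 3 * (lebConst * (Z s).lebSq) ≤ η ^ 2) →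
      (Z t).sobSq ≤ C * ((Z 0).sobSq + ψ⁻¹ * (η * S + η⁻¹ ^ 3 * A)) * Real.exp (ψ * t) := by
  obtain ⟨δ, hδ, C, hC, hrate⟩ := exists_energyRate_high hc c.precConst_ne_top
  obtain ⟨d₀, hd₀, hsmall⟩ := exists_small c
  have hs := sobConst_pos
  have hl := lebConst_pos
  have hv := torusVol_pos
  have hsup := hc.massSup_pos
  have hinf := hc.massInf_pos
  refine ⟨min d₀ (δ / sobConst), lt_min hd₀ (by positivity),
    15 * torusVol * c.massInf⁻¹ * (c.massSup * (2048 / torusVol) + 4 * C * (sobConst + lebConst)),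
    by positivity, ?_⟩
  intro ψ hψ T Z p hsol hZ η τ S A hη hη1 hτ hS hA t ht hSob hLeb hint
  have hae := hsol.ae_modeSystem hc (hsmall _ (min_le_left _ _)) hZ
  have hsub : Icc 0 t ⊆ Icc 0 T := Icc_subset_Icc_right ht.2
  set R := 2 * C * (2 * η * sobConst * S + η⁻¹ ^ 3 * lebConst * A) with hR
  have hR0 : 0 ≤ R := by positivity
  have hder : ∀ N : ℕ, ∀ᵐ s ∂(volume.restrict (Icc 0 t)),
      deriv (fun s => energy c (fun k => trunc N k ^ 4) (Z s)) s ≤ R * Real.exp (ψ * s) := by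
    intro N
    filter_upwards [ae_restrict_of_ae_restrict_of_subset hsub hae,
      ae_restrict_mem measurableSet_Icc] with s ⟨hsT, m, mu, mw, mJ, hm⟩ hst
    rw [(hm (fun k => trunc N k ^ 4) (N ^ 4) fun k => Nat.pow_le_pow_left (trunc_le N k) 4).deriv]
    obtain ⟨hH, hn⟩ := hZ s hsT
    set h₄ := sobConst * (Z s).sobSq with hh₄
    set h₀ := lebConst * (Z s).lebSq with hh₀
    have h40 : 0 ≤ h₄ := mul_nonneg hs.le (Z s).sobSq_nonneg
    have h00 : 0 ≤ h₀ := mul_nonneg hl.le (Z s).lebSq_nonneg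
    have hle : h₄ ≤ δ := by
      have := hn.trans (min_le_right _ _)
      rwa [le_div_iff₀ hs, mul_comm] at this
    -- The interpolated value yields the smallness h₃ ≤ η²; the minimum with h₄ secures h₃ ≤ h₄,
    -- which interpolation alone does not give.
    set h₃ := min (τ * h₄ + τ⁻¹ ^ 3 * h₀) h₄ with hh₃
    have cube : ∀ f : Freq → ℝ≥0∞, sqs f ≤ ENNReal.ofReal h₀ →
        sqs (fun k => (wt k : ℝ≥0∞) ^ 4 * f k) ≤ ENNReal.ofReal h₄ →
        sqs (fun k => (wt k : ℝ≥0∞) ^ 3 * f k) ≤ ENNReal.ofReal h₃ := by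
      intro f f0 f4
      rw [hh₃, ENNReal.ofReal_min]
      exact le_min (sqs_wt_cube_le_interp hτ h00 h40 f0 f4)
        ((sqs_wt_pow_mono (by norm_num) f).trans f4)
    have u4 := State.sqs_sob_u hH
    have w4 := State.sqs_sob_ω hH
    have J4 := State.sqs_sob_J hH
    have hb : m.Bounds h₃ h₄ := by
      refine ⟨?_, ?_, ?_, ?_, ?_, ?_⟩
      · rw [mu]; exact cube _ (Z s).sqs_leb_u u4
      · rw [mw]; exact cube _ (Z s).sqs_leb_ω w4
      · rw [mJ]; exact cube _ (Z s).sqs_leb_J J4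
      · rw [mu]; exact u4
      · rw [mw]; exact w4
      · rw [mJ]; exact J4
    have h1 := hrate m N h₃ h₄ η hb (le_min (by positivity) h40) (min_le_right _ _) hle hη hη1
      ((min_le_left _ _).trans (hint s hst))
    -- A second interpolation, now with parameter η: for this term it is not smallness that matters
    -- but a coefficient η in front of the H⁴ energy.
    have h2 : (sqs (fun k => (wt k : ℝ≥0∞) ^ 3 * mag9 m.J k)).toReal
        ≤ η * h₄ + η⁻¹ ^ 3 * h₀ := by
      rw [mJ]
      exact ENNReal.toReal_le_of_le_ofReal (by positivity)
        (sqs_wt_cube_le_interp hη h00 h40 (Z s).sqs_leb_J J4)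
    have h3 : h₄ ≤ sobConst * (S * Real.exp (ψ * s)) :=
      mul_le_mul_of_nonneg_left (hSob s hst) hs.le
    have h4 : h₀ ≤ lebConst * (A * Real.exp (ψ * s)) :=
      mul_le_mul_of_nonneg_left (hLeb s hst) hl.le
    calc 2 * m.energyRate (fun k => trunc N k ^ 4)
        ≤ 2 * (C * (η * h₄ + (η * h₄ + η⁻¹ ^ 3 * h₀))) := by
          refine mul_le_mul_of_nonneg_left (h1.trans ?_) (by norm_num)
          gcongr
      _ ≤ 2 * (C * (η * (sobConst * (S * Real.exp (ψ * s)))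
            + (η * (sobConst * (S * Real.exp (ψ * s)))
              + η⁻¹ ^ 3 * (lebConst * (A * Real.exp (ψ * s)))))) := by gcongr
      _ = _ := by rw [hR]; ring
  have h7 : 1 ≤ Real.exp (ψ * t) := Real.one_le_exp (mul_nonneg hψ.le ht.1)
  have h6 := (Z 0).sobSq_nonneg
  set X := Real.exp (ψ * t) with hX
  have hT : (0 : ℝ) ≤ T := ht.1.trans ht.2
  -- The right-hand side does not depend on N, so the truncation can be removed at time t.
  have hplain : ∀ N : ℕ, plainEnergy (fun k => trunc N k ^ 4) (Z t)
      ≤ c.massInf⁻¹ * (c.massSup * (2048 / torusVol * (Z 0).sobSq) + R * ψ⁻¹) * X := by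
    intro N
    obtain ⟨K, hK⟩ := hsol.exists_lipschitz_energy (V := fun k => trunc N k ^ 4) (B := N ^ 4)
      fun k => Nat.pow_le_pow_left (trunc_le N k) 4
    have h1 := le_add_integral_of_deriv_le ht.1 (hK.mono hsub) (by fun_prop) (hder N)
    have h2 := integral_mul_exp_le (t := t) hR0 hψ
    have h3 := le_energy c (fun k => trunc N k ^ 4) (Z t)
    have h4 := energy_le hc (fun k => trunc N k ^ 4) (Z 0)
    have h5 : c.massSup * plainEnergy (fun k => trunc N k ^ 4) (Z 0)
        ≤ c.massSup * (2048 / torusVol * (Z 0).sobSq) :=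
      mul_le_mul_of_nonneg_left (plainEnergy_trunc_le (hZ 0 ⟨le_rfl, hT⟩).1 N) hsup.le
    have h8 : c.massSup * (2048 / torusVol * (Z 0).sobSq)
        ≤ c.massSup * (2048 / torusVol * (Z 0).sobSq) * X :=
      le_mul_of_one_le_right (by positivity) h7
    have e : plainEnergy (fun k => trunc N k ^ 4) (Z t)
        = c.massInf⁻¹ * (c.massInf * plainEnergy (fun k => trunc N k ^ 4) (Z t)) := by
      rw [← mul_assoc, inv_mul_cancel₀ hinf.ne', one_mul]
    rw [e, mul_assoc]
    refine mul_le_mul_of_nonneg_left ?_ (inv_nonneg.mpr hinf.le)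
    rw [add_mul]
    linarith
  refine (sobSq_le_of_plainEnergy_le (hZ t ht).1 hplain).trans ?_
  have e1 : 15 * torusVol * (c.massInf⁻¹ * (c.massSup * (2048 / torusVol * (Z 0).sobSq)
      + R * ψ⁻¹) * X) = 15 * torusVol * c.massInf⁻¹ * (c.massSup * (2048 / torusVol) * (Z 0).sobSq
      + R * ψ⁻¹) * X := by ring
  rw [e1, mul_assoc (15 * torusVol * c.massInf⁻¹) (_ + _) ((Z 0).sobSq + _)]
  gcongr
  rw [hR]
  set P := c.massSup * (2048 / torusVol) with hP
  have hP0 : 0 ≤ P := by positivity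
  set Q := η⁻¹ ^ 3 with hQ
  have hQ0 : 0 ≤ Q := by positivity
  have hi : 0 < ψ⁻¹ := inv_pos.mpr hψ
  have e2 : (P + 4 * C * (sobConst + lebConst)) * ((Z 0).sobSq + ψ⁻¹ * (η * S + Q * A))
      = P * (Z 0).sobSq + 2 * C * (2 * η * sobConst * S + Q * lebConst * A) * ψ⁻¹
        + (P * (ψ⁻¹ * (η * S + Q * A)) + 4 * C * (sobConst + lebConst) * (Z 0).sobSq
          + 4 * C * ψ⁻¹ * (lebConst * (η * S) + sobConst * (Q * A))
          + 2 * C * ψ⁻¹ * lebConst * (Q * A)) := by ring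
  rw [e2]
  exact le_add_of_nonneg_right (by positivity)

end Micropolar

end

open Micropolar in
theorem mainTheorem4 (c : Constants) (hc : c.Admissible) :
    ∃ δB : ℝ, 0 < δB ∧ δB < 1 ∧
      ∀ ψ : ℝ, 0 < ψ → ∃ C : ℝ, 0 < C ∧
        ∀ (T : ℝ) (Z : ℝ → State) (p : ℝ → L2), 0 < T → IsSolution c T Z p →
          (∀ t ∈ Set.Icc 0 T, (Z t).MemH 4 ∧ (Z t).normH 4 ≤ δB) →
          ∀ Cins : ℝ, 0 < Cins →
            (∀ t ∈ Set.Ioc 0 T, (Z t).Eins ≤ Cins * Real.exp (ψ * t)) →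
            ∀ t ∈ Set.Icc 0 T,
              (Z t).normH 4 ^ 2 ≤ C * ((Z 0).normH 4 ^ 2 + Cins) * Real.exp (ψ * t) := by
  obtain ⟨d₁, hd₁, C₁, hC₁, hleb⟩ := exists_lebSq_le hc
  obtain ⟨d₂, hd₂, C₂, hC₂, hsob⟩ := exists_sobSq_le hc
  have hδ0 : 0 < min (1 / 2) (min d₁ d₂) := lt_min (by norm_num) (lt_min hd₁ hd₂)
  have hδ1 : min (1 / 2) (min d₁ d₂) < 1 := lt_of_le_of_lt (min_le_left _ _) (by norm_num)
  refine ⟨min (1 / 2) (min d₁ d₂), hδ0, hδ1, fun ψ hψ => ?_⟩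
  have hs := sobConst_pos
  have hl := lebConst_pos
  have hi : 0 < ψ⁻¹ := inv_pos.mpr hψ
  set CA := C₁ * (1 + ψ⁻¹) with hCA
  have hCA0 : 0 < CA := by positivity
  -- Chosen so that the term returning the supremum, C₂ ψ⁻¹ η S, is at most S/2.
  set η := min 1 (ψ / (2 * C₂)) with hη
  have hη0 : 0 < η := lt_min one_pos (by positivity)
  have hη1 : η ≤ 1 := min_le_left _ _
  have hη2 : C₂ * (ψ⁻¹ * η) ≤ 1 / 2 := by
    calc C₂ * (ψ⁻¹ * η) ≤ C₂ * (ψ⁻¹ * (ψ / (2 * C₂))) := by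
          gcongr
          exact min_le_right _ _
      _ = 1 / 2 := by field_simp
  -- With the squared H⁴ norm at most 1, the high-frequency part of the interpolation is at most
  -- η²/2.
  set τ := η ^ 2 / (2 * sobConst) with hτ
  have hτ0 : 0 < τ := by positivity
  -- The threshold for M e^{ψt} below which the L² bound makes the low-frequency part at most η²/2.
  -- It depends on ψ, while δ_B does not.
  set ε := η ^ 2 / (2 * (τ⁻¹ ^ 3 * lebConst * CA)) with hε
  have hε0 : 0 < ε := by positivity
  set A := C₂ * (1 + ψ⁻¹ * (η⁻¹ ^ 3 * CA)) with hA
  have hA0 : 0 < A := by positivity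
  refine ⟨ε⁻¹ + 2 * A, by positivity, ?_⟩
  intro T Z p hT hsol hZ Cins hCins hEins t ht
  simp only [State.normH_sq]
  have hZ' : ∀ t ∈ Icc 0 T, (Z t).MemH 4 ∧ (Z t).sobSq ≤ min (1 / 2) (min d₁ d₂) := by
    intro t ht
    obtain ⟨h1, h2⟩ := hZ t ht
    refine ⟨h1, ?_⟩
    rw [← State.normH_sq]
    have h0 : 0 ≤ (Z t).normH 4 := Real.sqrt_nonneg _
    -- Since δ_B < 1, the squared norm satisfies δ_B² ≤ δ_B, so the bounds d₁ and d₂ on `sobSq`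
    -- hold.
    nlinarith
  have hY1 : ∀ t ∈ Icc 0 T, (Z t).sobSq ≤ 1 := fun t ht => (hZ' t ht).2.trans hδ1.le
  have hL := hleb ψ hψ T Z p hsol (fun t ht => ⟨(hZ' t ht).1, (hZ' t ht).2.trans
    ((min_le_right _ _).trans (min_le_left _ _))⟩) Cins hCins hEins
  have hS := hsob ψ hψ T Z p hsol (fun t ht => ⟨(hZ' t ht).1, (hZ' t ht).2.trans
    ((min_le_right _ _).trans (min_le_right _ _))⟩) η τ
  rw [← hCA] at hL
  have hY0 := (Z 0).sobSq_nonneg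
  set M := (Z 0).sobSq + Cins with hM
  have hM0 : 0 < M := by positivity
  have hX := Real.exp_pos (ψ * t)
  -- Above the threshold the claimed bound exceeds 1, which already bounds the squared norm; this is
  -- the role of ε⁻¹ in the constant.
  by_cases hcase : ε ≤ M * Real.exp (ψ * t)
  · calc (Z t).sobSq ≤ 1 := hY1 t ht
      _ = ε⁻¹ * ε := (inv_mul_cancel₀ hε0.ne').symm
      _ ≤ ε⁻¹ * (M * Real.exp (ψ * t)) := by gcongr
      _ ≤ (ε⁻¹ + 2 * A) * (M * Real.exp (ψ * t)) := by
          gcongr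
          linarith
      _ = _ := by ring
  · rw [not_le] at hcase
    -- Below the threshold the bootstrap runs on the norm with its exponential growth divided out.
    -- Any bound S for it improves to S/2 + A M, so 2 A M is a bound.
    have hF := le_two_mul_of_self_improving (F := fun s => (Z s).sobSq * Real.exp (-(ψ * s)))
      (t := t) (A := A * M) (B := 1) ?_ ?_ ?_ t ⟨ht.1, le_rfl⟩
    · have h1 : (Z t).sobSq = (Z t).sobSq * Real.exp (-(ψ * t)) * Real.exp (ψ * t) := by
        rw [mul_assoc, ← Real.exp_add, neg_add_cancel, Real.exp_zero, mul_one]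
      rw [h1]
      refine mul_le_mul_of_nonneg_right (hF.trans ?_) hX.le
      have : 0 ≤ ε⁻¹ * M := by positivity
      linarith
    · intro s hs'
      have h1 : Real.exp (-(ψ * s)) ≤ 1 := Real.exp_le_one_iff.mpr (by
        have := mul_nonneg hψ.le hs'.1
        linarith)
      exact mul_le_one₀ (hY1 s ⟨hs'.1, hs'.2.trans ht.2⟩) (Real.exp_pos _).le h1
    · intro s _
      exact mul_nonneg (Z s).sobSq_nonneg (Real.exp_pos _).le
    · intro S hS0 hSle r hr
      have hrT : r ∈ Icc 0 T := ⟨hr.1, hr.2.trans ht.2⟩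
      have h1 := hS S (CA * M) hη0 hη1 hτ0 hS0 (by positivity) r hrT ?_ ?_ ?_
      · have h2 : (Z r).sobSq * Real.exp (-(ψ * r))
            ≤ C₂ * ((Z 0).sobSq + ψ⁻¹ * (η * S + η⁻¹ ^ 3 * (CA * M))) := by
          calc _ ≤ C₂ * ((Z 0).sobSq + ψ⁻¹ * (η * S + η⁻¹ ^ 3 * (CA * M))) * Real.exp (ψ * r)
                * Real.exp (-(ψ * r)) := mul_le_mul_of_nonneg_right h1 (Real.exp_pos _).le
            _ = _ := by
                rw [mul_assoc _ (Real.exp (ψ * r)), ← Real.exp_add, add_neg_cancel, Real.exp_zero,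
                  mul_one]
        refine h2.trans ?_
        have h3 : C₂ * (ψ⁻¹ * η) * S ≤ 1 / 2 * S := by gcongr
        have h4 : C₂ * (Z 0).sobSq ≤ C₂ * M := by
          gcongr
          rw [hM]
          linarith
        have h5 : C₂ * ((Z 0).sobSq + ψ⁻¹ * (η * S + η⁻¹ ^ 3 * (CA * M)))
            = C₂ * (Z 0).sobSq + C₂ * (ψ⁻¹ * η) * S + C₂ * (ψ⁻¹ * (η⁻¹ ^ 3 * CA)) * M := by ring
        have h6 : A * M = C₂ * M + C₂ * (ψ⁻¹ * (η⁻¹ ^ 3 * CA)) * M := by rw [hA]; ring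
        rw [h5, h6]
        linarith
      · intro s hs'
        have h2 := hSle s ⟨hs'.1, hs'.2.trans hr.2⟩
        calc (Z s).sobSq = (Z s).sobSq * Real.exp (-(ψ * s)) * Real.exp (ψ * s) := by
              rw [mul_assoc, ← Real.exp_add, neg_add_cancel, Real.exp_zero, mul_one]
          _ ≤ _ := mul_le_mul_of_nonneg_right h2 (Real.exp_pos _).le
      · exact fun s hs' => hL s ⟨hs'.1, hs'.2.trans hrT.2⟩
      · intro s hs'
        have hsT : s ∈ Icc 0 T := ⟨hs'.1, hs'.2.trans hrT.2⟩
        have h2 : τ * (sobConst * (Z s).sobSq) ≤ η ^ 2 / 2 := by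
          calc τ * (sobConst * (Z s).sobSq) ≤ τ * (sobConst * 1) := by
                gcongr
                exact hY1 s hsT
            _ = η ^ 2 / 2 := by rw [hτ]; field_simp
        -- The exponential is increasing, so being below the threshold at t carries over to all
        -- earlier times.
        have h3 : M * Real.exp (ψ * s) ≤ ε := by
          refine le_trans ?_ hcase.le
          gcongr
          exact hs'.2.trans hr.2
        have h4 : τ⁻¹ ^ 3 * (lebConst * (Z s).lebSq) ≤ η ^ 2 / 2 := by
          calc τ⁻¹ ^ 3 * (lebConst * (Z s).lebSq)
              ≤ τ⁻¹ ^ 3 * (lebConst * (CA * M * Real.exp (ψ * s))) := by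
                gcongr
                exact hL s hsT
            _ = τ⁻¹ ^ 3 * lebConst * CA * (M * Real.exp (ψ * s)) := by ring
            _ ≤ τ⁻¹ ^ 3 * lebConst * CA * ε := by gcongr
            _ = η ^ 2 / 2 := by rw [hε]; field_simp
        linarith
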